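/- Let $\alpha\in(0,1)$, $T>0$, $\Omega=(0,1)\times(0,1)$ with points $z=(\theta,r)$, $Q=\Omega\times(0,T)$, $w=r^\alpha$, $A=\mathrm{diag}(1,r^\alpha)$, $\mathcal A u=-\mathrm{div}(A\nabla u)$ (in the sense of distributions), $\Gamma_2^1=\{(\theta,r)\in\overline\Omega: r=1\}$ and $\Omega^\sharp_{1/8}=(\tfrac18,\tfrac78)\times(\tfrac18,1)$. Let $H^1(\Omega;w)$ be the space of $u\in L^2(\Omega)$ with weak gradient satisfying $\int_\Omega A\nabla u\cdot\nabla u\,dz<\infty$, with norm $\|u\|_{H^1(\Omega;w)}^2=\int_\Omega (u^2+A\nabla u\cdot\nabla u)\,dz$; let $H^1_0(\Omega;w)$ be the closure of $C_c^\infty(\Omega)$ in it, with the inner product $(u,v)_{H_0^1(\Omega;w)}=\int_\Omega A\nabla u\cdot\nabla v\,dz$ and the corresponding (equivalent) norm $\|\cdot\|_{H^1_0(\Omega;w)}$; let $H^{-1}(\Omega;w)$ be its dual; and let $D(\mathcal A)=\{u\in H^1_0(\Omega;w):\mathcal A u\in L^2(\Omega)\}$ with $\|u\|_{D(\mathcal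 A)}^2=\|u\|_{H^1(\Omega;w)}^2+\|\mathcal A u\|_{L^2(\Omega)}^2$. For $\varphi^0\in H_0^1(\Omega;w)$, $\varphi^1\in L^2(\Omega)$ and $f\in L^2(Q)=L^2(0,T;L^2(\Omega))$, a weak solution of $$\partial_{tt}\varphi-\mathrm{div}(A\nabla\varphi)=f\ \text{in } Q,\qquad \varphi=0\ \text{on }\partial\Omega\times(0,T),\qquad \varphi(0)=\varphi^0,\ \partial_t\varphi(0)=\varphi^1\ \text{in }\Omega,$$ is a function $\varphi\in L^2(0,T;H_0^1(\Omega;w))\cap H^1(0,T;L^2(\Omega))\cap H^2(0,T;H^{-1}(\Omega;w))$ such that for each $v\in H^1_0(\Omega;w)$ and a.e. $t\in[0,T]$ $$\langle\partial_{tt}\varphi,v\rangle_{H^{-1}(\Omega;w),H_0^1(\Omega;w)}+(\varphi,v)_{H_0^1(\Omega;w)}=(f,v)_{L^2(\Omega)},$$ and $\varphi(0)=\varphi^0$, $\partial_t\varphi(0)=\varphi^1$, the values at $0$ being those of the representatives in $C([0,T];L^2(\Omega))$ and $C([0,T];H^{-1}(\Omega;w))$. Then: (1) For all $\varphi^0\in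 H_0^1(\Omega;w)$, $\varphi^1\in L^2(\Omega)$, $f\in L^2(Q)$ there is a unique weak solution $\varphi$. (2) There is a constant $C>0$, depending only on $\alpha$ and $T$, such that for all such data the derivative $\partial_r\varphi$ of the weak solution has a trace in $L^2(0,T;L^2(\Gamma_2^1))$, and $$\operatorname*{ess\,sup}_{t\in[0,T]}\bigl(\|\varphi(t)\|_{H_0^1(\Omega;w)}+\|\partial_t\varphi(t)\|_{L^2(\Omega)}\bigr)+\|\partial_{tt}\varphi\|_{L^2(0,T;H^{-1}(\Omega;w))}+\|\partial_r\varphi\|_{L^2(0,T;L^2(\Gamma_2^1))}\le C\bigl(\|\varphi^0\|_{H^1_0(\Omega;w)}+\|\varphi^1\|_{L^2(\Omega)}+\|f\|_{L^2(Q)}\bigr).$$ Here $g\in L^2(0,T;L^2(\Gamma_2^1))$ is the trace of $\partial_r\varphi$ if $\frac1h\int_{1-h}^1\partial_r\varphi(\cdot,r,\cdot)\,dr\to g$ as $h\to0^+$ in the sense of distributions on $(0,1)\times(0,T)$; such a $g$ is unique. (3) There is a constant $C>0$, depending only on $\alpha$ and $T$, such that if $\varphi^0\in D(\mathcal A)$,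 $\varphi^1\in H_0^1(\Omega;w)$ and $f\in H^1(0,T;L^2(\Omega))$, then the weak solution satisfies, for a.e. $t\in(0,T)$, $\varphi(t)\in D(\mathcal A)$, $\varphi(t)|_{\Omega^\sharp_{1/8}}\in H^2(\Omega^\sharp_{1/8})$, $\partial_t\varphi(t)\in H_0^1(\Omega;w)$, $\partial_{tt}\varphi(t)\in L^2(\Omega)$, and $$\operatorname*{ess\,sup}_{t\in[0,T]}\bigl(\|\varphi(t)\|_{H^2(\Omega^\sharp_{1/8})}+\|\varphi(t)\|_{D(\mathcal A)}+\|\partial_t\varphi(t)\|_{H_0^1(\Omega;w)}+\|\partial_{tt}\varphi(t)\|_{L^2(\Omega)}\bigr)\le C\bigl(\|\varphi^0\|_{D(\mathcal A)}+\|\varphi^1\|_{H_0^1(\Omega;w)}+\|f\|_{H^1(0,T;L^2(\Omega))}\bigr).$$ -/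

import Mathlib

open MeasureTheory Set Filter Topology
open scoped ENNReal ContDiff

namespace DegenerateWave

noncomputable section

/-- `ψ ∈ C_c^∞(U)`: smooth, with compact support contained in `U`. -/
def IsTest {E : Type*} [NormedAddCommGroup E] [NormedSpace ℝ E] (U : Set E) (ψ : E → ℝ) : Prop :=
  ContDiff ℝ ∞ ψ ∧ HasCompactSupport ψ ∧ tsupport ψ ⊆ U

/-- `L²(U)` for a subset `U` of the plane with coordinates `z = (θ, r)`. -/
abbrev L2 (U : Set (ℝ × ℝ)) : Type := Lp ℝ 2 (volume.restrict U)

/-- The Bochner space `L²(0,T;X)`. -/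
abbrev L2t (T : ℝ) (X : Type*) [NormedAddCommGroup X] : Type _ :=
  Lp X 2 (volume.restrict (Ioo (0 : ℝ) T))

/-- The unit square; a point is `z = (z.1, z.2) = (θ, r)`. -/
def Ω : Set (ℝ × ℝ) := Ioo 0 1 ×ˢ Ioo 0 1

/-- The coordinate direction `θ`. -/
def eθ : ℝ × ℝ := (1, 0)

/-- The coordinate direction `r`. -/
def er : ℝ × ℝ := (0, 1)

/-- For `u`, `v` locally integrable on `U`: `v` is the weak derivative of `u` on `U` in the
direction `e`. -/
def IsWeakPartial (U : Set (ℝ × ℝ)) (e : ℝ × ℝ) (u v : ℝ × ℝ → ℝ) : Prop :=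
  ∀ ψ : ℝ × ℝ → ℝ, IsTest U ψ →
    ∫ z in U, u z * fderiv ℝ ψ z e = - ∫ z in U, v z * ψ z

section helpers

lemma IsTest.memLp {U : Set (ℝ × ℝ)} {ψ : ℝ × ℝ → ℝ} (h : IsTest U ψ) :
    MemLp ψ 2 (volume.restrict U) :=
  (h.1.continuous.memLp_of_hasCompactSupport h.2.1).restrict U

lemma IsTest.memLp_fderiv {U : Set (ℝ × ℝ)} {ψ : ℝ × ℝ → ℝ} (h : IsTest U ψ) (e : ℝ × ℝ) :
    MemLp (fun z => fderiv ℝ ψ z e) 2 (volume.restrict U) := by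
  have h1 : Continuous (fun z => fderiv ℝ ψ z e) :=
    (h.1.continuous_fderiv (by simp)).clm_apply continuous_const
  have h2 : HasCompactSupport (fun z => fderiv ℝ ψ z e) := h.2.1.fderiv_apply ℝ e
  exact (h1.memLp_of_hasCompactSupport h2).restrict U

lemma IsTest.memLp_weight {ψ : ℝ × ℝ → ℝ} (h : IsTest Ω ψ) (s : ℝ) :
    MemLp (fun z : ℝ × ℝ => z.2 ^ s * ψ z) 2 (volume.restrict Ω) := by
  have h1 : Continuous (fun z : ℝ × ℝ => z.2 ^ s * ψ z) := by
    rw [continuous_iff_continuousAt]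
    intro z
    by_cases hz : z ∈ tsupport ψ
    · have h0 : z.2 ≠ 0 := ne_of_gt (h.2.2 hz).2.1
      exact (continuousAt_snd.rpow_const (Or.inl h0)).mul h.1.continuous.continuousAt
    · have hev : (fun z : ℝ × ℝ => z.2 ^ s * ψ z) =ᶠ[𝓝 z] fun _ => (0 : ℝ) := by
        filter_upwards [(isClosed_tsupport ψ).isOpen_compl.mem_nhds hz] with y hy
        rw [image_eq_zero_of_notMem_tsupport hy, mul_zero]
      exact hev.continuousAt
  have h2 : HasCompactSupport (fun z : ℝ × ℝ => z.2 ^ s * ψ z) := h.2.1.mul_left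
  exact (h1.memLp_of_hasCompactSupport h2).restrict Ω

lemma IsTest.add {U : Set (ℝ × ℝ)} {ψ χ : ℝ × ℝ → ℝ} (h : IsTest U ψ) (h' : IsTest U χ) :
    IsTest U (fun z => ψ z + χ z) :=
  ⟨h.1.add h'.1, h.2.1.add h'.2.1,
    (tsupport_add ψ χ).trans (union_subset h.2.2 h'.2.2)⟩

lemma IsTest.const_mul {U : Set (ℝ × ℝ)} {ψ : ℝ × ℝ → ℝ} (h : IsTest U ψ) (c : ℝ) :
    IsTest U (fun z => c * ψ z) :=
  ⟨contDiff_const.mul h.1, h.2.1.mul_left,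
    (tsupport_mul_subset_right (f := fun _ => c) (g := ψ)).trans h.2.2⟩

lemma IsTest.zero {U : Set (ℝ × ℝ)} : IsTest U (fun _ : ℝ × ℝ => (0 : ℝ)) :=
  ⟨contDiff_const, HasCompactSupport.zero, by
    have : (fun _ : ℝ × ℝ => (0 : ℝ)) = 0 := rfl
    rw [this, tsupport_zero]; exact empty_subset _⟩

lemma integrable_coe_mul (u : L2 Ω) {g : ℝ × ℝ → ℝ} (hg : MemLp g 2 (volume.restrict Ω)) :
    Integrable (fun z => u z * g z) (volume.restrict Ω) :=
  (Lp.memLp u).integrable_mul hg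

end helpers

/-- The weighted Sobolev space `H¹(Ω;w)`, `w = r^α`: functions `u ∈ L²(Ω)` with a weak gradient
such that `A∇u·∇u = (∂_θ u)² + r^α (∂_r u)²` is integrable.  It is realised through the isometry
`u ↦ (u, ∂_θ u, r^{α/2} ∂_r u)` as a subspace of `L²(Ω)³`, so that the norm is
`‖u‖² = ∫ (u² + (∂_θ u)² + r^α (∂_r u)²)`. -/
def H1w (α : ℝ) : Submodule ℝ (PiLp 2 (fun _ : Fin 3 => L2 Ω)) where
  carrier := {x | IsWeakPartial Ω eθ (x 0) (x 1) ∧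
    IsWeakPartial Ω er (x 0) (fun z => z.2 ^ (-(α / 2)) * x 2 z)}
  zero_mem' := by
    have h0 : ((0 : L2 Ω) : ℝ × ℝ → ℝ) =ᵐ[volume.restrict Ω] 0 := Lp.coeFn_zero _ _ _
    have key : ∀ g : ℝ × ℝ → ℝ, ∫ z in Ω, (0 : L2 Ω) z * g z = 0 := by
      intro g
      rw [integral_congr_ae (g := fun _ => (0 : ℝ))]
      · simp
      · filter_upwards [h0] with z hz
        rw [hz, Pi.zero_apply, zero_mul]
    refine ⟨fun ψ _ => ?_, fun ψ _ => ?_⟩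
    · simp only [PiLp.zero_apply]
      rw [key, key, neg_zero]
    · simp only [PiLp.zero_apply]
      rw [key]
      have := key (fun z => z.2 ^ (-(α / 2)) * ψ z)
      rw [eq_comm, neg_eq_zero, ← this]
      congr 1
      funext z
      ring
  add_mem' := by
    rintro x y ⟨hx1, hx2⟩ ⟨hy1, hy2⟩
    have key : ∀ (i : Fin 3) (g : ℝ × ℝ → ℝ), MemLp g 2 (volume.restrict Ω) →
        ∫ z in Ω, (x + y) i z * g z = (∫ z in Ω, x i z * g z) + ∫ z in Ω, y i z * g z := by
      intro i g hg
      rw [← integral_add (integrable_coe_mul _ hg) (integrable_coe_mul _ hg)]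
      apply integral_congr_ae
      filter_upwards [Lp.coeFn_add (x i) (y i)] with z hz
      rw [PiLp.add_apply, hz, Pi.add_apply, add_mul]
    refine ⟨fun ψ hψ => ?_, fun ψ hψ => ?_⟩
    · rw [key 0 _ (hψ.memLp_fderiv eθ), key 1 _ hψ.memLp, hx1 ψ hψ, hy1 ψ hψ, neg_add]
    · have e : ∀ a : L2 Ω, ∫ z in Ω, z.2 ^ (-(α / 2)) * a z * ψ z =
          ∫ z in Ω, a z * (z.2 ^ (-(α / 2)) * ψ z) := by
        intro a
        congr 1
        funext z
        ring
      have hx := hx2 ψ hψ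
      have hy := hy2 ψ hψ
      rw [e] at hx hy
      rw [e, key 0 _ (hψ.memLp_fderiv er), key 2 _ (hψ.memLp_weight _), hx, hy, neg_add]
  smul_mem' := by
    rintro c x ⟨hx1, hx2⟩
    have key : ∀ (i : Fin 3) (g : ℝ × ℝ → ℝ),
        ∫ z in Ω, (c • x) i z * g z = c * ∫ z in Ω, x i z * g z := by
      intro i g
      rw [← integral_const_mul]
      apply integral_congr_ae
      filter_upwards [Lp.coeFn_smul c (x i)] with z hz
      rw [PiLp.smul_apply, hz, Pi.smul_apply, smul_eq_mul, mul_assoc]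
    refine ⟨fun ψ hψ => ?_, fun ψ hψ => ?_⟩
    · rw [key 0, key 1, hx1 ψ hψ, mul_neg]
    · have e : ∀ a : L2 Ω, ∫ z in Ω, z.2 ^ (-(α / 2)) * a z * ψ z =
          ∫ z in Ω, a z * (z.2 ^ (-(α / 2)) * ψ z) := by
        intro a
        congr 1
        funext z
        ring
      have hx := hx2 ψ hψ
      rw [e] at hx
      rw [e, key 0, key 2, hx, mul_neg]

/-- The elements of `H¹(Ω;w)` that are (a.e. equal to) functions in `C_c^∞(Ω)`. -/
def smoothPart (α : ℝ) : Submodule ℝ (H1w α) where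
  carrier := {x | ∃ ψ : ℝ × ℝ → ℝ, IsTest Ω ψ ∧ (x.1 0 : ℝ × ℝ → ℝ) =ᵐ[volume.restrict Ω] ψ}
  zero_mem' := ⟨fun _ => 0, IsTest.zero, Lp.coeFn_zero _ _ _⟩
  add_mem' := by
    rintro x y ⟨ψ, hψ, hx⟩ ⟨χ, hχ, hy⟩
    refine ⟨_, hψ.add hχ, ?_⟩
    filter_upwards [hx, hy, Lp.coeFn_add (x.1 0) (y.1 0)] with z h1 h2 h3
    simp only [Submodule.coe_add, PiLp.add_apply]
    rw [h3, Pi.add_apply, h1, h2]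
  smul_mem' := by
    rintro c x ⟨ψ, hψ, hx⟩
    refine ⟨_, hψ.const_mul c, ?_⟩
    filter_upwards [hx, Lp.coeFn_smul c (x.1 0)] with z h1 h2
    simp only [Submodule.coe_smul, PiLp.smul_apply]
    rw [h2, Pi.smul_apply, h1, smul_eq_mul]

/-- `H₀¹(Ω;w)` as a subspace: the closure of `C_c^∞(Ω)` in `H¹(Ω;w)`. -/
def H01sub (α : ℝ) : Submodule ℝ (H1w α) := (smoothPart α).topologicalClosure

/-- The space `H₀¹(Ω;w)`; its norm as a type is the one inherited from `H¹(Ω;w)`. -/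
def H01 (α : ℝ) : Type := H01sub α

instance (α : ℝ) : NormedAddCommGroup (H01 α) := inferInstanceAs (NormedAddCommGroup (H01sub α))

instance (α : ℝ) : InnerProductSpace ℝ (H01 α) :=
  inferInstanceAs (InnerProductSpace ℝ (H01sub α))

/-- The dual space `H⁻¹(Ω;w)` of `H₀¹(Ω;w)`. -/
abbrev Hneg1 (α : ℝ) : Type := H01 α →L[ℝ] ℝ

section accessors

variable {α : ℝ}

/-- The inclusion of `H₀¹(Ω;w)` in `H¹(Ω;w)`. -/
def incl : H01 α →L[ℝ] H1w α := (H01sub α).subtypeL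

/-- The continuous embedding of `H₀¹(Ω;w)` into `L²(Ω)`. -/
def val : H01 α →L[ℝ] L2 Ω :=
  (PiLp.proj 2 (fun _ : Fin 3 => L2 Ω) 0).comp ((H1w α).subtypeL.comp incl)

/-- `∂_θ u`. -/
def dθ (u : H01 α) : L2 Ω := (incl u).1 1

/-- The weighted radial derivative `r^{α/2} ∂_r u`. -/
def wdr (u : H01 α) : L2 Ω := (incl u).1 2

/-- The radial derivative `∂_r u`, as a function on `Ω`. -/
def dr (u : H01 α) (z : ℝ × ℝ) : ℝ := z.2 ^ (-(α / 2)) * wdr u z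

/-- The inner product `(u, v)_{H₀¹(Ω;w)} = ∫_Ω A∇u·∇v`, `A = diag(1, r^α)`. -/
def energyInner (u v : H01 α) : ℝ :=
  ∫ z in Ω, (dθ u z * dθ v z + z.2 ^ α * (dr u z * dr v z))

/-- The norm `‖u‖_{H₀¹(Ω;w)} = (∫_Ω A∇u·∇u)^{1/2}`. -/
def energyNorm (u : H01 α) : ℝ := Real.sqrt (energyInner u u)

/-- The embedding `L²(Ω) → H⁻¹(Ω;w)`, `h ↦ (h, ·)_{L²(Ω)}`. -/
def toHneg1 (h : L2 Ω) : Hneg1 α := (innerSL ℝ h).comp val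

/-- The norm of `H⁻¹(Ω;w)` dual to `‖·‖_{H₀¹(Ω;w)}`. -/
def hneg1Norm (ℓ : Hneg1 α) : ℝ≥0∞ := ⨆ (v : H01 α) (_ : energyNorm v ≤ 1), ‖ℓ v‖ₑ

/-- `h ∈ L²(Ω)` is `𝒜u = -div(A∇u)` in the sense of distributions on `Ω`. -/
def IsA (u : H01 α) (h : L2 Ω) : Prop :=
  ∀ ψ : ℝ × ℝ → ℝ, IsTest Ω ψ →
    ∫ z in Ω, (dθ u z * fderiv ℝ ψ z eθ + z.2 ^ α * (dr u z * fderiv ℝ ψ z er)) =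
      ∫ z in Ω, h z * ψ z

/-- Membership in `D(𝒜) = H²(Ω;w) ∩ H₀¹(Ω;w)`. -/
def MemDA (u : H01 α) : Prop := ∃ h : L2 Ω, IsA u h

/-- The norm of `D(𝒜)`, `(‖u‖²_{H¹(Ω;w)} + ‖𝒜u‖²_{L²(Ω)})^{1/2}`, with the value `∞` when
`u ∉ D(𝒜)`. -/
def normDA (u : H01 α) : ℝ≥0∞ :=
  ⨅ (h : L2 Ω) (_ : IsA u h), ENNReal.ofReal (Real.sqrt (‖u‖ ^ 2 + ‖h‖ ^ 2))

/-- The norm of `H₀¹(Ω;w)` extended to `L²(Ω)` by `∞`. -/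
def normH01 (α : ℝ) (u : L2 Ω) : ℝ≥0∞ :=
  ⨅ (v : H01 α) (_ : val v = u), ENNReal.ofReal (energyNorm v)

/-- The norm of `L²(Ω)` extended to `H⁻¹(Ω;w)` by `∞`. -/
def normL2 (ℓ : Hneg1 α) : ℝ≥0∞ :=
  ⨅ (h : L2 Ω) (_ : toHneg1 h = ℓ), ‖h‖ₑ

end accessors

/-- The region `Ω_δ^♯ = (δ, 1-δ) × (δ, 1)`. -/
def Ωsharp (δ : ℝ) : Set (ℝ × ℝ) := Ioo δ (1 - δ) ×ˢ Ioo δ 1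

/-- The (unweighted) norm of `H²(U)`, `U ⊆ Ω`, of the restriction of `u` to `U`, with the value `∞`
when this restriction is not in `H²(U)`. -/
def normH2 (U : Set (ℝ × ℝ)) (u : L2 Ω) : ℝ≥0∞ :=
  ⨅ (u₀ : L2 U) (uθ : L2 U) (ur : L2 U) (uθθ : L2 U) (uθr : L2 U) (urr : L2 U)
    (_ : (u : ℝ × ℝ → ℝ) =ᵐ[volume.restrict U] u₀)
    (_ : IsWeakPartial U eθ u₀ uθ) (_ : IsWeakPartial U er u₀ ur)
    (_ : IsWeakPartial U eθ uθ uθθ) (_ : IsWeakPartial U er uθ uθr)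
    (_ : IsWeakPartial U er ur urr),
    ENNReal.ofReal (Real.sqrt
      (‖u₀‖ ^ 2 + ‖uθ‖ ^ 2 + ‖ur‖ ^ 2 + ‖uθθ‖ ^ 2 + ‖uθr‖ ^ 2 + ‖urr‖ ^ 2))

section time

variable {X : Type*} [NormedAddCommGroup X] [NormedSpace ℝ X]

/-- `u'` is the weak time derivative on `(0,T)` of the Bochner function `u`. -/
def IsWeakTimeDeriv (T : ℝ) (u u' : ℝ → X) : Prop :=
  ∀ η : ℝ → ℝ, IsTest (Ioo 0 T) η →
    ∫ t in Ioo 0 T, deriv η t • u t = - ∫ t in Ioo 0 T, η t • u' t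

/-- `u(0) = x`, for a function `u` that is a.e. equal on `(0,T)` to a function continuous on
`[0,T]`; the value at `0` is that of the continuous representative. -/
def HasInitialValue (T : ℝ) (u : ℝ → X) (x : X) : Prop :=
  ∃ v : ℝ → X, ContinuousOn v (Icc 0 T) ∧ v =ᵐ[volume.restrict (Ioo 0 T)] u ∧ v 0 = x

end time

/-- `φ ∈ L²(0,T;H₀¹(Ω;w)) ∩ H¹(0,T;L²(Ω)) ∩ H²(0,T;H⁻¹(Ω;w))`, with weak time derivatives
`φt = ∂_t φ` and `φtt = ∂_tt φ`, is a weak solution with data `(φ0, φ1, f)`. The space `L²(Q)` of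
the source is written as `L²(0,T;L²(Ω))`. -/
structure IsWeakSolution (α T : ℝ) (φ0 : H01 α) (φ1 : L2 Ω) (f : L2t T (L2 Ω))
    (φ : L2t T (H01 α)) (φt : L2t T (L2 Ω)) (φtt : L2t T (Hneg1 α)) : Prop where
  deriv_one : IsWeakTimeDeriv T (fun t => val (φ t)) φt
  deriv_two : IsWeakTimeDeriv T (fun t => (toHneg1 (φt t) : Hneg1 α)) φtt
  equation : ∀ v : H01 α, ∀ᵐ t ∂(volume.restrict (Ioo 0 T)),
    φtt t v + energyInner (φ t) v = inner ℝ (f t) (val v)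
  init_zero : HasInitialValue T (fun t => val (φ t)) (val φ0)
  init_one : HasInitialValue T (fun t => (toHneg1 (φt t) : Hneg1 α)) (toHneg1 φ1)

/-- The space `L²(Γ₂¹)` on the side `Γ₂¹ = {r = 1}` of the square, parametrised by `θ ∈ (0,1)`. -/
abbrev L2Top : Type := Lp ℝ 2 (volume.restrict (Ioo (0 : ℝ) 1))

/-- `g` is the trace of `∂_r φ` on the side `r = 1`: the averages of `∂_r φ` over the layers
`1 - h < r < 1` converge to `g` as `h → 0⁺`, in the sense of distributions in
`(θ,t) ∈ (0,1) × (0,T)`. -/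
def IsTopTrace {α : ℝ} (T : ℝ) (φ : L2t T (H01 α)) (g : L2t T L2Top) : Prop :=
  ∀ χ : ℝ × ℝ → ℝ, IsTest (Ioo 0 1 ×ˢ Ioo 0 T) χ →
    Tendsto
      (fun h : ℝ => h⁻¹ * ∫ t in Ioo 0 T, ∫ z in Ioo 0 1 ×ˢ Ioo (1 - h) 1,
        dr (φ t) z * χ (z.1, t))
      (𝓝[>] 0)
      (𝓝 (∫ t in Ioo 0 T, ∫ θ in Ioo 0 1, g t θ * χ (θ, t)))

end

end DegenerateWave

open DegenerateWave

namespace DegenerateWave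

noncomputable section

/-! The operator separates: on the square, $\mathcal
A=-\partial_\theta^2-\partial_r(r^\alpha\partial_r)$ with Dirichlet conditions. Everything is
therefore diagonalised by products $e_a(\theta,r)=V_i(\theta)W_j(r)$, $a=(i,j)$, of eigenfunctions
of two one-dimensional problems, with eigenvalues $\lambda_a=\nu_i+\mu_j$.

One dimension. Let $V$ be the weighted Volterra operator $f\mapsto\int_0^r\rho^{-\beta/2}f$, bounded
and compact on $L^2(0,1)$ because $\beta<1$. The solution operator of $-(r^\beta u')'=w$ is
$V(1-P)V^*$, with $P$ the orthogonal projection on $r^{-\beta/2}$, which enforces $u(1)=0$. It is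
compact, symmetric, injective and positive, so `exists_modes` yields a Hilbert basis of
eigenfunctions together with their fluxes $F=r^\beta W'$; it is used with $\beta=0$ in $\theta$ and
$\beta=\alpha$ in $r$.

Two dimensions. The products form a Hilbert basis of $L^2(\Omega)$ (`eq_zero_of_inner_tens`). They
lie in $H^1_0(\Omega;w)$ as limits of products of test functions (`Spec.exists_eigenvector`), and by
`Spec.energyInner_e` the energy form is the diagonal form with entries $\lambda_a$. Hence a weak
solution is the same as a family of scalar oscillators $x_a''+\lambda_a x_a=f_a$
(`Spec.exists_isCoeff`). The oscillator estimate `Osc.energy_le` has a constant independent of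
$\lambda$; summing it over the modes gives existence, uniqueness and the energy bound. The bound of
$\partial_{tt}\varphi$ follows from the equation $\partial_{tt}\varphi=f-\mathcal A\varphi$.

Trace estimate. The multiplier $r\partial_r$ becomes the matrix $M_{ij}=\int W_i\,rW_j'$. The
identities `Spec.M_add_M` and `Spec.mu_M_add` evaluate the symmetric parts of $M$ and of
$\mathrm{diag}(\mu)M$; the second one contains $F_i(1)F_j(1)$. Differentiating $\sum M_{ij}y_ix_j$
in time produces the square of the boundary flux, and integrating gives `Spec.hidden_regularity` for
finitely many radial modes with fixed $i$; orthogonality in $\theta$ sums it over $i$. That the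
resulting series is the trace in the sense of layer averages is a question of uniform convergence in
the width $h$: two time derivatives are moved to the test function (`Spec.sq_mu_pair_le`), and this
gain controls the fluxes uniformly (`Spec.sq_sum_F_le`). Then $h\to0$ termwise.

Higher regularity. With $f\in H^1$ in time, $x_a'$ is again an oscillator, with force $f_a'$ and
initial velocity $f_a(0)-\lambda_ax_a(0)$; this bounds $\lambda_a x_a$ and $\sqrt{\lambda_a}\,x_a'$
(`Spec.mode_regularity`). Since $\nu$, $\mu$ and $\sqrt{\nu\mu}$ are at most $\lambda$, the second
derivatives, with weights, are controlled by $\mathcal Au$, and the weights are bounded where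
$r>1/8$ (`Spec.normH2_le`). -/

/-! ### Primitives and test functions on an interval -/

/-- `u` is on `[0,T]` the primitive of the integrable function `g`. -/
structure IsPrim (T : ℝ) (u g : ℝ → ℝ) : Prop where
  integrable : IntervalIntegrable g volume 0 T
  eq : ∀ t ∈ Icc 0 T, u t = u 0 + ∫ s in (0 : ℝ)..t, g s

lemma IsPrim.integrable_sub {T : ℝ} {u g : ℝ → ℝ} (h : IsPrim T u g) {t : ℝ} (ht : t ∈ Icc 0 T) :
    IntervalIntegrable g volume 0 t := by
  refine h.integrable.mono_set ?_
  rw [uIcc_of_le ht.1, uIcc_of_le (ht.1.trans ht.2)]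
  exact Icc_subset_Icc_right ht.2

lemma IsPrim.continuousOn {T : ℝ} (hT : 0 ≤ T) {u g : ℝ → ℝ} (h : IsPrim T u g) :
    ContinuousOn u (Icc 0 T) := by
  have h1 : ContinuousOn (fun t => u 0 + ∫ s in (0 : ℝ)..t, g s) (Icc 0 T) := by
    refine continuousOn_const.add ?_
    have := intervalIntegral.continuousOn_primitive_interval' (a := 0) h.integrable (by simp)
    rwa [uIcc_of_le hT] at this
  exact h1.congr h.eq

lemma IsPrim.congr {T : ℝ} {u g g' : ℝ → ℝ} (h : IsPrim T u g)
    (hg : g =ᵐ[volume.restrict (Ioo 0 T)] g') (hT : 0 ≤ T) : IsPrim T u g' := by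
  have key : ∀ t ∈ Icc 0 T, ∀ᵐ s ∂volume, s ∈ uIoc 0 t → g s = g' s := by
    intro t ht
    have h1 := (ae_restrict_iff' measurableSet_Ioo).1 hg
    -- Interval integrals run over half-open intervals, which contain the endpoint $T$ when $t=T$.
    have h2 : ∀ᵐ s : ℝ ∂volume, s ≠ T := by simp [ae_iff]
    filter_upwards [h1, h2] with s hs hs2 hs3
    rw [uIoc_of_le ht.1] at hs3
    exact hs ⟨hs3.1, lt_of_le_of_ne (hs3.2.trans ht.2) hs2⟩
  refine ⟨h.integrable.congr_ae ?_, fun t ht => ?_⟩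
  · exact (ae_restrict_iff' measurableSet_uIoc).2 (key T ⟨hT, le_rfl⟩)
  · rw [h.eq t ht, intervalIntegral.integral_congr_ae (key t ht)]

lemma intervalIntegrable_of_memLp {T : ℝ} (hT : 0 ≤ T) {g : ℝ → ℝ}
    (hg : MemLp g 2 (volume.restrict (Ioo 0 T))) : IntervalIntegrable g volume 0 T := by
  rw [intervalIntegrable_iff_integrableOn_Ioo_of_le hT]
  exact hg.integrable (by norm_num)

/-- The product rule for absolutely continuous functions. It is the only calculus rule in time that
the oscillators need, since their forcing is merely integrable. -/
lemma IsPrim.mul {T : ℝ} {u g v h : ℝ → ℝ} (hT : 0 ≤ T) (hu : IsPrim T u g) (hv : IsPrim T v h) :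
    IsPrim T (fun t => u t * v t) (fun t => g t * v t + u t * h t) := by
  have cu : ContinuousOn u (uIcc 0 T) := by rw [uIcc_of_le hT]; exact hu.continuousOn hT
  have cv : ContinuousOn v (uIcc 0 T) := by rw [uIcc_of_le hT]; exact hv.continuousOn hT
  refine ⟨(hu.integrable.mul_continuousOn cv).add (hv.integrable.continuousOn_mul cu), ?_⟩
  intro t ht
  have iu := hu.integrable_sub ht
  have iv := hv.integrable_sub ht
  -- The factors are replaced by their explicit primitives: these have a known derivative almost
  -- everywhere, while nothing is assumed of $u$ and $v$ outside $[0,T]$.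
  have au : AbsolutelyContinuousOnInterval (fun s => u 0 + ∫ x in (0 : ℝ)..s, g x) 0 t :=
    (LipschitzOnWith.absolutelyContinuousOnInterval (K := 0)
      ((LipschitzWith.const (u 0)).lipschitzOnWith)).add
      (iu.absolutelyContinuousOnInterval_intervalIntegral (by simp))
  have av : AbsolutelyContinuousOnInterval (fun s => v 0 + ∫ x in (0 : ℝ)..s, h x) 0 t :=
    (LipschitzOnWith.absolutelyContinuousOnInterval (K := 0)
      ((LipschitzWith.const (v 0)).lipschitzOnWith)).add
      (iv.absolutelyContinuousOnInterval_intervalIntegral (by simp))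
  have := au.integral_deriv_mul_eq_sub av
  simp only [intervalIntegral.integral_same, add_zero] at this
  rw [← hu.eq t ht, ← hv.eq t ht] at this
  have h2 : ∫ s in (0 : ℝ)..t, (g s * v s + u s * h s) = u t * v t - u 0 * v 0 := by
    rw [← this]
    apply intervalIntegral.integral_congr_ae
    filter_upwards [iu.ae_hasDerivAt_integral, iv.ae_hasDerivAt_integral] with s hs1 hs2 hs
    have hs' : s ∈ Icc 0 T := by
      rw [uIoc_of_le ht.1] at hs
      exact ⟨hs.1.le, hs.2.trans ht.2⟩
    have e1 := ((hs1 (uIoc_subset_uIcc hs) 0 (by simp)).const_add (u 0)).deriv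
    have e2 := ((hs2 (uIoc_subset_uIcc hs) 0 (by simp)).const_add (v 0)).deriv
    rw [e1, e2, ← hu.eq s hs', ← hv.eq s hs']
  rw [h2]; ring

lemma IsPrim.add {T : ℝ} {u g v h : ℝ → ℝ} (hu : IsPrim T u g) (hv : IsPrim T v h) :
    IsPrim T (fun t => u t + v t) (fun t => g t + h t) := by
  refine ⟨hu.integrable.add hv.integrable, fun t ht => ?_⟩
  rw [intervalIntegral.integral_add (hu.integrable_sub ht) (hv.integrable_sub ht), hu.eq t ht,
    hv.eq t ht]
  ring

lemma IsPrim.const_mul {T : ℝ} {u g : ℝ → ℝ} (hu : IsPrim T u g) (c : ℝ) :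
    IsPrim T (fun t => c * u t) (fun t => c * g t) := by
  refine ⟨hu.integrable.const_mul c, fun t ht => ?_⟩
  rw [intervalIntegral.integral_const_mul, hu.eq t ht]
  ring

lemma IsPrim.sum {ι : Type*} (S : Finset ι) {T : ℝ} {u g : ι → ℝ → ℝ}
    (hu : ∀ i ∈ S, IsPrim T (u i) (g i)) :
    IsPrim T (fun t => ∑ i ∈ S, u i t) (fun t => ∑ i ∈ S, g i t) := by
  classical
  induction S using Finset.induction_on with
  | empty => exact ⟨by simp, by simp⟩
  | insert a S ha ih =>
    simp only [Finset.sum_insert ha]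
    exact (hu a (by simp)).add (ih fun i hi => hu i (by simp [hi]))

lemma isPrim_of_hasDerivAt {T : ℝ} {u g : ℝ → ℝ} (hu : ∀ t, HasDerivAt u (g t) t)
    (hg : Continuous g) : IsPrim T u g := by
  refine ⟨hg.intervalIntegrable _ _, fun t _ => ?_⟩
  rw [intervalIntegral.integral_eq_sub_of_hasDerivAt (fun x _ => hu x) (hg.intervalIntegrable _ _)]
  ring

lemma IsTest.exists_Icc {a b : ℝ} (hab : a < b) {ψ : ℝ → ℝ} (h : IsTest (Ioo a b) ψ) :
    ∃ c d, a < c ∧ c ≤ d ∧ d < b ∧ tsupport ψ ⊆ Icc c d := by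
  rcases (tsupport ψ).eq_empty_or_nonempty with h0 | h0
  · exact ⟨(a + b) / 2, (a + b) / 2, by linarith, le_rfl, by linarith, by simp [h0]⟩
  · obtain ⟨c, hc, hc'⟩ := h.2.1.exists_isLeast h0
    obtain ⟨d, hd, hd'⟩ := h.2.1.exists_isGreatest h0
    exact ⟨c, d, (h.2.2 hc).1, hc' hd, (h.2.2 hd).2, fun x hx => ⟨hc' hx, hd' hx⟩⟩

/-- Zero mean is exactly what makes the primitive vanish to the right of the support of ψ; to the
left it vanishes anyway. -/
lemma isTest_primitive {a b : ℝ} (hab : a < b) {ψ : ℝ → ℝ} (h : IsTest (Ioo a b) ψ)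
    (h0 : ∫ t in Ioo a b, ψ t = 0) :
    IsTest (Ioo a b) (fun t => ∫ s in a..t, ψ s) ∧
      ∀ t, HasDerivAt (fun t => ∫ s in a..t, ψ s) (ψ t) t := by
  have hd : ∀ t, HasDerivAt (fun t => ∫ s in a..t, ψ s) (ψ t) t := fun t =>
    h.1.continuous.integral_hasStrictDerivAt a t |>.hasDerivAt
  obtain ⟨c, d, hac, hcd, hdb, hsupp⟩ := h.exists_Icc hab
  have hz : ∀ t, t ∉ Icc c d → ψ t = 0 := fun t ht =>
    image_eq_zero_of_notMem_tsupport fun h => ht (hsupp h)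
  have htot : ∫ s in a..b, ψ s = 0 := by
    rw [intervalIntegral.integral_of_le hab.le, integral_Ioc_eq_integral_Ioo, h0]
  have hs : Function.support (fun t => ∫ s in a..t, ψ s) ⊆ Icc c d := by
    intro t ht
    by_contra hn
    apply ht
    rw [mem_Icc, not_and_or, not_le, not_le] at hn
    rcases hn with hn | hn
    · apply intervalIntegral.integral_zero_ae
      refine Eventually.of_forall fun s hs => hz s fun hs' => ?_
      have := hs.2
      have := hs'.1
      have : max a t < c := max_lt hac hn
      linarith
    · have : ∫ s in t..b, ψ s = 0 := by
        apply intervalIntegral.integral_zero_ae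
        refine Eventually.of_forall fun s hs => hz s fun hs' => ?_
        have := hs.1
        have := hs'.2
        have : d < min t b := lt_min hn hdb
        linarith
      have h3 := intervalIntegral.integral_add_adjacent_intervals (μ := volume)
        (h.1.continuous.intervalIntegrable a t) (h.1.continuous.intervalIntegrable t b)
      simp only
      linarith
  have hts : tsupport (fun t => ∫ s in a..t, ψ s) ⊆ Icc c d :=
    closure_minimal hs isClosed_Icc
  refine ⟨⟨?_, ?_, hts.trans (Icc_subset_Ioo hac hdb)⟩, hd⟩
  · rw [contDiff_infty_iff_deriv]
    refine ⟨fun t => (hd t).differentiableAt, ?_⟩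
    have : deriv (fun t => ∫ s in a..t, ψ s) = ψ := funext fun t => (hd t).deriv
    rw [this]
    exact h.1
  · exact HasCompactSupport.of_support_subset_isCompact isCompact_Icc hs

lemma exists_isTest_integral_eq_one {a b : ℝ} (hab : a < b) :
    ∃ ρ : ℝ → ℝ, IsTest (Ioo a b) ρ ∧ ∫ t in Ioo a b, ρ t = 1 := by
  let f : ContDiffBump ((a + b) / 2) := ⟨(b - a) / 8, (b - a) / 4, by linarith, by linarith⟩
  have hts : tsupport (f.normed volume) ⊆ Ioo a b := by
    rw [f.tsupport_normed_eq, Real.closedBall_eq_Icc]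
    refine Icc_subset_Ioo ?_ ?_ <;> simp only [f] <;> linarith
  refine ⟨f.normed volume, ⟨f.contDiff_normed, f.hasCompactSupport_normed, hts⟩, ?_⟩
  rw [setIntegral_eq_integral_of_forall_compl_eq_zero, f.integral_normed]
  intro x hx
  exact image_eq_zero_of_notMem_tsupport fun h => hx (hts h)

lemma IsTest.eq_zero {E : Type*} [NormedAddCommGroup E] [NormedSpace ℝ E] {U : Set E} {ψ : E → ℝ}
    (h : IsTest U ψ) {x : E} (hx : x ∉ U) : ψ x = 0 :=
  image_eq_zero_of_notMem_tsupport fun h' => hx (h.2.2 h')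

lemma IsTest.sub' {E : Type*} [NormedAddCommGroup E] [NormedSpace ℝ E] {U : Set E} {ψ χ : E → ℝ}
    (h : IsTest U ψ) (h' : IsTest U χ) (c : ℝ) : IsTest U (fun x => ψ x - c * χ x) := by
  refine ⟨h.1.sub (contDiff_const.mul h'.1), ?_, ?_⟩
  · exact h.2.1.sub h'.2.1.mul_left
  · exact (tsupport_sub ψ (fun x => c * χ x)).trans (union_subset h.2.2
      ((tsupport_mul_subset_right (f := fun _ => c) (g := χ)).trans h'.2.2))

lemma IsTest.integrableOn_mul {a b : ℝ} {η : ℝ → ℝ} (hη : Continuous η) {u : ℝ → ℝ}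
    (hu : IntegrableOn u (Ioo a b)) : IntegrableOn (fun t => η t * u t) (Ioo a b) := by
  have hu' : IntegrableOn u (Icc a b) := by rwa [integrableOn_Icc_iff_integrableOn_Ioo]
  exact (hu'.continuousOn_mul hη.continuousOn isCompact_Icc).mono_set Ioo_subset_Icc_self

/-- The lemma of du Bois-Reymond. -/
lemma ae_eq_const_of_integral_deriv_mul_eq_zero {a b : ℝ} (hab : a < b) {w : ℝ → ℝ}
    (hw : IntegrableOn w (Ioo a b))
    (h : ∀ η : ℝ → ℝ, IsTest (Ioo a b) η → ∫ t in Ioo a b, deriv η t * w t = 0) :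
    ∃ k : ℝ, ∀ᵐ t ∂(volume.restrict (Ioo a b)), w t = k := by
  obtain ⟨ρ, hρ, hρ1⟩ := exists_isTest_integral_eq_one hab
  -- If $w$ is constant, pairing it with a test function of mass one returns the constant.
  refine ⟨∫ t in Ioo a b, ρ t * w t, ?_⟩
  set k := ∫ t in Ioo a b, ρ t * w t with hk
  rw [ae_restrict_iff' measurableSet_Ioo]
  have hk' : IntegrableOn (fun _ : ℝ => k) (Ioo a b) := integrableOn_const (by simp)
  have := isOpen_Ioo.ae_eq_zero_of_integral_contDiff_smul_eq_zero (f := fun t => w t - k)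
    (U := Ioo a b) (μ := volume) (IntegrableOn.locallyIntegrableOn (hw.sub hk')) ?_
  · filter_upwards [this] with t ht ht'
    linarith [ht ht']
  · intro g hg1 hg2 hg3
    have hg : IsTest (Ioo a b) g := ⟨hg1, hg2, hg3⟩
    have ig : IntegrableOn g (Ioo a b) := hg1.continuous.integrable_of_hasCompactSupport hg2 |>.integrableOn
    have iρ : IntegrableOn ρ (Ioo a b) :=
      hρ.1.continuous.integrable_of_hasCompactSupport hρ.2.1 |>.integrableOn
    set m := ∫ t in Ioo a b, g t with hm
    -- Subtracting $m\rho$ removes the mean of $g$, so the difference is the derivative of a test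
    -- function and is annihilated by $w$.
    have ht := hg.sub' hρ m
    have h0 : ∫ t in Ioo a b, (g t - m * ρ t) = 0 := by
      rw [integral_sub ig (iρ.const_mul m), integral_const_mul, hρ1]; simp [hm]
    obtain ⟨p1, p2⟩ := isTest_primitive hab ht h0
    have h1 := h _ p1
    have e1 : (fun t => deriv (fun t => ∫ s in a..t, (g s - m * ρ s)) t * w t)
        = fun t => g t * w t - m * (ρ t * w t) := by
      funext t
      rw [(p2 t).deriv]; ring
    rw [e1, integral_sub (IsTest.integrableOn_mul hg1.continuous hw)
      ((IsTest.integrableOn_mul hρ.1.continuous hw).const_mul m), integral_const_mul, ← hk] at h1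
    have e2 : (∫ t, g t • (w t - k)) = ∫ t in Ioo a b, g t • (w t - k) := by
      rw [setIntegral_eq_integral_of_forall_compl_eq_zero]
      intro x hx
      rw [hg.eq_zero hx, zero_smul]
    rw [e2]
    have e3 : (fun t => g t • (w t - k)) = fun t => g t * w t - g t * k := by
      funext t; simp; ring
    rw [e3, integral_sub (IsTest.integrableOn_mul hg1.continuous hw) (ig.mul_const k),
      integral_mul_const, ← hm]
    linarith

lemma IsTest.isPrim {T : ℝ} {η : ℝ → ℝ} (h : IsTest (Ioo 0 T) η) : IsPrim T η (deriv η) :=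
  isPrim_of_hasDerivAt (fun t => (h.1.differentiable (by simp) t).hasDerivAt)
    (h.1.continuous_deriv (by simp))

lemma setIntegral_Ioo_eq {T : ℝ} (hT : 0 ≤ T) (f : ℝ → ℝ) :
    ∫ t in Ioo 0 T, f t = ∫ t in (0 : ℝ)..T, f t := by
  rw [intervalIntegral.integral_of_le hT, integral_Ioc_eq_integral_Ioo]

lemma IsPrim.isWeakTimeDeriv {T : ℝ} (hT : 0 < T) {u g : ℝ → ℝ} (h : IsPrim T u g) :
    IsWeakTimeDeriv T u g := by
  intro η hη
  have hp := hη.isPrim.mul hT.le h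
  have e := hp.eq T ⟨hT.le, le_rfl⟩
  rw [hη.eq_zero (x := T) (by simp), hη.eq_zero (x := 0) (by simp)] at e
  simp only [smul_eq_mul]
  rw [setIntegral_Ioo_eq hT.le, setIntegral_Ioo_eq hT.le]
  have cu : ContinuousOn u (uIcc 0 T) := by rw [uIcc_of_le hT.le]; exact h.continuousOn hT.le
  rw [intervalIntegral.integral_add (hη.isPrim.integrable.mul_continuousOn cu)
    (h.integrable.continuousOn_mul hη.1.continuous.continuousOn)] at e
  linarith

/-- A scalar function with an integrable weak derivative is a.e. equal to a primitive of it. -/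
lemma IsWeakTimeDeriv.exists_isPrim {T : ℝ} (hT : 0 < T) {u g : ℝ → ℝ}
    (hu : IntegrableOn u (Ioo 0 T)) (hg : IntegrableOn g (Ioo 0 T)) (h : IsWeakTimeDeriv T u g) :
    ∃ v : ℝ → ℝ, IsPrim T v g ∧ u =ᵐ[volume.restrict (Ioo 0 T)] v := by
  have ig : IntervalIntegrable g volume 0 T := by
    rwa [intervalIntegrable_iff_integrableOn_Ioo_of_le hT.le]
  have h0 : IsPrim T (fun t => ∫ s in (0 : ℝ)..t, g s) g := ⟨ig, fun t _ => by simp⟩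
  have iv : IntegrableOn (fun t => ∫ s in (0 : ℝ)..t, g s) (Ioo 0 T) :=
    (h0.continuousOn hT.le).integrableOn_Icc.mono_set Ioo_subset_Icc_self
  -- The function $u$ and the primitive of $g$ have the same weak derivative, so they differ by a
  -- constant.
  obtain ⟨k, hk⟩ := ae_eq_const_of_integral_deriv_mul_eq_zero hT (hu.sub iv) (by
    intro η hη
    have c := hη.1.continuous_deriv (by simp)
    have e : (fun t => deriv η t * ((u - fun t => ∫ s in (0 : ℝ)..t, g s) t)) =
        fun t => deriv η t * u t - deriv η t * ∫ s in (0 : ℝ)..t, g s := by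
      funext t; simp; ring
    rw [e, integral_sub (IsTest.integrableOn_mul c hu) (IsTest.integrableOn_mul c iv)]
    have h1 := h η hη
    have h2 := h0.isWeakTimeDeriv hT η hη
    simp only [smul_eq_mul] at h1 h2
    rw [h1, h2, sub_self])
  refine ⟨fun t => k + ∫ s in (0 : ℝ)..t, g s, ⟨ig, fun t _ => by simp⟩, ?_⟩
  filter_upwards [hk] with t ht
  simp at ht
  linarith

/-! ### Summability in complete spaces -/

/-- A Cauchy criterion suited to orthogonal terms: a quadratic bound on finite sums by a summable
scalar family. It is applied in $H^1_0(\Omega;w)$ and $L^2(\Omega)$, in spaces of continuous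
functions, and in $L^2$ of the boundary side. -/
lemma summable_of_norm_sq_sum_le {ι X : Type*} [NormedAddCommGroup X] [CompleteSpace X]
    {x : ι → X} {m : ι → ℝ} (hm : Summable m) (h : ∀ S : Finset ι, ‖∑ i ∈ S, x i‖ ^ 2 ≤ ∑ i ∈ S, m i) :
    Summable x := by
  rw [summable_iff_vanishing_norm]
  intro ε hε
  obtain ⟨s, hs⟩ := summable_iff_vanishing_norm.1 hm (ε ^ 2) (by positivity)
  refine ⟨s, fun t ht => ?_⟩
  have h1 := hs t ht
  have h2 := h t
  have h3 : ‖∑ i ∈ t, x i‖ ^ 2 < ε ^ 2 := lt_of_le_of_lt (h2.trans (Real.le_norm_self _)) h1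
  exact lt_of_pow_lt_pow_left₀ 2 hε.le h3

lemma norm_sq_tsum_le {ι X : Type*} [NormedAddCommGroup X] [CompleteSpace X]
    {x : ι → X} {m : ι → ℝ} (hm : Summable m) (h : ∀ S : Finset ι, ‖∑ i ∈ S, x i‖ ^ 2 ≤ ∑ i ∈ S, m i) :
    ‖∑' i, x i‖ ^ 2 ≤ ∑' i, m i :=
  le_of_tendsto_of_tendsto ((summable_of_norm_sq_sum_le hm h).hasSum.norm.pow 2) hm.hasSum
    (Eventually.of_forall h)

/-! ### Orthonormal bases of eigenvectors -/

/-- Members of an orthonormal family are at mutual distance $\sqrt2$, so balls of radius $1/2$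
around them are disjoint open sets. -/
lemma countable_of_orthonormal {ι E : Type*} [NormedAddCommGroup E] [InnerProductSpace ℝ E]
    [SecondCountableTopology E] {v : ι → E} (hv : Orthonormal ℝ v) : Countable ι := by
  have : (univ : Set ι).Countable := by
    refine Set.PairwiseDisjoint.countable_of_isOpen (s := fun i => Metric.ball (v i) (1 / 2)) ?_
      (fun i _ => Metric.isOpen_ball) (fun i _ => ⟨v i, by simp⟩)
    intro i _ j _ hij
    refine Metric.ball_disjoint_ball ?_
    have h1 : ‖v i - v j‖ ^ 2 = 2 := by
      rw [norm_sub_sq_real, hv.1 i, hv.1 j, hv.2 hij]; norm_num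
    rw [dist_eq_norm]
    nlinarith [norm_nonneg (v i - v j)]
  exact countable_univ_iff.1 this

/-- Eigenspaces of nonzero eigenvalues are finite-dimensional by compactness, and injectivity makes
the eigenspace of $0$ trivial. Orthonormal bases of all of them are then put together; the spectral
theorem says that nothing is orthogonal to every eigenspace. -/
lemma exists_hilbertBasis_eigenvectors {E : Type} [NormedAddCommGroup E] [InnerProductSpace ℝ E]
    [CompleteSpace E] {K : E →L[ℝ] E} (hK : IsCompactOperator K)
    (hs : (K : E →ₗ[ℝ] E).IsSymmetric) (hinj : ∀ x, K x = 0 → x = 0) :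
    ∃ (ι : Type) (b : HilbertBasis ι ℝ E) (κ : ι → ℝ), ∀ i, K (b i) = κ i • b i := by
  have hfin : ∀ μ : ℝ, FiniteDimensional ℝ (Module.End.eigenspace (K : E →ₗ[ℝ] E) μ) := by
    intro μ
    by_cases hμ : μ = 0
    · have : Module.End.eigenspace (K : E →ₗ[ℝ] E) μ = ⊥ := by
        rw [eq_bot_iff]
        intro x hx
        rw [Module.End.mem_eigenspace_iff, hμ, zero_smul] at hx
        exact hinj x hx
      rw [this]; infer_instance
    · exact ContinuousLinearMap.finite_dimensional_eigenspace hK μ hμ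
  let w : ∀ μ : ℝ, OrthonormalBasis (Fin (Module.finrank ℝ
      (Module.End.eigenspace (K : E →ₗ[ℝ] E) μ))) ℝ (Module.End.eigenspace (K : E →ₗ[ℝ] E) μ) :=
    fun μ => stdOrthonormalBasis ℝ _
  let v : (Σ μ : ℝ, Fin (Module.finrank ℝ (Module.End.eigenspace (K : E →ₗ[ℝ] E) μ))) → E :=
    fun a => (w a.1 a.2 : E)
  have hv : Orthonormal ℝ v :=
    hs.orthogonalFamily_eigenspaces.orthonormal_sigma_orthonormal (v_family := fun μ => w μ)
      (fun μ => (w μ).orthonormal)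
  have hsp : (Submodule.span ℝ (range v))ᗮ = ⊥ := by
    rw [eq_bot_iff, ← ContinuousLinearMap.orthogonalComplement_iSup_eigenspaces_eq_bot hK hs]
    apply Submodule.orthogonal_le
    refine iSup_le fun μ x hx => ?_
    have h1 := (w μ).sum_repr ⟨x, hx⟩
    have h2 := congrArg (Subtype.val) h1
    simp only [Submodule.coe_sum, Submodule.coe_smul] at h2
    rw [← h2]
    exact Submodule.sum_mem _ fun i _ => Submodule.smul_mem _ _
      (Submodule.subset_span ⟨⟨μ, i⟩, rfl⟩)
  refine ⟨_, HilbertBasis.mkOfOrthogonalEqBot hv hsp, fun a => a.1, fun a => ?_⟩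
  rw [HilbertBasis.coe_mkOfOrthogonalEqBot]
  exact Module.End.mem_eigenspace_iff.1 (w a.1 a.2).2

/-! ### The weighted Volterra operator on the unit interval -/

lemma intervalIntegrable_rpow_neg {β : ℝ} (hβ : β < 1) (a b : ℝ) :
    IntervalIntegrable (fun r : ℝ => r ^ (-β)) volume a b :=
  intervalIntegral.intervalIntegrable_rpow' (by linarith)

/-- The square is $r^{-\beta}$, integrable at $0$ exactly because $\beta<1$. This is where the
weakness of the degeneracy enters. -/
lemma memLp_rpow {β : ℝ} (hβ : β < 1) :
    MemLp (fun r : ℝ => r ^ (-(β / 2))) 2 (volume.restrict (Ioo (0 : ℝ) 1)) := by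
  have hm : AEStronglyMeasurable (fun r : ℝ => r ^ (-(β / 2))) (volume.restrict (Ioo (0 : ℝ) 1)) :=
    (measurable_id.pow_const _).aestronglyMeasurable
  rw [memLp_two_iff_integrable_sq hm]
  have h1 := intervalIntegrable_rpow_neg hβ 0 1
  rw [intervalIntegrable_iff_integrableOn_Ioo_of_le zero_le_one] at h1
  refine h1.congr_fun (fun r hr => ?_) measurableSet_Ioo
  simp only
  rw [← Real.rpow_natCast, ← Real.rpow_mul hr.1.le]
  congr 1; push_cast; ring

/-- The function `r^{-β/2}` in `L²(0,1)`. -/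
def wt (β : ℝ) (hβ : β < 1) : L2Top := (memLp_rpow hβ).toLp

lemma wt_coe {β : ℝ} (hβ : β < 1) :
    (wt β hβ : ℝ → ℝ) =ᵐ[volume.restrict (Ioo (0 : ℝ) 1)] fun r => r ^ (-(β / 2)) :=
  MemLp.coeFn_toLp _

lemma L2Top.inner_eq (f g : L2Top) : inner ℝ f g = ∫ r in Ioo (0 : ℝ) 1, f r * g r := by
  rw [L2.inner_def]
  congr 1; funext r; simp [mul_comm]

lemma integrableOn_wt_mul {β : ℝ} (hβ : β < 1) (f : L2Top) :
    IntegrableOn (fun r : ℝ => r ^ (-(β / 2)) * f r) (Ioo 0 1) :=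
  (memLp_rpow hβ).integrable_mul (Lp.memLp f)

/-- The primitive `r ↦ ∫_0^r ρ^{-β/2} f(ρ) dρ`. -/
def volt (β : ℝ) (f : ℝ → ℝ) (r : ℝ) : ℝ := ∫ s in (0 : ℝ)..r, s ^ (-(β / 2)) * f s

lemma isPrim_volt {β : ℝ} (hβ : β < 1) (f : L2Top) :
    IsPrim 1 (volt β f) (fun r => r ^ (-(β / 2)) * f r) :=
  ⟨by rw [intervalIntegrable_iff_integrableOn_Ioo_of_le zero_le_one]; exact integrableOn_wt_mul hβ f,
    fun t _ => by simp [volt]⟩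

/-- `∫_0^r ρ^{-β} dρ`. -/
def voltSq (β : ℝ) (r : ℝ) : ℝ := ∫ s in (0 : ℝ)..r, s ^ (-β)

lemma continuous_voltSq {β : ℝ} (hβ : β < 1) : Continuous (voltSq β) :=
  intervalIntegral.continuous_primitive (intervalIntegrable_rpow_neg hβ) 0

/-- Cauchy–Schwarz against the weight $x^{-\beta/2}$ on $(r,s)$. The modulus of continuity so
obtained depends on $f$ only through its norm, which is what compactness needs. -/
lemma abs_setIntegral_wt_mul_le {β : ℝ} (hβ : β < 1) (f : L2Top) {r s : ℝ} (hr : 0 ≤ r)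
    (hrs : r ≤ s) (hs : s ≤ 1) :
    (volt β f s - volt β f r) ^ 2 ≤ (voltSq β s - voltSq β r) * ‖f‖ ^ 2 := by
  have hf := isPrim_volt hβ f
  have e1 : volt β f s - volt β f r = ∫ x in Ioo 0 1, (Ioo r s).indicator (fun x => x ^ (-(β / 2))) x * f x := by
    rw [volt, volt, intervalIntegral.integral_interval_sub_left
      (hf.integrable_sub ⟨hr.trans hrs, hs⟩) (hf.integrable_sub ⟨hr, hrs.trans hs⟩),
      intervalIntegral.integral_of_le hrs, integral_Ioc_eq_integral_Ioo]
    have : (fun x => (Ioo r s).indicator (fun x => x ^ (-(β / 2))) x * f x)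
        = (Ioo r s).indicator (fun x => x ^ (-(β / 2)) * f x) := by
      funext x
      by_cases hx : x ∈ Ioo r s <;> simp [hx]
    rw [this, setIntegral_indicator measurableSet_Ioo,
      inter_eq_right.2 (Ioo_subset_Ioo hr hs)]
  let g : L2Top := ((memLp_rpow hβ).indicator (measurableSet_Ioo (a := r) (b := s))).toLp
  have hg : (g : ℝ → ℝ) =ᵐ[volume.restrict (Ioo (0 : ℝ) 1)]
    (Ioo r s).indicator (fun x : ℝ => x ^ (-(β / 2))) := MemLp.coeFn_toLp _
  have e2 : volt β f s - volt β f r = inner ℝ g f := by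
    rw [e1, L2Top.inner_eq]
    apply integral_congr_ae
    filter_upwards [hg] with x hx
    rw [hx]
  have e3 : ‖g‖ ^ 2 = voltSq β s - voltSq β r := by
    rw [← real_inner_self_eq_norm_sq, L2Top.inner_eq, voltSq, voltSq,
      intervalIntegral.integral_interval_sub_left (intervalIntegrable_rpow_neg hβ _ _)
      (intervalIntegrable_rpow_neg hβ _ _),
      intervalIntegral.integral_of_le hrs, integral_Ioc_eq_integral_Ioo]
    have : ∫ x in Ioo 0 1, g x * g x = ∫ x in Ioo 0 1, (Ioo r s).indicator (fun x => x ^ (-β)) x := by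
      apply integral_congr_ae
      filter_upwards [hg, ae_restrict_mem measurableSet_Ioo] with x hx hx'
      rw [hx]
      by_cases hx2 : x ∈ Ioo r s
      · simp only [hx2, indicator_of_mem]
        rw [← Real.rpow_add hx'.1]; congr 1; ring
      · simp [hx2]
    rw [this, setIntegral_indicator measurableSet_Ioo, inter_eq_right.2 (Ioo_subset_Ioo hr hs)]
  rw [e2, ← e3, ← mul_pow]
  exact sq_le_sq' (by linarith [neg_abs_le (inner ℝ g f), abs_real_inner_le_norm g f])
    (real_inner_le_norm g f)

lemma volt_sq_le {β : ℝ} (hβ : β < 1) (f : L2Top) {r : ℝ} (hr : r ∈ Icc (0 : ℝ) 1) :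
    volt β f r ^ 2 ≤ voltSq β r * ‖f‖ ^ 2 := by
  have := abs_setIntegral_wt_mul_le hβ f le_rfl hr.1 hr.2
  simpa [volt, voltSq] using this

lemma voltSq_le {β : ℝ} (hβ : β < 1) {r s : ℝ} (hr : 0 ≤ r) (h : r ≤ s) : voltSq β r ≤ voltSq β s := by
  rw [← sub_nonneg, voltSq, voltSq, intervalIntegral.integral_interval_sub_left
    (intervalIntegrable_rpow_neg hβ _ _) (intervalIntegrable_rpow_neg hβ _ _)]
  exact intervalIntegral.integral_nonneg h fun x hx => Real.rpow_nonneg (hr.trans hx.1) _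

lemma voltSq_one_nonneg {β : ℝ} (hβ : β < 1) : 0 ≤ voltSq β 1 := by
  have := voltSq_le hβ le_rfl (zero_le_one (α := ℝ))
  simpa [voltSq] using this

lemma memLp_of_continuousOn {f : ℝ → ℝ} (hf : ContinuousOn f (Icc 0 1)) :
    MemLp f 2 (volume.restrict (Ioo (0 : ℝ) 1)) := by
  rw [memLp_two_iff_integrable_sq ((hf.mono Ioo_subset_Icc_self).aestronglyMeasurable measurableSet_Ioo)]
  exact (hf.pow 2).integrableOn_Icc.mono_set Ioo_subset_Icc_self

lemma memLp_volt {β : ℝ} (hβ : β < 1) (f : L2Top) :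
    MemLp (volt β f) 2 (volume.restrict (Ioo (0 : ℝ) 1)) :=
  memLp_of_continuousOn ((isPrim_volt hβ f).continuousOn zero_le_one)

lemma volt_congr {β : ℝ} {f g : ℝ → ℝ} (h : f =ᵐ[volume.restrict (Ioo (0 : ℝ) 1)] g) {r : ℝ}
    (hr : r ∈ Icc (0 : ℝ) 1) : volt β f r = volt β g r := by
  rw [volt, volt, intervalIntegral.integral_of_le hr.1, intervalIntegral.integral_of_le hr.1,
    integral_Ioc_eq_integral_Ioo, integral_Ioc_eq_integral_Ioo]
  apply integral_congr_ae
  have := ae_restrict_of_ae_restrict_of_subset (Ioo_subset_Ioo_right hr.2) h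
  filter_upwards [this] with x hx
  rw [hx]

lemma norm_sq_le_of_ae {f : L2Top} {M : ℝ}
    (h : ∀ᵐ r ∂(volume.restrict (Ioo (0 : ℝ) 1)), f r ^ 2 ≤ M) : ‖f‖ ^ 2 ≤ M := by
  rw [← real_inner_self_eq_norm_sq, L2Top.inner_eq]
  calc ∫ r in Ioo (0 : ℝ) 1, f r * f r = ∫ r in Ioo (0 : ℝ) 1, f r ^ 2 := by simp_rw [sq]
    _ ≤ ∫ r in Ioo (0 : ℝ) 1, M :=
        integral_mono_ae (Lp.memLp f).integrable_sq (integrableOn_const (by simp)) h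
    _ = M := by simp

/-- The weighted Volterra operator `f ↦ ∫_0^r ρ^{-β/2} f(ρ) dρ` on `L²(0,1)`. -/
def voltOp (β : ℝ) (hβ : β < 1) : L2Top →L[ℝ] L2Top :=
  LinearMap.mkContinuous
    { toFun := fun f => (memLp_volt hβ f).toLp
      map_add' := by
        intro f g
        rw [← MemLp.toLp_add]
        refine MemLp.toLp_congr _ _ ?_
        filter_upwards [ae_restrict_mem measurableSet_Ioo] with r hr
        have hr' := Ioo_subset_Icc_self hr
        rw [volt_congr (Lp.coeFn_add f g) hr', Pi.add_apply, volt, volt, volt,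
          ← intervalIntegral.integral_add ((isPrim_volt hβ f).integrable_sub hr')
          ((isPrim_volt hβ g).integrable_sub hr')]
        congr 1; funext x; simp; ring
      map_smul' := by
        intro c f
        rw [RingHom.id_apply, ← MemLp.toLp_const_smul]
        refine MemLp.toLp_congr _ _ ?_
        filter_upwards [ae_restrict_mem measurableSet_Ioo] with r hr
        have hr' := Ioo_subset_Icc_self hr
        rw [volt_congr (Lp.coeFn_smul c f) hr', Pi.smul_apply, volt, volt, smul_eq_mul,
          ← intervalIntegral.integral_const_mul]
        congr 1; funext x; simp; ring }
    (Real.sqrt (voltSq β 1)) (by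
      intro f
      refine le_of_sq_le_sq ?_ (by positivity)
      rw [mul_pow, Real.sq_sqrt (voltSq_one_nonneg hβ)]
      refine norm_sq_le_of_ae ?_
      filter_upwards [(memLp_volt hβ f).coeFn_toLp, ae_restrict_mem measurableSet_Ioo] with r hr hr2
      simp only [LinearMap.coe_mk, AddHom.coe_mk]
      rw [hr]
      exact (volt_sq_le hβ f (Ioo_subset_Icc_self hr2)).trans (mul_le_mul_of_nonneg_right
          (voltSq_le hβ hr2.1.le hr2.2.le) (sq_nonneg _)))

lemma voltOp_coe {β : ℝ} (hβ : β < 1) (f : L2Top) :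
    (voltOp β hβ f : ℝ → ℝ) =ᵐ[volume.restrict (Ioo (0 : ℝ) 1)] volt β f :=
  (memLp_volt hβ f).coeFn_toLp

/-- The representing function is the weight cut off at $r$. Bounded point evaluations are the
building blocks of the finite-rank approximations of `voltOp`. -/
lemma exists_volt_eq_inner {β : ℝ} (hβ : β < 1) {r : ℝ} (hr : r ∈ Icc (0 : ℝ) 1) :
    ∃ g : L2Top, ∀ f : L2Top, volt β f r = inner ℝ g f := by
  refine ⟨((memLp_rpow hβ).indicator (measurableSet_Ioo (a := 0) (b := r))).toLp, fun f => ?_⟩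
  rw [L2Top.inner_eq, volt, intervalIntegral.integral_of_le hr.1, integral_Ioc_eq_integral_Ioo]
  have : ∫ s in Ioo 0 r, s ^ (-(β / 2)) * f s
      = ∫ s in Ioo 0 1, (Ioo 0 r).indicator (fun s => s ^ (-(β / 2)) * f s) s := by
    rw [setIntegral_indicator measurableSet_Ioo, inter_eq_right.2 (Ioo_subset_Ioo_right hr.2)]
  rw [this]
  apply integral_congr_ae
  filter_upwards [((memLp_rpow hβ).indicator (measurableSet_Ioo (a := 0) (b := r))).coeFn_toLp]
    with x hx
  rw [hx]
  by_cases hx2 : x ∈ Ioo 0 r <;> simp [hx2]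

lemma memLp_indicator_one (s : Set ℝ) (hs : MeasurableSet s) :
    MemLp (s.indicator (fun _ : ℝ => (1 : ℝ))) 2 (volume.restrict (Ioo (0 : ℝ) 1)) :=
  (memLp_const (1 : ℝ)).indicator hs

/-- The operator is a norm limit of finite-rank ones: on each cell $[k/n,(k+1)/n)$ the primitive is
replaced by its value at $k/n$. Uniform continuity of `voltSq` makes the error small uniformly in
$f$. -/
lemma isCompactOperator_voltOp {β : ℝ} (hβ : β < 1) : IsCompactOperator (voltOp β hβ) := by
  have hcl := isClosed_setOfPred_isCompactOperator (σ₁₂ := RingHom.id ℝ) (M₁ := L2Top) (M₂ := L2Top)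
  have : voltOp β hβ ∈ closure {f : L2Top →L[ℝ] L2Top | IsCompactOperator f} := by
    rw [Metric.mem_closure_iff]
    intro ε hε
    have huc := isCompact_Icc.uniformContinuousOn_of_continuous
      ((continuous_voltSq hβ).continuousOn (s := Icc (0 : ℝ) 1))
    rw [Metric.uniformContinuousOn_iff] at huc
    obtain ⟨δ, hδ, hδ'⟩ := huc ((ε / 2) ^ 2) (by positivity)
    obtain ⟨m, hm⟩ := exists_nat_one_div_lt hδ
    set n : ℕ := m + 1 with hn
    have hn0 : (0 : ℝ) < n := by rw [hn]; positivity
    have hnδ : 1 / (n : ℝ) < δ := by rw [hn]; push_cast; exact hm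
    have hpt : ∀ k ∈ Finset.range n, ((k : ℝ) / n) ∈ Icc (0 : ℝ) 1 := fun k hk =>
      ⟨by positivity, (div_le_one hn0).2 (by exact_mod_cast (Finset.mem_range.1 hk).le)⟩
    have hex : ∀ k : ℕ, ∃ g : L2Top, k ∈ Finset.range n →
        ∀ f : L2Top, volt β f ((k : ℝ) / n) = inner ℝ g f := fun k => by
      by_cases hk : k ∈ Finset.range n
      · obtain ⟨g, hg⟩ := exists_volt_eq_inner hβ (hpt k hk)
        exact ⟨g, fun _ => hg⟩
      · exact ⟨0, fun h => absurd h hk⟩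
    choose g hg using hex
    let J : ℕ → Set ℝ := fun k => Ico ((k : ℝ) / n) ((k + 1 : ℝ) / n)
    let ind : ℕ → L2Top := fun k => (memLp_indicator_one (J k) measurableSet_Ico).toLp
    let A : L2Top →L[ℝ] L2Top := ∑ k ∈ Finset.range n, (innerSL ℝ (g k)).smulRight (ind k)
    have hA : IsCompactOperator A := by
      have : A ∈ compactOperator (RingHom.id ℝ) L2Top L2Top := by
        refine Submodule.sum_mem _ fun k _ => ?_
        have h1 : IsCompactOperator (innerSL ℝ (g k) : L2Top → ℝ) :=
          isCompactOperator_of_locallyCompactSpace_dom (innerSL ℝ (g k))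
        exact h1.continuous_comp (g := fun c : ℝ => c • ind k) (by fun_prop)
      exact this
    refine ⟨A, hA, ?_⟩
    rw [dist_eq_norm]
    refine lt_of_le_of_lt (ContinuousLinearMap.opNorm_le_bound _ (M := ε / 2) (by positivity)
      fun f => ?_) (by linarith)
    refine le_of_sq_le_sq ?_ (by positivity)
    rw [mul_pow]
    refine norm_sq_le_of_ae ?_
    have e1 : A f = ∑ k ∈ Finset.range n, inner ℝ (g k) f • ind k := by
      simp [A]
    have e2 : ∀ᵐ r ∂(volume.restrict (Ioo (0 : ℝ) 1)), A f r =
        ∑ k ∈ Finset.range n, inner ℝ (g k) f * (J k).indicator (fun _ => (1 : ℝ)) r := by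
      rw [e1]
      have h1 : ∀ᵐ r ∂(volume.restrict (Ioo (0 : ℝ) 1)), ∀ k ∈ Finset.range n,
          (inner ℝ (g k) f • ind k : L2Top) r
            = inner ℝ (g k) f * (J k).indicator (fun _ => (1 : ℝ)) r := by
        refine (Finset.eventually_all _).2 fun k _ => ?_
        filter_upwards [Lp.coeFn_smul (inner ℝ (g k) f) (ind k),
          (memLp_indicator_one (J k) measurableSet_Ico).coeFn_toLp] with r h1 h2
        rw [h1, Pi.smul_apply, smul_eq_mul, h2]
      filter_upwards [h1, Lp.coeFn_finsetSum (Finset.range n) (fun k => inner ℝ (g k) f • ind k)]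
        with r h1 h2
      rw [h2, Finset.sum_apply]
      exact Finset.sum_congr rfl h1
    filter_upwards [e2, Lp.coeFn_sub (voltOp β hβ f) (A f), voltOp_coe hβ f,
      ae_restrict_mem measurableSet_Ioo] with r h1 h2 h3 hr
    rw [sub_apply, h2, Pi.sub_apply, h1, h3]
    have hnr : 0 ≤ (n : ℝ) * r := by have := hr.1; positivity
    -- The index of the cell containing $r$; all other terms of the finite-rank operator vanish
    -- there.
    set k := ⌊(n : ℝ) * r⌋₊ with hk
    have hk1 : (k : ℝ) ≤ n * r := Nat.floor_le hnr
    have hk2 : (n : ℝ) * r < k + 1 := Nat.lt_floor_add_one _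
    have hkn : k ∈ Finset.range n := by
      rw [Finset.mem_range, hk, Nat.floor_lt hnr]
      nlinarith [hr.2]
    have hJ : ∀ j, r ∈ J j ↔ j = k := by
      intro j
      simp only [J, mem_Ico, div_le_iff₀ hn0, lt_div_iff₀ hn0]
      rw [mul_comm r]
      refine ⟨fun h => ?_, fun h => ?_⟩
      · have := (Nat.floor_eq_iff hnr).2 h
        rw [← this]
      · rw [h]; exact ⟨hk1, hk2⟩
    rw [Finset.sum_eq_single_of_mem k hkn (fun j _ hj => by simp [hJ, hj]),
      indicator_of_mem ((hJ k).2 rfl), mul_one, ← hg k hkn]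
    have hle : (k : ℝ) / n ≤ r := by rw [div_le_iff₀ hn0]; linarith
    refine (abs_setIntegral_wt_mul_le hβ f (by positivity) hle hr.2.le).trans ?_
    refine mul_le_mul_of_nonneg_right ?_ (sq_nonneg _)
    have hlt : r - k / n < δ := by
      have : r < (k + 1) / n := by rw [lt_div_iff₀ hn0]; linarith
      have e : ((k : ℝ) + 1) / n = k / n + 1 / n := by ring
      linarith
    have := hδ' r (Ioo_subset_Icc_self hr) (k / n) (hpt k hkn) (by
      rw [Real.dist_eq, abs_of_nonneg (by linarith)]; exact hlt)
    rw [Real.dist_eq] at this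
    exact (le_abs_self _).trans this.le
  rwa [hcl.closure_eq] at this

/-! ### The degenerate Sturm-Liouville problem -/

lemma memLp_rpow_mul {β : ℝ} (hβ : β < 1) {g : ℝ → ℝ} (hg : ContinuousOn g (Icc 0 1)) :
    MemLp (fun r => r ^ (-(β / 2)) * g r) 2 (volume.restrict (Ioo (0 : ℝ) 1)) := by
  have hm := (memLp_rpow hβ).aestronglyMeasurable.mul
    ((hg.mono Ioo_subset_Icc_self).aestronglyMeasurable (μ := volume) measurableSet_Ioo)
  refine (memLp_two_iff_integrable_sq hm).2 ?_
  have h1 : IntegrableOn (fun r : ℝ => (r ^ (-(β / 2))) ^ 2) (Icc 0 1) := by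
    rw [integrableOn_Icc_iff_integrableOn_Ioo]
    exact (memLp_rpow hβ).integrable_sq
  refine ((h1.mul_continuousOn (hg.pow 2) isCompact_Icc).mono_set Ioo_subset_Icc_self).congr ?_
  refine Eventually.of_forall fun r => ?_
  simp only [Pi.mul_apply, Pi.pow_apply]
  ring

/-- `ρ ↦ ∫_ρ^1 w`. -/
def tailInt (w : ℝ → ℝ) (r : ℝ) : ℝ := ∫ s in r..1, w s

lemma L2Top.intervalIntegrable (w : L2Top) : IntervalIntegrable w volume 0 1 :=
  intervalIntegrable_of_memLp zero_le_one (Lp.memLp w)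

lemma isPrim_tailInt (w : L2Top) : IsPrim 1 (tailInt w) (fun r => -w r) := by
  have h := L2Top.intervalIntegrable w
  refine ⟨h.neg, fun t ht => ?_⟩
  have h1 : IntervalIntegrable w volume 0 t := by
    refine h.mono_set ?_
    rw [uIcc_of_le ht.1, uIcc_of_le zero_le_one]; exact Icc_subset_Icc_right ht.2
  have h2 : IntervalIntegrable w volume t 1 := by
    refine h.mono_set ?_
    rw [uIcc_of_le ht.2, uIcc_of_le zero_le_one]; exact Icc_subset_Icc_left ht.1
  have := intervalIntegral.integral_add_adjacent_intervals h1 h2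
  rw [intervalIntegral.integral_neg, tailInt, tailInt]
  linarith

lemma continuousOn_tailInt (w : L2Top) : ContinuousOn (tailInt w) (Icc 0 1) :=
  (isPrim_tailInt w).continuousOn zero_le_one

/-- Integration by parts between the tail integral of $w$, which vanishes at $1$, and the primitive
`volt β f`, which vanishes at $0$: there is no boundary term. -/
lemma adjoint_voltOp {β : ℝ} (hβ : β < 1) (w : L2Top) :
    (voltOp β hβ).adjoint w = (memLp_rpow_mul hβ (continuousOn_tailInt w)).toLp := by
  refine ext_inner_right ℝ fun f => ?_
  rw [ContinuousLinearMap.adjoint_inner_left, L2Top.inner_eq, L2Top.inner_eq]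
  have h := ((isPrim_tailInt w).mul zero_le_one (isPrim_volt hβ f))
  have h1 := h.eq 1 ⟨zero_le_one, le_rfl⟩
  have z1 : tailInt w 1 = 0 := by simp [tailInt]
  have z2 : volt β f 0 = 0 := by simp [volt]
  rw [z1, z2, zero_mul, mul_zero, zero_add, ← setIntegral_Ioo_eq zero_le_one, integral_add] at h1
  · have e1 : ∫ r in Ioo (0 : ℝ) 1, w r * voltOp β hβ f r
        = - ∫ r in Ioo (0 : ℝ) 1, -w r * volt β f r := by
      rw [← integral_neg]
      apply integral_congr_ae
      filter_upwards [voltOp_coe hβ f] with r hr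
      rw [hr]; ring
    have e2 : ∫ r in Ioo (0 : ℝ) 1, ((memLp_rpow_mul hβ (continuousOn_tailInt w)).toLp : L2Top) r * f r
        = ∫ r in Ioo (0 : ℝ) 1, tailInt w r * (r ^ (-(β / 2)) * f r) := by
      apply integral_congr_ae
      filter_upwards [(memLp_rpow_mul hβ (continuousOn_tailInt w)).coeFn_toLp] with r hr
      rw [hr]; ring
    rw [e1, e2]; linarith
  · exact (Lp.memLp w).neg.integrable_mul (memLp_volt hβ f)
  · have := (memLp_of_continuousOn (continuousOn_tailInt w)).integrable_mul
      (memLp_volt hβ f)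
    have h3 : IntegrableOn (fun r : ℝ => r ^ (-(β / 2)) * f r) (Icc 0 1) := by
      rw [integrableOn_Icc_iff_integrableOn_Ioo]; exact integrableOn_wt_mul hβ f
    exact (h3.continuousOn_mul (continuousOn_tailInt w) isCompact_Icc).mono_set Ioo_subset_Icc_self

/-- The constant that makes the weighted gradient orthogonal to `r^{-β/2}`. -/
def slConst (β : ℝ) (hβ : β < 1) (w : L2Top) : ℝ :=
  (‖wt β hβ‖ ^ 2)⁻¹ * inner ℝ (voltOp β hβ (wt β hβ)) w

/-- The weighted gradient `r^{β/2} u'` of the solution `u` of `-(r^β u')' = w`, `u(0) = u(1) = 0`. -/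
def slGrad (β : ℝ) (hβ : β < 1) (w : L2Top) : L2Top :=
  (voltOp β hβ).adjoint w - slConst β hβ w • wt β hβ

/-- The solution operator of `-(r^β u')' = w`, `u(0) = u(1) = 0`. -/
def slOp (β : ℝ) (hβ : β < 1) : L2Top →L[ℝ] L2Top :=
  (voltOp β hβ).comp (voltOp β hβ).adjoint - (‖wt β hβ‖ ^ 2)⁻¹ •
    (innerSL ℝ (voltOp β hβ (wt β hβ))).smulRight (voltOp β hβ (wt β hβ))

/-- With $V$ the Volterra operator and $P$ the orthogonal projection on $r^{-\beta/2}$, the rank-one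
correction turns $VV^*$ into $V(1-P)V^*$. -/
lemma slOp_apply {β : ℝ} (hβ : β < 1) (w : L2Top) :
    slOp β hβ w = voltOp β hβ (slGrad β hβ w) := by
  simp only [slOp, slGrad, slConst, sub_apply, ContinuousLinearMap.comp_apply,
    smul_apply, ContinuousLinearMap.smulRight_apply, innerSL_apply_apply, map_sub,
    map_smul, smul_smul]

/-- This orthogonality encodes the boundary condition at $r=1$: the primitive `volt` at $1$ is the
inner product with $r^{-\beta/2}$. -/
lemma inner_wt_slGrad {β : ℝ} (hβ : β < 1) (w : L2Top) :
    inner ℝ (wt β hβ) (slGrad β hβ w) = 0 := by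
  rw [slGrad, inner_sub_right, ContinuousLinearMap.adjoint_inner_right, inner_smul_right,
    real_inner_self_eq_norm_sq, slConst]
  by_cases h : ‖wt β hβ‖ = 0
  · rw [norm_eq_zero] at h
    simp [h]
  · field_simp
    ring

/-- $V^*w$ differs from the weighted gradient by a multiple of $r^{-\beta/2}$, to which the gradient
is orthogonal. The identity yields both injectivity and positivity of the eigenvalues. -/
lemma inner_slOp_self {β : ℝ} (hβ : β < 1) (w : L2Top) :
    inner ℝ (slOp β hβ w) w = ‖slGrad β hβ w‖ ^ 2 := by
  have e : (voltOp β hβ).adjoint w = slGrad β hβ w + slConst β hβ w • wt β hβ := by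
    simp [slGrad]
  rw [slOp_apply, ← ContinuousLinearMap.adjoint_inner_right, e, inner_add_right, inner_smul_right,
    real_inner_comm (wt β hβ), inner_wt_slGrad, mul_zero, add_zero, real_inner_self_eq_norm_sq]

lemma isSymmetric_slOp {β : ℝ} (hβ : β < 1) : (slOp β hβ : L2Top →ₗ[ℝ] L2Top).IsSymmetric := by
  intro x y
  have key : inner ℝ (voltOp β hβ ((voltOp β hβ).adjoint x)) y
      = inner ℝ x (voltOp β hβ ((voltOp β hβ).adjoint y)) := by
    rw [← ContinuousLinearMap.adjoint_inner_right, ContinuousLinearMap.adjoint_inner_left]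
  simp only [slOp, ContinuousLinearMap.coe_coe, sub_apply,
    ContinuousLinearMap.comp_apply, smul_apply,
    ContinuousLinearMap.smulRight_apply, innerSL_apply_apply, inner_sub_left, inner_sub_right,
    inner_smul_left, inner_smul_right]
  rw [key, real_inner_comm (voltOp β hβ (wt β hβ)) x]
  simp only [conj_trivial]
  ring

lemma isCompactOperator_slOp {β : ℝ} (hβ : β < 1) : IsCompactOperator (slOp β hβ) := by
  have h1 := (isCompactOperator_voltOp hβ).comp_clm (voltOp β hβ).adjoint
  have h2 : IsCompactOperator (innerSL ℝ (voltOp β hβ (wt β hβ)) : L2Top → ℝ) :=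
    isCompactOperator_of_locallyCompactSpace_dom (innerSL ℝ (voltOp β hβ (wt β hβ)))
  have h3 := h2.continuous_comp (g := fun c : ℝ => (‖wt β hβ‖ ^ 2)⁻¹ • c • voltOp β hβ (wt β hβ))
    (by fun_prop)
  exact h1.sub h3

lemma slGrad_coe {β : ℝ} (hβ : β < 1) (w : L2Top) :
    (slGrad β hβ w : ℝ → ℝ) =ᵐ[volume.restrict (Ioo (0 : ℝ) 1)]
      fun r => r ^ (-(β / 2)) * (tailInt w r - slConst β hβ w) := by
  rw [slGrad, adjoint_voltOp]
  filter_upwards [Lp.coeFn_sub ((memLp_rpow_mul hβ (continuousOn_tailInt w)).toLp)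
    (slConst β hβ w • wt β hβ), Lp.coeFn_smul (slConst β hβ w) (wt β hβ), wt_coe hβ,
    (memLp_rpow_mul hβ (continuousOn_tailInt w)).coeFn_toLp] with r h1 h2 h3 h4
  rw [h1, Pi.sub_apply, h2, Pi.smul_apply, h3, h4, smul_eq_mul]
  ring

/-- The tail integral is continuous, hence constant on the whole open interval, and its derivative
is $-w$ almost everywhere. -/
lemma ae_eq_zero_of_tailInt_eq {w : L2Top} {c : ℝ}
    (h : ∀ᵐ r ∂(volume.restrict (Ioo (0 : ℝ) 1)), tailInt w r = c) : w = 0 := by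
  have h1 : EqOn (tailInt w) (fun _ => c) (Ioo 0 1) :=
    Measure.eqOn_open_of_ae_eq h isOpen_Ioo
      ((continuousOn_tailInt w).mono Ioo_subset_Icc_self) continuousOn_const
  have h2 := (L2Top.intervalIntegrable w).neg.ae_hasDerivAt_integral
  rw [Lp.eq_zero_iff_ae_eq_zero]
  rw [Filter.EventuallyEq, ae_restrict_iff' measurableSet_Ioo]
  filter_upwards [h2] with r hr hr'
  have h3 := hr (by rw [uIcc_of_le zero_le_one]; exact Ioo_subset_Icc_self hr') 0 (by simp)
  have h4 : HasDerivAt (fun r => ∫ s in (0 : ℝ)..r, (-(w : ℝ → ℝ)) s) 0 r := by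
    have : (fun r => ∫ s in (0 : ℝ)..r, (-(w : ℝ → ℝ)) s) =ᶠ[𝓝 r] fun _ => c - tailInt w 0 := by
      filter_upwards [isOpen_Ioo.mem_nhds hr'] with s hs
      have := (isPrim_tailInt w).eq s (Ioo_subset_Icc_self hs)
      rw [h1 hs] at this
      simp only [Pi.neg_apply]
      linarith
    exact (hasDerivAt_const r _).congr_of_eventuallyEq this
  have := h3.unique h4
  simpa using this

lemma slOp_injective {β : ℝ} (hβ : β < 1) (w : L2Top) (h : slOp β hβ w = 0) : w = 0 := by
  have h1 := inner_slOp_self hβ w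
  rw [h, inner_zero_left, eq_comm, sq_eq_zero_iff, norm_eq_zero] at h1
  refine ae_eq_zero_of_tailInt_eq (c := slConst β hβ w) ?_
  have h2 := slGrad_coe hβ w
  rw [h1] at h2
  filter_upwards [h2, Lp.coeFn_zero ℝ 2 (volume.restrict (Ioo (0 : ℝ) 1)),
    ae_restrict_mem measurableSet_Ioo] with r h3 h4 hr
  rw [h4, Pi.zero_apply, eq_comm, mul_eq_zero] at h3
  have := (Real.rpow_pos_of_pos hr.1 (-(β / 2))).ne'
  simp only [this, false_or] at h3
  linarith

/-- `W` is an eigenfunction of `-(r^β W')' = μ W` on `(0,1)` with Dirichlet boundary conditions and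
with flux `F = r^β W'`. -/
structure Mode (β μ : ℝ) (W F : ℝ → ℝ) : Prop where
  pos : 0 < μ
  cont : Continuous W
  zero : W 0 = 0
  one : W 1 = 0
  hasDerivAt : ∀ r ∈ Ioo (0 : ℝ) 1, HasDerivAt W (r ^ (-β) * F r) r
  flux : ∀ r, HasDerivAt F (-(μ * W r)) r

/-- The eigenvalue relation reads $w=\kappa^{-1}V(\text{weighted gradient})$, and its right-hand
side is continuous. Feeding this representative back into the formula for the gradient shows that
the flux is a primitive of $-\kappa^{-1}w$, hence $C^1$. -/
lemma exists_mode {β : ℝ} (hβ : β < 1) {w : L2Top} {κ : ℝ} (hκ : 0 < κ)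
    (h : slOp β hβ w = κ • w) :
    ∃ W F : ℝ → ℝ, Mode β κ⁻¹ W F ∧ (w : ℝ → ℝ) =ᵐ[volume.restrict (Ioo (0 : ℝ) 1)] W := by
  set c := slConst β hβ w
  set W₀ : ℝ → ℝ := fun r => κ⁻¹ * volt β (slGrad β hβ w) r with hW₀
  have c₀ : ContinuousOn W₀ (Icc 0 1) :=
    continuousOn_const.mul ((isPrim_volt hβ _).continuousOn zero_le_one)
  -- Extension by constants outside $[0,1]$ makes $W$ continuous on the line, so the flux, a tail
  -- integral of $W$, is differentiable at every real point.
  set W : ℝ → ℝ := IccExtend zero_le_one ((Icc (0 : ℝ) 1).domRestrict W₀) with hW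
  have cW : Continuous W := (continuousOn_iff_continuous_domRestrict.1 c₀).Icc_extend'
  have eW : ∀ r ∈ Icc (0 : ℝ) 1, W r = W₀ r := fun r hr => by
    rw [hW, IccExtend_of_mem _ _ hr]; rfl
  have hw : (w : ℝ → ℝ) =ᵐ[volume.restrict (Ioo (0 : ℝ) 1)] W := by
    have e1 : w = κ⁻¹ • voltOp β hβ (slGrad β hβ w) := by
      rw [← slOp_apply, h, smul_smul, inv_mul_cancel₀ hκ.ne', one_smul]
    have e2 := Lp.coeFn_smul κ⁻¹ (voltOp β hβ (slGrad β hβ w))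
    rw [← e1] at e2
    filter_upwards [e2, voltOp_coe hβ (slGrad β hβ w), ae_restrict_mem measurableSet_Ioo]
      with r h1 h2 h3
    rw [h1, Pi.smul_apply, h2, eW r (Ioo_subset_Icc_self h3), smul_eq_mul]
  have htail : ∀ r ∈ Icc (0 : ℝ) 1, tailInt w r = tailInt W r := by
    intro r hr
    rw [tailInt, tailInt, intervalIntegral.integral_of_le hr.2, intervalIntegral.integral_of_le hr.2,
      integral_Ioc_eq_integral_Ioo, integral_Ioc_eq_integral_Ioo]
    apply integral_congr_ae
    exact ae_restrict_of_ae_restrict_of_subset (Ioo_subset_Ioo_left hr.1) hw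
  have hFd : ∀ r, HasDerivAt (fun r => κ⁻¹ * (tailInt W r - c)) (-(κ⁻¹ * W r)) r := by
    intro r
    have h1 : HasDerivAt (tailInt W) (-W r) r :=
      intervalIntegral.integral_hasDerivAt_left (cW.intervalIntegrable _ _)
        (cW.stronglyMeasurableAtFilter _ _) cW.continuousAt
    convert! (h1.sub_const c).const_mul κ⁻¹ using 1
    ring
  have cF : Continuous (fun r => κ⁻¹ * (tailInt W r - c)) :=
    continuous_iff_continuousAt.2 fun r => (hFd r).continuousAt
  have hvolt : ∀ r ∈ Icc (0 : ℝ) 1, W₀ r = ∫ s in (0 : ℝ)..r, s ^ (-β) * (κ⁻¹ * (tailInt W s - c)) := by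
    intro r hr
    rw [hW₀]
    simp only
    rw [volt_congr (slGrad_coe hβ w) hr, volt, ← intervalIntegral.integral_const_mul]
    refine intervalIntegral.integral_congr_ae (Eventually.of_forall fun s hs => ?_)
    rw [uIoc_of_le hr.1] at hs
    rw [htail s ⟨hs.1.le, hs.2.trans hr.2⟩]
    have : s ^ (-β) = s ^ (-(β / 2)) * s ^ (-(β / 2)) := by
      rw [← Real.rpow_add hs.1]; congr 1; ring
    rw [this]; ring
  refine ⟨W, fun r => κ⁻¹ * (tailInt W r - c), ⟨inv_pos.2 hκ, cW, ?_, ?_, ?_, hFd⟩, hw⟩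
  · rw [eW 0 (by simp)]; simp [hW₀, volt]
  · rw [eW 1 (by simp)]
    have : volt β (slGrad β hβ w) 1 = inner ℝ (wt β hβ) (slGrad β hβ w) := by
      rw [L2Top.inner_eq, volt, ← setIntegral_Ioo_eq zero_le_one]
      apply integral_congr_ae
      filter_upwards [wt_coe hβ] with r hr
      rw [hr]
    simp [hW₀, this, inner_wt_slGrad]
  · intro r hr
    have h1 : HasDerivAt (fun r => ∫ s in (0 : ℝ)..r, s ^ (-β) * (κ⁻¹ * (tailInt W s - c)))
        (r ^ (-β) * (κ⁻¹ * (tailInt W r - c))) r := by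
      have hc : ContinuousOn (fun s : ℝ => s ^ (-β) * (κ⁻¹ * (tailInt W s - c))) (Ioi 0) := by
        intro s hs
        exact ((Real.continuousAt_rpow_const _ _ (Or.inl (ne_of_gt hs))).mul
          cF.continuousAt).continuousWithinAt
      refine intervalIntegral.integral_hasDerivAt_right ?_ ?_ ?_
      · exact (intervalIntegrable_rpow_neg hβ 0 r).mul_continuousOn cF.continuousOn
      · exact hc.stronglyMeasurableAtFilter isOpen_Ioi r hr.1
      · exact hc.continuousAt (isOpen_Ioi.mem_nhds hr.1)
    refine h1.congr_of_eventuallyEq ?_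
    filter_upwards [isOpen_Ioo.mem_nhds hr] with s hs
    rw [eW s (Ioo_subset_Icc_self hs), hvolt s (Ioo_subset_Icc_self hs)]

/-- The spectral decomposition of the one-dimensional problem. -/
lemma exists_modes {β : ℝ} (hβ : β < 1) :
    ∃ (ι : Type) (b : HilbertBasis ι ℝ L2Top) (μ : ι → ℝ) (W F : ι → ℝ → ℝ) (m : ℝ),
      Countable ι ∧ 0 < m ∧ ∀ i, m ≤ μ i ∧ Mode β (μ i) (W i) (F i) ∧
        (b i : ℝ → ℝ) =ᵐ[volume.restrict (Ioo (0 : ℝ) 1)] W i := by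
  obtain ⟨ι, b, κ, hb⟩ := exists_hilbertBasis_eigenvectors (isCompactOperator_slOp hβ)
    (isSymmetric_slOp hβ) (slOp_injective hβ)
  have hκ : ∀ i, 0 < κ i := by
    intro i
    have h1 := inner_slOp_self hβ (b i)
    rw [hb i, inner_smul_left, real_inner_self_eq_norm_sq, b.orthonormal.1 i] at h1
    simp at h1
    have h2 : 0 ≤ κ i := by rw [h1]; positivity
    refine lt_of_le_of_ne h2 fun h0 => ?_
    have h3 := slOp_injective hβ (b i) (by rw [hb i, ← h0, zero_smul])
    have := b.orthonormal.1 i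
    rw [h3] at this
    simp at this
  have hex := fun i => exists_mode hβ (hκ i) (hb i)
  choose W F hWF hw using hex
  -- Needed for $L^2(0,1)$ to be recognised as second countable, hence for the index set to be
  -- countable.
  have : Fact ((2 : ℝ≥0∞) ≠ ⊤) := ⟨by norm_num⟩
  -- Eigenvalues of the solution operator are at most its norm, so their inverses are bounded below;
  -- the added $1$ gives positivity without showing that the operator is nonzero.
  have hn : 0 < ‖slOp β hβ‖ + 1 := by positivity
  refine ⟨ι, b, fun i => (κ i)⁻¹, W, F, (‖slOp β hβ‖ + 1)⁻¹, countable_of_orthonormal b.orthonormal,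
    inv_pos.2 hn, fun i => ⟨?_, hWF i, hw i⟩⟩
  have h1 := (slOp β hβ).le_opNorm (b i)
  rw [hb i, norm_smul, b.orthonormal.1 i, mul_one, mul_one, Real.norm_of_nonneg (hκ i).le] at h1
  exact inv_anti₀ (hκ i) (by linarith)

/-! ### Products of functions of one variable -/

lemma restrict_Ω : (volume.restrict Ω : Measure (ℝ × ℝ)) =
    (volume.restrict (Ioo (0 : ℝ) 1)).prod (volume.restrict (Ioo (0 : ℝ) 1)) := by
  rw [Ω, Measure.volume_eq_prod, Measure.prod_restrict]

lemma integral_Ω (g : ℝ × ℝ → ℝ) : ∫ z in Ω, g z =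
    ∫ z, g z ∂((volume.restrict (Ioo (0 : ℝ) 1)).prod (volume.restrict (Ioo (0 : ℝ) 1))) := by
  rw [restrict_Ω]

lemma isOpen_Ω : IsOpen Ω := isOpen_Ioo.prod isOpen_Ioo

lemma measurableSet_Ω : MeasurableSet Ω := isOpen_Ω.measurableSet

lemma L2.inner_eq {U : Set (ℝ × ℝ)} (f g : L2 U) : inner ℝ f g = ∫ z in U, f z * g z := by
  rw [MeasureTheory.L2.inner_def]
  congr 1; funext r; simp [mul_comm]

lemma ae_fst {p : ℝ → Prop} (h : ∀ᵐ r ∂(volume.restrict (Ioo (0 : ℝ) 1)), p r) :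
    ∀ᵐ z ∂(volume.restrict Ω), p z.1 := by
  rw [restrict_Ω]
  exact Measure.quasiMeasurePreserving_fst.ae h

lemma ae_snd {p : ℝ → Prop} (h : ∀ᵐ r ∂(volume.restrict (Ioo (0 : ℝ) 1)), p r) :
    ∀ᵐ z ∂(volume.restrict Ω), p z.2 := by
  rw [restrict_Ω]
  exact Measure.quasiMeasurePreserving_snd.ae h

lemma memLp_tens (f g : L2Top) :
    MemLp (fun z : ℝ × ℝ => f z.1 * g z.2) 2 (volume.restrict Ω) := by
  rw [restrict_Ω]
  refine (memLp_two_iff_integrable_sq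
    ((Lp.aestronglyMeasurable f).comp_fst.mul (Lp.aestronglyMeasurable g).comp_snd)).2 ?_
  refine ((Lp.memLp f).integrable_sq.mul_prod (Lp.memLp g).integrable_sq).congr ?_
  refine Eventually.of_forall fun z => ?_
  simp only [Pi.mul_apply]
  ring

/-- The function `(θ, r) ↦ f(θ) g(r)`. -/
def tens (f g : L2Top) : L2 Ω := (memLp_tens f g).toLp

lemma tens_coe (f g : L2Top) :
    (tens f g : ℝ × ℝ → ℝ) =ᵐ[volume.restrict Ω] fun z => f z.1 * g z.2 :=
  MemLp.coeFn_toLp _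

lemma tens_coe' {f g : L2Top} {φ ψ : ℝ → ℝ} (hf : f =ᵐ[volume.restrict (Ioo (0 : ℝ) 1)] φ)
    (hg : g =ᵐ[volume.restrict (Ioo (0 : ℝ) 1)] ψ) :
    (tens f g : ℝ × ℝ → ℝ) =ᵐ[volume.restrict Ω] fun z => φ z.1 * ψ z.2 := by
  filter_upwards [tens_coe f g, ae_fst hf, ae_snd hg] with z h1 h2 h3
  rw [h1, h2, h3]

lemma inner_tens (f g f' g' : L2Top) :
    inner ℝ (tens f g) (tens f' g') = inner ℝ f f' * inner ℝ g g' := by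
  rw [L2.inner_eq, L2Top.inner_eq, L2Top.inner_eq, ← integral_prod_mul, ← integral_Ω]
  apply integral_congr_ae
  filter_upwards [tens_coe f g, tens_coe f' g'] with z h1 h2
  rw [h1, h2]; ring

/-- Expanding the square of the norm leaves only products of one-dimensional inner products, all of
them continuous. -/
lemma tendsto_tens {f g : ℕ → L2Top} {f' g' : L2Top} (hf : Tendsto f atTop (𝓝 f'))
    (hg : Tendsto g atTop (𝓝 g')) : Tendsto (fun n => tens (f n) (g n)) atTop (𝓝 (tens f' g')) := by
  rw [tendsto_iff_norm_sub_tendsto_zero]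
  have h1 : Tendsto (fun n => ‖tens (f n) (g n) - tens f' g'‖ ^ 2) atTop (𝓝 0) := by
    have e : ∀ n, ‖tens (f n) (g n) - tens f' g'‖ ^ 2 = inner ℝ (f n) (f n) * inner ℝ (g n) (g n)
        - 2 * (inner ℝ (f n) f' * inner ℝ (g n) g') + inner ℝ f' f' * inner ℝ g' g' := by
      intro n
      rw [norm_sub_sq_real, ← real_inner_self_eq_norm_sq, ← real_inner_self_eq_norm_sq, inner_tens,
        inner_tens, inner_tens]
    simp only [e]
    have h2 := ((((hf.inner (𝕜 := ℝ) hf).mul (hg.inner (𝕜 := ℝ) hg)).sub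
      (((hf.inner (𝕜 := ℝ) (tendsto_const_nhds (x := f'))).mul
        (hg.inner (𝕜 := ℝ) (tendsto_const_nhds (x := g')))).const_mul 2)).add
      (tendsto_const_nhds (x := inner ℝ f' f' * inner ℝ g' g')))
    convert! h2 using 2
    ring
  have := h1.sqrt
  simpa using this

lemma eq_zero_of_inner_basis {ι : Type*} (b : HilbertBasis ι ℝ L2Top) {f : L2Top}
    (h : ∀ i, inner ℝ (b i) f = 0) : f = 0 := by
  apply b.repr.injective
  ext i
  rw [b.repr_apply_apply, h i]
  simp

lemma sq_integral_mul_le {μ : Measure ℝ} {f g : ℝ → ℝ} (hf : MemLp f 2 μ) (hg : MemLp g 2 μ) :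
    (∫ x, f x * g x ∂μ) ^ 2 ≤ (∫ x, f x ^ 2 ∂μ) * ∫ x, g x ^ 2 ∂μ := by
  have e : ∀ {p q : ℝ → ℝ} (hp : MemLp p 2 μ) (hq : MemLp q 2 μ),
      inner ℝ (hp.toLp p) (hq.toLp q) = ∫ x, p x * q x ∂μ := by
    intro p q hp hq
    rw [MeasureTheory.L2.inner_def]
    apply integral_congr_ae
    filter_upwards [hp.coeFn_toLp, hq.coeFn_toLp] with x h1 h2
    rw [h1, h2]; simp [mul_comm]
  have h := abs_real_inner_le_norm (hf.toLp f) (hg.toLp g)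
  have h1 := e hf hf
  have h2 := e hg hg
  rw [real_inner_self_eq_norm_sq] at h1 h2
  simp only [← sq] at h1 h2
  rw [← h1, ← h2, ← e hf hg, ← mul_pow, ← sq_abs]
  exact pow_le_pow_left₀ (abs_nonneg _) h 2

/-- Completeness of the products of two orthonormal bases. -/
lemma eq_zero_of_inner_tens {ι κ : Type*} [Countable ι] (b : HilbertBasis ι ℝ L2Top)
    (b' : HilbertBasis κ ℝ L2Top) {u : L2 Ω} (h : ∀ i j, inner ℝ (tens (b i) (b' j)) u = 0) :
    u = 0 := by
  set m := volume.restrict (Ioo (0 : ℝ) 1) with hm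
  have iu : Integrable (fun z => u z ^ 2) (m.prod m) := by
    rw [hm, ← restrict_Ω]; exact (Lp.memLp u).integrable_sq
  have mu : AEStronglyMeasurable (u : ℝ × ℝ → ℝ) (m.prod m) := by
    rw [hm, ← restrict_Ω]; exact Lp.aestronglyMeasurable u
  have hsl : ∀ᵐ r ∂m, MemLp (fun θ => u (θ, r)) 2 m := by
    filter_upwards [iu.prod_left_ae, mu.prodMk_right] with r h1 h2
    exact (memLp_two_iff_integrable_sq h2).2 h1
  -- As a function of $r$, the coefficient of the slice $u(\cdot,r)$ along $b_i$ is in $L^2$ and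
  -- orthogonal to every $b'_j$.
  have hk : ∀ i, ∀ᵐ r ∂m, ∫ θ, u (θ, r) * b i θ ∂m = 0 := by
    intro i
    have mm : AEStronglyMeasurable (fun z : ℝ × ℝ => u z * b i z.1) (m.prod m) :=
      mu.mul (Lp.aestronglyMeasurable (b i)).comp_fst
    have hL : MemLp (fun r => ∫ θ, u (θ, r) * b i θ ∂m) 2 m := by
      have hm1 : AEStronglyMeasurable (fun r => ∫ θ, u (θ, r) * b i θ ∂m) m :=
        mm.prod_swap.integral_prod_right'
      refine (memLp_two_iff_integrable_sq hm1).2 ?_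
      have i2 : Integrable (fun r => (∫ θ, u (θ, r) ^ 2 ∂m) * ∫ θ, b i θ ^ 2 ∂m) m :=
        iu.integral_prod_right.mul_const _
      refine i2.mono' (hm1.pow 2) ?_
      filter_upwards [hsl] with r hr
      rw [Real.norm_of_nonneg (sq_nonneg _)]
      exact sq_integral_mul_le hr (Lp.memLp (b i))
    have h0 : hL.toLp = 0 := by
      refine eq_zero_of_inner_basis b' fun j => ?_
      refine Eq.trans ?_ (h i j)
      rw [L2Top.inner_eq, L2.inner_eq, integral_Ω]
      have e1 : ∫ z, tens (b i) (b' j) z * u z ∂(m.prod m)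
          = ∫ z, (b i z.1 * b' j z.2) * u z ∂(m.prod m) := by
        apply integral_congr_ae
        have hr : m.prod m = volume.restrict Ω := restrict_Ω.symm
        rw [hr]
        filter_upwards [tens_coe (b i) (b' j)] with z hz
        rw [hz]
      refine Eq.trans ?_ e1.symm
      rw [integral_prod_symm]
      · apply integral_congr_ae
        filter_upwards [hL.coeFn_toLp] with r hr
        rw [hr, ← integral_const_mul]
        congr 1; funext θ; ring
      · have := memLp_tens (b i) (b' j)
        rw [restrict_Ω] at this
        exact this.integrable_mul ((memLp_two_iff_integrable_sq mu).2 iu)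
    have h2 := (Lp.eq_zero_iff_ae_eq_zero).1 h0
    filter_upwards [h2, hL.coeFn_toLp] with r h3 h4
    rw [← h4, h3]; rfl
  -- Countability of the first index set merges the exceptional null sets: almost every slice is
  -- orthogonal to the whole basis $b$.
  have hz : ∀ᵐ r ∂m, ∫ θ, u (θ, r) ^ 2 ∂m = 0 := by
    filter_upwards [hsl, ae_all_iff.2 hk] with r h1 h2
    have h0 : h1.toLp = 0 := by
      refine eq_zero_of_inner_basis b fun i => ?_
      refine Eq.trans ?_ (h2 i)
      rw [L2Top.inner_eq]
      apply integral_congr_ae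
      filter_upwards [h1.coeFn_toLp] with θ hθ
      rw [hθ]; ring
    have h3 := (Lp.eq_zero_iff_ae_eq_zero).1 h0
    rw [integral_eq_zero_iff_of_nonneg (fun _ => sq_nonneg _) h1.integrable_sq]
    filter_upwards [h3, h1.coeFn_toLp] with θ h4 h5
    rw [← h5, h4]; simp
  have : ‖u‖ ^ 2 = 0 := by
    rw [← real_inner_self_eq_norm_sq, L2.inner_eq, integral_Ω, ← hm]
    have : ∫ z, u z * u z ∂(m.prod m) = ∫ z, u z ^ 2 ∂(m.prod m) := by simp_rw [sq]
    rw [this, integral_prod_symm _ iu, integral_congr_ae hz]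
    simp
  simpa using this

/-! ### Test functions and classical derivatives -/

lemma IsTest.continuous_mul {E : Type*} [NormedAddCommGroup E] [NormedSpace ℝ E] {U : Set E}
    {ψ h : E → ℝ} (hψ : IsTest U ψ) (hU : IsOpen U) (hh : ContinuousOn h U) :
    Continuous (fun z => h z * ψ z) := by
  rw [continuous_iff_continuousAt]
  intro z
  by_cases hz : z ∈ tsupport ψ
  · exact (hh.continuousAt (hU.mem_nhds (hψ.2.2 hz))).mul hψ.1.continuous.continuousAt
  · have hev : (fun z => h z * ψ z) =ᶠ[𝓝 z] fun _ => (0 : ℝ) := by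
      filter_upwards [(isClosed_tsupport ψ).isOpen_compl.mem_nhds hz] with y hy
      rw [image_eq_zero_of_notMem_tsupport hy, mul_zero]
    exact hev.continuousAt

lemma IsTest.hasCompactSupport_mul {E : Type*} [NormedAddCommGroup E] [NormedSpace ℝ E] {U : Set E}
    {ψ h : E → ℝ} (hψ : IsTest U ψ) : HasCompactSupport (fun z => h z * ψ z) := hψ.2.1.mul_left

lemma IsTest.fderiv_apply {E : Type*} [NormedAddCommGroup E] [NormedSpace ℝ E] {U : Set E}
    {ψ : E → ℝ} (h : IsTest U ψ) (e : E) : IsTest U (fun z => fderiv ℝ ψ z e) :=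
  ⟨(h.1.fderiv_right (m := ∞) (by simp)).clm_apply contDiff_const, h.2.1.fderiv_apply ℝ e,
    (tsupport_fderiv_apply_subset ℝ e).trans h.2.2⟩

lemma IsTest.isTest_deriv {U : Set ℝ} {η : ℝ → ℝ} (h : IsTest U η) : IsTest U (deriv η) := by
  have := h.fderiv_apply 1
  simpa using this

/-- The function $g$ may be singular at the endpoints; since η has compact support in the open
interval, $g\eta$ extends by zero to a differentiable function on the line, and the integral of its
derivative vanishes. -/
lemma integral_mul_deriv_add_eq_zero {g g' η : ℝ → ℝ} (hη : IsTest (Ioo 0 1) η)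
    (hg : ∀ r ∈ Ioo (0 : ℝ) 1, HasDerivAt g (g' r) r) (hg' : ContinuousOn g' (Ioo 0 1)) :
    ∫ r in Ioo (0 : ℝ) 1, (g r * deriv η r + g' r * η r) = 0 := by
  have cg : ContinuousOn g (Ioo 0 1) := fun r hr => (hg r hr).continuousAt.continuousWithinAt
  have c1 := (hη.continuous_mul isOpen_Ioo cg)
  have c2 := (hη.continuous_mul isOpen_Ioo hg')
  have c3 := (hη.isTest_deriv.continuous_mul isOpen_Ioo cg)
  rw [setIntegral_eq_integral_of_forall_compl_eq_zero]
  · refine integral_eq_zero_of_hasDerivAt_of_integrable (f := fun r => g r * η r) ?_ ?_ ?_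
    · intro r
      by_cases hr : r ∈ Ioo (0 : ℝ) 1
      · convert! (hg r hr).mul (hη.1.differentiable (by simp) r).hasDerivAt using 1
        ring
      · have h1 : r ∉ tsupport η := fun h => hr (hη.2.2 h)
        have e1 : g r * deriv η r + g' r * η r = 0 := by
          rw [hη.eq_zero hr, hη.isTest_deriv.eq_zero hr]; ring
        rw [e1]
        have hev : (fun z => g z * η z) =ᶠ[𝓝 r] fun _ => (0 : ℝ) := by
          filter_upwards [(isClosed_tsupport η).isOpen_compl.mem_nhds h1] with y hy
          rw [image_eq_zero_of_notMem_tsupport hy, mul_zero]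
        exact (hasDerivAt_const r (0 : ℝ)).congr_of_eventuallyEq hev
    · exact (c3.integrable_of_hasCompactSupport hη.isTest_deriv.hasCompactSupport_mul).add
        (c2.integrable_of_hasCompactSupport hη.hasCompactSupport_mul)
    · exact c1.integrable_of_hasCompactSupport hη.hasCompactSupport_mul
  · intro r hr
    rw [hη.eq_zero hr, hη.isTest_deriv.eq_zero hr]; ring

lemma IsTest.slice_snd {ψ : ℝ × ℝ → ℝ} (h : IsTest Ω ψ) (θ : ℝ) :
    IsTest (Ioo 0 1) (fun r => ψ (θ, r)) ∧
      ∀ r, deriv (fun r => ψ (θ, r)) r = fderiv ℝ ψ (θ, r) er := by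
  have hK : IsCompact (Prod.snd '' tsupport ψ) := h.2.1.isCompact.image continuous_snd
  have hs : tsupport (fun r => ψ (θ, r)) ⊆ {r | (θ, r) ∈ tsupport ψ} := by
    refine closure_minimal (fun r hr => subset_tsupport ψ hr) ?_
    exact (isClosed_tsupport ψ).preimage (by fun_prop)
  refine ⟨⟨h.1.comp (contDiff_const.prodMk contDiff_id), ?_, fun r hr => (h.2.2 (hs hr)).2⟩, ?_⟩
  · exact HasCompactSupport.of_support_subset_isCompact hK fun r hr =>
      ⟨(θ, r), subset_tsupport ψ hr, rfl⟩
  · intro r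
    have h1 : HasDerivAt (fun r : ℝ => ((θ, r) : ℝ × ℝ)) (0, 1) r :=
      (hasDerivAt_const r θ).prodMk (hasDerivAt_id r)
    exact ((h.1.differentiable (by simp) (θ, r)).hasFDerivAt.comp_hasDerivAt r h1).deriv

lemma IsTest.slice_fst {ψ : ℝ × ℝ → ℝ} (h : IsTest Ω ψ) (r : ℝ) :
    IsTest (Ioo 0 1) (fun θ => ψ (θ, r)) ∧
      ∀ θ, deriv (fun θ => ψ (θ, r)) θ = fderiv ℝ ψ (θ, r) eθ := by
  have hK : IsCompact (Prod.fst '' tsupport ψ) := h.2.1.isCompact.image continuous_fst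
  have hs : tsupport (fun θ => ψ (θ, r)) ⊆ {θ | (θ, r) ∈ tsupport ψ} := by
    refine closure_minimal (fun θ hr => subset_tsupport ψ hr) ?_
    exact (isClosed_tsupport ψ).preimage (by fun_prop)
  refine ⟨⟨h.1.comp (contDiff_id.prodMk contDiff_const), ?_, fun θ hr => (h.2.2 (hs hr)).1⟩, ?_⟩
  · exact HasCompactSupport.of_support_subset_isCompact hK fun θ hr =>
      ⟨(θ, r), subset_tsupport ψ hr, rfl⟩
  · intro θ
    have h1 : HasDerivAt (fun θ : ℝ => ((θ, r) : ℝ × ℝ)) (1, 0) θ :=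
      (hasDerivAt_id θ).prodMk (hasDerivAt_const θ r)
    exact ((h.1.differentiable (by simp) (θ, r)).hasFDerivAt.comp_hasDerivAt θ h1).deriv

lemma IsTest.integrable_mul {ψ h : ℝ × ℝ → ℝ} (hψ : IsTest Ω ψ) (hh : ContinuousOn h Ω) :
    Integrable (fun z => h z * ψ z) :=
  (hψ.continuous_mul isOpen_Ω hh).integrable_of_hasCompactSupport hψ.hasCompactSupport_mul

/-- Fubini and one-dimensional integration by parts on each line. Continuity is asked only in the
open square, so that powers of $r$ singular at $r=0$ are admitted. -/
lemma isWeakPartial_er {F G : ℝ × ℝ → ℝ} (hF : ContinuousOn F Ω) (hG : ContinuousOn G Ω)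
    (h : ∀ θ ∈ Ioo (0 : ℝ) 1, ∀ r ∈ Ioo (0 : ℝ) 1, HasDerivAt (fun s => F (θ, s)) (G (θ, r)) r) :
    IsWeakPartial Ω er F G := by
  intro ψ hψ
  have i1 := (hψ.fderiv_apply er).integrable_mul hF
  have i2 := hψ.integrable_mul hG
  rw [← add_eq_zero_iff_eq_neg, ← integral_add i1.integrableOn i2.integrableOn]
  have i3 : IntegrableOn (fun z => F z * fderiv ℝ ψ z er + G z * ψ z) (Ioo 0 1 ×ˢ Ioo 0 1)
    ((volume : Measure ℝ).prod volume) := (i1.add i2).integrableOn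
  rw [Ω, Measure.volume_eq_prod, setIntegral_prod _ i3]
  refine (setIntegral_congr_fun (g := fun _ => (0 : ℝ)) measurableSet_Ioo fun θ hθ => ?_).trans
    (by simp)
  obtain ⟨s1, s2⟩ := hψ.slice_snd θ
  have := integral_mul_deriv_add_eq_zero s1 (h θ hθ)
    (hG.comp (by fun_prop : ContinuousOn (fun r : ℝ => (θ, r)) (Ioo 0 1)) fun r hr => ⟨hθ, hr⟩)
  simp only [s2] at this
  exact this

lemma isWeakPartial_eθ {F G : ℝ × ℝ → ℝ} (hF : ContinuousOn F Ω) (hG : ContinuousOn G Ω)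
    (h : ∀ r ∈ Ioo (0 : ℝ) 1, ∀ θ ∈ Ioo (0 : ℝ) 1, HasDerivAt (fun s => F (s, r)) (G (θ, r)) θ) :
    IsWeakPartial Ω eθ F G := by
  intro ψ hψ
  have i1 := (hψ.fderiv_apply eθ).integrable_mul hF
  have i2 := hψ.integrable_mul hG
  rw [← add_eq_zero_iff_eq_neg, ← integral_add i1.integrableOn i2.integrableOn]
  have i3 : Integrable (fun z => F z * fderiv ℝ ψ z eθ + G z * ψ z)
      ((volume.restrict (Ioo (0 : ℝ) 1)).prod (volume.restrict (Ioo (0 : ℝ) 1))) := by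
    rw [← restrict_Ω]; exact (i1.add i2).integrableOn
  rw [integral_Ω, integral_prod_symm _ i3]
  refine (setIntegral_congr_fun (g := fun _ => (0 : ℝ)) measurableSet_Ioo fun r hr => ?_).trans
    (by simp)
  obtain ⟨s1, s2⟩ := hψ.slice_fst r
  have := integral_mul_deriv_add_eq_zero s1 (h r hr)
    (hG.comp (by fun_prop : ContinuousOn (fun θ : ℝ => (θ, r)) (Ioo 0 1)) fun θ hθ => ⟨hθ, hr⟩)
  simp only [s2] at this
  exact this

/-! ### The weighted Sobolev spaces -/

section sobolev

variable {α : ℝ}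

lemma IsWeakPartial.congr {U : Set (ℝ × ℝ)} {e : ℝ × ℝ} {u u' v v' : ℝ × ℝ → ℝ}
    (h : IsWeakPartial U e u v) (hu : u =ᵐ[volume.restrict U] u') (hv : v =ᵐ[volume.restrict U] v') :
    IsWeakPartial U e u' v' := by
  intro ψ hψ
  have e1 : ∫ z in U, u' z * fderiv ℝ ψ z e = ∫ z in U, u z * fderiv ℝ ψ z e := by
    apply integral_congr_ae
    filter_upwards [hu] with z hz
    rw [hz]
  have e2 : ∫ z in U, v' z * ψ z = ∫ z in U, v z * ψ z := by
    apply integral_congr_ae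
    filter_upwards [hv] with z hz
    rw [hz]
  rw [e1, e2, h ψ hψ]

lemma integral_coe_mul_eq_inner {U : Set (ℝ × ℝ)} (u : L2 U) {g : ℝ × ℝ → ℝ}
    (hg : MemLp g 2 (volume.restrict U)) : ∫ z in U, u z * g z = inner ℝ (hg.toLp g) u := by
  rw [L2.inner_eq]
  apply integral_congr_ae
  filter_upwards [hg.coeFn_toLp] with z hz
  rw [hz, mul_comm]

lemma continuous_integral_coe_mul {U : Set (ℝ × ℝ)} {g : ℝ × ℝ → ℝ}
    (hg : MemLp g 2 (volume.restrict U)) : Continuous fun u : L2 U => ∫ z in U, u z * g z := by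
  simp only [fun u : L2 U => integral_coe_mul_eq_inner u hg]
  fun_prop

lemma integral_weight_mul (s : ℝ) (a ψ : ℝ × ℝ → ℝ) :
    ∫ z in Ω, z.2 ^ s * a z * ψ z = ∫ z in Ω, a z * (z.2 ^ s * ψ z) := by
  congr 1; funext z; ring

/-- Each defining identity, for a fixed test function, equates two continuous functionals of the
triple. Completeness of the Sobolev spaces follows. -/
lemma isClosed_H1w : IsClosed (H1w α : Set (PiLp 2 (fun _ : Fin 3 => L2 Ω))) := by
  have e : (H1w α : Set (PiLp 2 (fun _ : Fin 3 => L2 Ω))) =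
      ⋂ ψ : {ψ : ℝ × ℝ → ℝ // IsTest Ω ψ}, ({x | ∫ z in Ω, x 0 z * fderiv ℝ ψ.1 z eθ
          = - ∫ z in Ω, x 1 z * ψ.1 z} ∩
        {x | ∫ z in Ω, x 0 z * fderiv ℝ ψ.1 z er
          = - ∫ z in Ω, x 2 z * (z.2 ^ (-(α / 2)) * ψ.1 z)}) := by
    ext x
    simp only [mem_iInter, mem_inter_iff, mem_ofPred_eq, Subtype.forall]
    constructor
    · intro h ψ hψ
      exact ⟨h.1 ψ hψ, by rw [← integral_weight_mul]; exact h.2 ψ hψ⟩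
    · intro h
      refine ⟨fun ψ hψ => (h ψ hψ).1, fun ψ hψ => ?_⟩
      rw [integral_weight_mul]; exact (h ψ hψ).2
  rw [e]
  have hc : ∀ i : Fin 3, Continuous fun x : PiLp 2 (fun _ : Fin 3 => L2 Ω) => x i := fun i => by
    fun_prop
  refine isClosed_iInter fun ψ => IsClosed.inter ?_ ?_
  · exact isClosed_eq ((continuous_integral_coe_mul (ψ.2.memLp_fderiv eθ)).comp (hc 0))
      ((continuous_integral_coe_mul ψ.2.memLp).comp (hc 1)).neg
  · exact isClosed_eq ((continuous_integral_coe_mul (ψ.2.memLp_fderiv er)).comp (hc 0))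
      ((continuous_integral_coe_mul (ψ.2.memLp_weight _)).comp (hc 2)).neg

instance : CompleteSpace (H1w α) := isClosed_H1w.completeSpace_coe

instance : CompleteSpace (H01 α) :=
  (Submodule.isClosed_topologicalClosure (smoothPart α)).completeSpace_coe

lemma ae_eq_of_integral_test {U : Set (ℝ × ℝ)} (hU : IsOpen U) {u v : ℝ × ℝ → ℝ}
    (hu : LocallyIntegrableOn u U) (hv : LocallyIntegrableOn v U)
    (iu : ∀ ψ, IsTest U ψ → IntegrableOn (fun z => u z * ψ z) U)
    (iv : ∀ ψ, IsTest U ψ → IntegrableOn (fun z => v z * ψ z) U)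
    (h : ∀ ψ, IsTest U ψ → ∫ z in U, u z * ψ z = ∫ z in U, v z * ψ z) :
    u =ᵐ[volume.restrict U] v := by
  have := hU.ae_eq_zero_of_integral_contDiff_smul_eq_zero (hu.sub hv) ?_
  · rw [Filter.EventuallyEq, ae_restrict_iff' hU.measurableSet]
    filter_upwards [this] with z hz hz'
    have := hz hz'
    simp only [Pi.sub_apply] at this
    linarith
  · intro g h1 h2 h3
    have hg : IsTest U g := ⟨h1, h2, h3⟩
    rw [← setIntegral_eq_integral_of_forall_compl_eq_zero (s := U)]
    · have e : (fun z => g z • (u - v) z) = fun z => u z * g z - v z * g z := by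
        funext z; simp; ring
      rw [e, integral_sub (iu g hg) (iv g hg), h g hg, sub_self]
    · intro z hz
      rw [hg.eq_zero hz, zero_smul]

lemma L2.ext_test {u v : L2 Ω} (h : ∀ ψ, IsTest Ω ψ → ∫ z in Ω, u z * ψ z = ∫ z in Ω, v z * ψ z) :
    u = v := by
  have hl : ∀ u : L2 Ω, LocallyIntegrableOn (u : ℝ × ℝ → ℝ) Ω := fun u => by
    have : IsFiniteMeasure ((volume : Measure (ℝ × ℝ)).restrict Ω) := by
      rw [restrict_Ω]; infer_instance
    exact IntegrableOn.locallyIntegrableOn ((Lp.memLp u).integrable (by norm_num))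
  exact Lp.ext (ae_eq_of_integral_test isOpen_Ω (hl u) (hl v)
    (fun ψ hψ => integrable_coe_mul u hψ.memLp) (fun ψ hψ => integrable_coe_mul v hψ.memLp) h)

/-- Functions with the same weighted test integrals agree. -/
lemma L2.ext_test_weight (s : ℝ) {u v : L2 Ω}
    (h : ∀ ψ, IsTest Ω ψ → ∫ z in Ω, z.2 ^ s * u z * ψ z = ∫ z in Ω, z.2 ^ s * v z * ψ z) :
    u = v := by
  refine L2.ext_test fun ψ hψ => ?_
  -- The weight is divided out of the test function, which is legitimate because the support stays
  -- away from $r=0$.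
  have hw : IsTest Ω (fun z : ℝ × ℝ => z.2 ^ (-s) * ψ z) := by
    refine ⟨?_, hψ.2.1.mul_left, (tsupport_mul_subset_right
      (f := fun z : ℝ × ℝ => z.2 ^ (-s)) (g := ψ)).trans hψ.2.2⟩
    rw [contDiff_iff_contDiffAt]
    intro z
    by_cases hz : z ∈ tsupport ψ
    · have h0 : z.2 ≠ 0 := ne_of_gt (hψ.2.2 hz).2.1
      exact (contDiffAt_snd.rpow_const_of_ne h0).mul hψ.1.contDiffAt
    · have hev : (fun z : ℝ × ℝ => z.2 ^ (-s) * ψ z) =ᶠ[𝓝 z] fun _ => (0 : ℝ) := by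
        filter_upwards [(isClosed_tsupport ψ).isOpen_compl.mem_nhds hz] with y hy
        rw [image_eq_zero_of_notMem_tsupport hy, mul_zero]
      exact contDiffAt_const.congr_of_eventuallyEq hev
  have e : ∀ u : L2 Ω, ∫ z in Ω, u z * ψ z = ∫ z in Ω, z.2 ^ s * u z * (z.2 ^ (-s) * ψ z) := by
    intro u
    refine setIntegral_congr_fun measurableSet_Ω fun z hz => ?_
    have : z.2 ^ s * z.2 ^ (-s) = 1 := by
      rw [← Real.rpow_add hz.2.1]; simp
    linear_combination (-(u z * ψ z)) * this
  rw [e, e, h _ hw]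

/-- Uniqueness of weak derivatives. It makes `val` injective, so that elements of $H^1_0(\Omega;w)$
are determined by their $L^2$ coefficients. -/
lemma H1w.ext {x y : H1w α} (h : x.1 0 = y.1 0) : x = y := by
  apply Subtype.ext
  ext i : 1
  fin_cases i
  · exact h
  · refine L2.ext_test fun ψ hψ => ?_
    have h1 := x.2.1 ψ hψ
    have h2 := y.2.1 ψ hψ
    rw [h, h2, neg_inj] at h1
    exact h1.symm
  · refine L2.ext_test_weight (-(α / 2)) fun ψ hψ => ?_
    have h1 := x.2.2 ψ hψ
    have h2 := y.2.2 ψ hψ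
    rw [h, h2, neg_inj] at h1
    exact h1.symm

lemma val_apply (u : H01 α) : val u = (incl u).1 0 := rfl

lemma val_injective : Function.Injective (val : H01 α → L2 Ω) := by
  intro u v h
  have h1 : incl u = incl v := H1w.ext h
  exact Subtype.ext h1

lemma IsTest.memLp_weight_fderiv {ψ : ℝ × ℝ → ℝ} (h : IsTest Ω ψ) (s : ℝ) :
    MemLp (fun z : ℝ × ℝ => z.2 ^ s * fderiv ℝ ψ z er) 2 (volume.restrict Ω) :=
  (h.fderiv_apply er).memLp_weight s

lemma isWeakPartial_of_isTest {ψ : ℝ × ℝ → ℝ} (hψ : IsTest Ω ψ) :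
    IsWeakPartial Ω eθ ψ (fun z => fderiv ℝ ψ z eθ) ∧
      IsWeakPartial Ω er ψ (fun z => fderiv ℝ ψ z er) := by
  have hd := hψ.1.differentiable (by simp)
  constructor
  · refine isWeakPartial_eθ hψ.1.continuous.continuousOn
      (hψ.fderiv_apply _).1.continuous.continuousOn fun r _ θ _ => ?_
    have h1 : HasDerivAt (fun θ : ℝ => ((θ, r) : ℝ × ℝ)) (1, 0) θ :=
      (hasDerivAt_id θ).prodMk (hasDerivAt_const θ r)
    exact (hd (θ, r)).hasFDerivAt.comp_hasDerivAt θ h1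
  · refine isWeakPartial_er hψ.1.continuous.continuousOn
      (hψ.fderiv_apply _).1.continuous.continuousOn fun θ _ r _ => ?_
    have h1 : HasDerivAt (fun r : ℝ => ((θ, r) : ℝ × ℝ)) (0, 1) r :=
      (hasDerivAt_const r θ).prodMk (hasDerivAt_id r)
    exact (hd (θ, r)).hasFDerivAt.comp_hasDerivAt r h1

lemma mul_rpow_cancel {z : ℝ × ℝ} (hz : z ∈ Ω) (s : ℝ) : z.2 ^ (-s) * z.2 ^ s = 1 := by
  rw [← Real.rpow_add hz.2.1]; simp

/-- The triple `(ψ, ∂_θ ψ, r^{α/2} ∂_r ψ)`. -/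
def testTriple (α : ℝ) {ψ : ℝ × ℝ → ℝ} (hψ : IsTest Ω ψ) : PiLp 2 (fun _ : Fin 3 => L2 Ω) :=
  WithLp.toLp 2 ![hψ.memLp.toLp, (hψ.memLp_fderiv eθ).toLp, (hψ.memLp_weight_fderiv (α / 2)).toLp]

lemma testTriple_mem {ψ : ℝ × ℝ → ℝ} (hψ : IsTest Ω ψ) : testTriple α hψ ∈ H1w α := by
  obtain ⟨h1, h2⟩ := isWeakPartial_of_isTest hψ
  refine ⟨h1.congr hψ.memLp.coeFn_toLp.symm (hψ.memLp_fderiv eθ).coeFn_toLp.symm,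
    h2.congr hψ.memLp.coeFn_toLp.symm ?_⟩
  filter_upwards [(hψ.memLp_weight_fderiv (α / 2)).coeFn_toLp, ae_restrict_mem measurableSet_Ω]
    with z hz hz'
  simp only [testTriple, Fin.isValue, Matrix.cons_val]
  rw [hz, ← mul_assoc, mul_rpow_cancel hz', one_mul]

/-- A test function as an element of `H₀¹(Ω;w)`. -/
def ofTest (α : ℝ) {ψ : ℝ × ℝ → ℝ} (hψ : IsTest Ω ψ) : H01 α :=
  (⟨⟨testTriple α hψ, testTriple_mem hψ⟩, subset_closure ⟨ψ, hψ, hψ.memLp.coeFn_toLp⟩⟩ : H01sub α)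

lemma val_ofTest {ψ : ℝ × ℝ → ℝ} (hψ : IsTest Ω ψ) :
    (val (ofTest α hψ) : ℝ × ℝ → ℝ) =ᵐ[volume.restrict Ω] ψ := hψ.memLp.coeFn_toLp

lemma dθ_ofTest {ψ : ℝ × ℝ → ℝ} (hψ : IsTest Ω ψ) :
    (dθ (ofTest α hψ) : ℝ × ℝ → ℝ) =ᵐ[volume.restrict Ω] fun z => fderiv ℝ ψ z eθ :=
  (hψ.memLp_fderiv eθ).coeFn_toLp

lemma wdr_ofTest {ψ : ℝ × ℝ → ℝ} (hψ : IsTest Ω ψ) :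
    (wdr (ofTest α hψ) : ℝ × ℝ → ℝ) =ᵐ[volume.restrict Ω] fun z => z.2 ^ (α / 2) * fderiv ℝ ψ z er :=
  (hψ.memLp_weight_fderiv (α / 2)).coeFn_toLp

/-- Closed properties of `H₀¹(Ω;w)` can be checked on test functions. -/
lemma H01.induction_test {p : H01 α → Prop} (hc : IsClosed {u | p u})
    (h : ∀ (ψ : ℝ × ℝ → ℝ) (hψ : IsTest Ω ψ), p (ofTest α hψ)) (u : H01 α) : p u := by
  have hd : Dense (range fun ψ : {ψ : ℝ × ℝ → ℝ // IsTest Ω ψ} => ofTest α ψ.2) := by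
    intro u
    have hu : incl u ∈ closure (smoothPart α : Set (H1w α)) :=
      (show (u : H01sub α).1 ∈ (smoothPart α).topologicalClosure from (u : H01sub α).2)
    rw [mem_closure_iff_seq_limit] at hu ⊢
    obtain ⟨x, hx, hxu⟩ := hu
    choose ψ hψ hψx using hx
    refine ⟨fun n => ofTest α (hψ n), fun n => ⟨⟨ψ n, hψ n⟩, rfl⟩, ?_⟩
    have : ∀ n, incl (ofTest α (hψ n)) = x n := fun n => H1w.ext (by
      apply Lp.ext
      exact (hψ n).memLp.coeFn_toLp.trans (hψx n).symm)
    refine tendsto_subtype_rng.2 ?_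
    have e : x = fun n => incl (ofTest α (hψ n)) := funext fun n => (this n).symm
    rw [e] at hxu
    exact hxu
  have := hd.closure_eq
  have h2 : closure (range fun ψ : {ψ : ℝ × ℝ → ℝ // IsTest Ω ψ} => ofTest α ψ.2) ⊆ {u | p u} :=
    closure_minimal (by rintro _ ⟨ψ, rfl⟩; exact h ψ.1 ψ.2) hc
  rw [this] at h2
  exact h2 (mem_univ u)

lemma energyInner_eq (u v : H01 α) :
    energyInner u v = inner ℝ (dθ u) (dθ v) + inner ℝ (wdr u) (wdr v) := by
  have i1 : Integrable (fun z => dθ u z * dθ v z) (volume.restrict Ω) :=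
    integrable_coe_mul _ (Lp.memLp _)
  have i2 : Integrable (fun z => wdr u z * wdr v z) (volume.restrict Ω) :=
    integrable_coe_mul _ (Lp.memLp _)
  rw [energyInner, L2.inner_eq, L2.inner_eq, ← integral_add i1 i2]
  refine setIntegral_congr_fun measurableSet_Ω fun z hz => ?_
  simp only [dr]
  have : z.2 ^ α * (z.2 ^ (-(α / 2)) * z.2 ^ (-(α / 2))) = 1 := by
    rw [← Real.rpow_add hz.2.1, ← Real.rpow_add hz.2.1]
    ring_nf; simp
  linear_combination (wdr u z * wdr v z) * this

lemma H01.inner_eq (u v : H01 α) :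
    inner ℝ u v = inner ℝ (val u) (val v) + energyInner u v := by
  have : inner ℝ u v = inner ℝ (incl u).1 (incl v).1 := rfl
  rw [this, PiLp.inner_apply, Fin.sum_univ_three, energyInner_eq]
  rw [add_assoc]; rfl

lemma H01.norm_sq_eq (u : H01 α) : ‖u‖ ^ 2 = ‖val u‖ ^ 2 + energyInner u u := by
  rw [← real_inner_self_eq_norm_sq, ← real_inner_self_eq_norm_sq, H01.inner_eq]

lemma energyInner_self_nonneg (u : H01 α) : 0 ≤ energyInner u u := by
  rw [energyInner_eq, real_inner_self_eq_norm_sq, real_inner_self_eq_norm_sq]; positivity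

lemma energyNorm_nonneg (u : H01 α) : 0 ≤ energyNorm u := Real.sqrt_nonneg _

lemma energyNorm_sq (u : H01 α) : energyNorm u ^ 2 = energyInner u u :=
  Real.sq_sqrt (energyInner_self_nonneg u)

/-- The map `u ↦ (u, ·)_{H₀¹(Ω;w)}` from `H₀¹(Ω;w)` to its dual. -/
def energyDual : H01 α →L[ℝ] Hneg1 α :=
  innerSL ℝ - ((ContinuousLinearMap.compL ℝ (H01 α) (L2 Ω) ℝ).flip val).comp
    ((innerSL ℝ).comp val)

lemma energyDual_apply (u v : H01 α) : energyDual u v = energyInner u v := by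
  have : energyDual u v = inner ℝ u v - inner ℝ (val u) (val v) := rfl
  rw [this, H01.inner_eq]; ring

lemma energyInner_comm (u v : H01 α) : energyInner u v = energyInner v u := by
  rw [energyInner_eq, energyInner_eq, real_inner_comm (dθ u), real_inner_comm (wdr u)]

lemma continuous_energyInner_left (v : H01 α) : Continuous fun u : H01 α => energyInner u v := by
  simp only [← energyDual_apply]
  fun_prop

/-- The embedding `L²(Ω) → H⁻¹(Ω;w)` as a continuous linear map. -/
def toHneg1L : L2 Ω →L[ℝ] Hneg1 α :=
  ((ContinuousLinearMap.compL ℝ (H01 α) (L2 Ω) ℝ).flip val).comp (innerSL ℝ)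

lemma toHneg1L_apply (h : L2 Ω) : (toHneg1L h : Hneg1 α) = toHneg1 h := rfl

lemma toHneg1_apply (h : L2 Ω) (v : H01 α) : (toHneg1 h : Hneg1 α) v = inner ℝ h (val v) := rfl

end sobolev

/-! ### Approximation of one-dimensional modes by test functions -/

lemma IsTest.memLp_one {η : ℝ → ℝ} (h : IsTest (Ioo 0 1) η) :
    MemLp η 2 (volume.restrict (Ioo (0 : ℝ) 1)) :=
  (h.1.continuous.memLp_of_hasCompactSupport h.2.1).restrict _

lemma continuousOn_rpow_Ioo (s : ℝ) : ContinuousOn (fun r : ℝ => r ^ s) (Ioo 0 1) := fun _ hr =>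
  (Real.continuousAt_rpow_const _ _ (Or.inl (ne_of_gt hr.1))).continuousWithinAt

lemma IsTest.memLp_wgrad {η : ℝ → ℝ} (h : IsTest (Ioo 0 1) η) (β : ℝ) :
    MemLp (fun r => r ^ (β / 2) * deriv η r) 2 (volume.restrict (Ioo (0 : ℝ) 1)) :=
  ((h.isTest_deriv.continuous_mul isOpen_Ioo (continuousOn_rpow_Ioo (β / 2))).memLp_of_hasCompactSupport
    h.isTest_deriv.hasCompactSupport_mul).restrict _

/-- The weighted gradients `r^{β/2} η'` of test functions. -/
def gradTest (β : ℝ) : Submodule ℝ L2Top where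
  carrier := {x | ∃ η : ℝ → ℝ, ∃ h : IsTest (Ioo 0 1) η, x = (h.memLp_wgrad β).toLp}
  zero_mem' := by
    have h : IsTest (Ioo (0 : ℝ) 1) (fun _ => (0 : ℝ)) :=
      ⟨contDiff_const, HasCompactSupport.zero, by
        have : (fun _ : ℝ => (0 : ℝ)) = 0 := rfl
        rw [this, tsupport_zero]; exact empty_subset _⟩
    refine ⟨_, h, ?_⟩
    symm
    rw [Lp.eq_zero_iff_ae_eq_zero]
    filter_upwards [(h.memLp_wgrad β).coeFn_toLp] with r hr
    rw [hr]; simp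
  add_mem' := by
    rintro _ _ ⟨η, h, rfl⟩ ⟨ζ, h', rfl⟩
    have h2 := h.sub' h' (-1)
    refine ⟨_, h2, ?_⟩
    rw [← MemLp.toLp_add]
    refine MemLp.toLp_congr _ _ (Eventually.of_forall fun r => ?_)
    have e1 := (h.1.differentiable (by simp) r).hasDerivAt
    have e2 := (h'.1.differentiable (by simp) r).hasDerivAt
    have e3 : deriv (fun x => η x - -1 * ζ x) r = deriv η r - -1 * deriv ζ r :=
      (e1.sub (e2.const_mul (-1))).deriv
    simp only [Pi.add_apply, e3]
    ring
  smul_mem' := by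
    rintro c _ ⟨η, h, rfl⟩
    have h2 : IsTest (Ioo 0 1) (fun r => c * η r) :=
      ⟨contDiff_const.mul h.1, h.2.1.mul_left,
        (tsupport_mul_subset_right (f := fun _ => c) (g := η)).trans h.2.2⟩
    refine ⟨_, h2, ?_⟩
    rw [← MemLp.toLp_const_smul]
    refine MemLp.toLp_congr _ _ (Eventually.of_forall fun r => ?_)
    have e1 := (h.1.differentiable (by simp) r).hasDerivAt
    have e3 : deriv (fun x => c * η x) r = c * deriv η r := (e1.const_mul c).deriv
    simp only [Pi.smul_apply, smul_eq_mul, e3]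
    ring

/-- If $f$ is orthogonal to all $r^{\beta/2}\eta'$, the lemma of du Bois-Reymond makes
$r^{\beta/2}f$ constant. Hence the orthogonal complement of the gradients consists of multiples of
$r^{-\beta/2}$, and the double complement is the closure. -/
lemma mem_closure_gradTest {β : ℝ} (hβ₀ : 0 ≤ β) (hβ : β < 1) {g : L2Top}
    (hg : inner ℝ (wt β hβ) g = 0) : g ∈ (gradTest β).topologicalClosure := by
  rw [← Submodule.orthogonal_orthogonal_eq_closure, Submodule.mem_orthogonal]
  intro f hf
  rw [Submodule.mem_orthogonal] at hf
  have hi : IntegrableOn (fun r : ℝ => r ^ (β / 2) * f r) (Ioo 0 1) := by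
    have h1 : IntegrableOn (f : ℝ → ℝ) (Icc 0 1) := by
      rw [integrableOn_Icc_iff_integrableOn_Ioo]; exact (Lp.memLp f).integrable (by norm_num)
    exact (h1.continuousOn_mul ((Real.continuous_rpow_const (by linarith)).continuousOn)
      isCompact_Icc).mono_set Ioo_subset_Icc_self
  obtain ⟨k, hk⟩ := ae_eq_const_of_integral_deriv_mul_eq_zero zero_lt_one hi (by
    intro η hη
    have := hf _ ⟨η, hη, rfl⟩
    rw [L2Top.inner_eq] at this
    refine Eq.trans ?_ this
    apply integral_congr_ae
    filter_upwards [(hη.memLp_wgrad β).coeFn_toLp] with r hr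
    rw [hr]; ring)
  have hf2 : f = k • wt β hβ := by
    apply Lp.ext
    filter_upwards [hk, Lp.coeFn_smul k (wt β hβ), wt_coe hβ, ae_restrict_mem measurableSet_Ioo]
      with r h1 h2 h3 hr
    rw [h2, Pi.smul_apply, h3, smul_eq_mul, ← h1]
    have : r ^ (β / 2) * r ^ (-(β / 2)) = 1 := by rw [← Real.rpow_add hr.1]; simp
    linear_combination (-(f r)) * this
  rw [hf2, inner_smul_left, hg, mul_zero]

namespace Mode

variable {β μ : ℝ} {W F : ℝ → ℝ}

lemma continuous_flux (h : Mode β μ W F) : Continuous F :=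
  continuous_iff_continuousAt.2 fun r => (h.flux r).continuousAt

lemma intervalIntegrable_deriv (h : Mode β μ W F) (hβ : β < 1) (a b : ℝ) :
    IntervalIntegrable (fun r => r ^ (-β) * F r) volume a b :=
  (intervalIntegrable_rpow_neg hβ a b).mul_continuousOn h.continuous_flux.continuousOn

lemma integral_deriv (h : Mode β μ W F) (hβ : β < 1) {a b : ℝ} (ha : 0 ≤ a) (hab : a ≤ b)
    (hb : b ≤ 1) : ∫ r in a..b, r ^ (-β) * F r = W b - W a :=
  intervalIntegral.integral_eq_sub_of_hasDerivAt_of_le hab h.cont.continuousOn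
    (fun r hr => h.hasDerivAt r ⟨ha.trans_lt hr.1, hr.2.trans_le hb⟩)
    (h.intervalIntegrable_deriv hβ a b)

lemma memLp (h : Mode β μ W F) : MemLp W 2 (volume.restrict (Ioo (0 : ℝ) 1)) :=
  memLp_of_continuousOn h.cont.continuousOn

lemma memLp_grad (h : Mode β μ W F) (hβ : β < 1) :
    MemLp (fun r => r ^ (-(β / 2)) * F r) 2 (volume.restrict (Ioo (0 : ℝ) 1)) :=
  memLp_rpow_mul hβ h.continuous_flux.continuousOn

/-- The weighted gradient `r^{β/2} W' = r^{-β/2} F`. -/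
def grad (h : Mode β μ W F) (hβ : β < 1) : L2Top := (h.memLp_grad hβ).toLp

lemma grad_coe (h : Mode β μ W F) (hβ : β < 1) :
    (h.grad hβ : ℝ → ℝ) =ᵐ[volume.restrict (Ioo (0 : ℝ) 1)] fun r => r ^ (-(β / 2)) * F r :=
  (h.memLp_grad hβ).coeFn_toLp

lemma volt_grad (h : Mode β μ W F) (hβ : β < 1) {r : ℝ} (hr : r ∈ Icc (0 : ℝ) 1) :
    volt β (h.grad hβ) r = W r := by
  rw [volt_congr (h.grad_coe hβ) hr, volt]
  have := h.integral_deriv hβ le_rfl hr.1 hr.2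
  rw [h.zero, sub_zero] at this
  rw [← this]
  refine intervalIntegral.integral_congr_ae (Eventually.of_forall fun s hs => ?_)
  rw [uIoc_of_le hr.1] at hs
  have e : s ^ (-β) = s ^ (-(β / 2)) * s ^ (-(β / 2)) := by
    rw [← Real.rpow_add hs.1]; congr 1; ring
  rw [e]; ring

lemma voltOp_grad (h : Mode β μ W F) (hβ : β < 1) : voltOp β hβ (h.grad hβ) = h.memLp.toLp := by
  apply Lp.ext
  filter_upwards [voltOp_coe hβ (h.grad hβ), h.memLp.coeFn_toLp, ae_restrict_mem measurableSet_Ioo]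
    with r h1 h2 hr
  rw [h1, h2, h.volt_grad hβ (Ioo_subset_Icc_self hr)]

lemma inner_wt_grad (h : Mode β μ W F) (hβ : β < 1) : inner ℝ (wt β hβ) (h.grad hβ) = 0 := by
  refine Eq.trans ?_ ((h.volt_grad hβ (r := 1) (by simp)).trans h.one)
  rw [volt, ← setIntegral_Ioo_eq zero_le_one, L2Top.inner_eq]
  apply integral_congr_ae
  filter_upwards [wt_coe hβ] with r hr
  rw [hr]

/-- The derivative of the first eigenfunction times the second flux has zero integral, because the
eigenfunction vanishes at both ends. Thus the weighted gradients inherit orthogonality from the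
eigenfunctions. -/
lemma inner_grad {μ' : ℝ} {W' F' : ℝ → ℝ} (h : Mode β μ W F) (h' : Mode β μ' W' F') (hβ : β < 1) :
    inner ℝ (h.grad hβ) (h'.grad hβ) = μ' * inner ℝ (h.memLp.toLp) (h'.memLp.toLp : L2Top) := by
  have c' := h'.continuous_flux
  have i1 : IntervalIntegrable (fun r => r ^ (-β) * F r * F' r) volume 0 1 :=
    (h.intervalIntegrable_deriv hβ 0 1).mul_continuousOn c'.continuousOn
  have i2 : IntervalIntegrable (fun r => W r * W' r) volume 0 1 :=
    (h.cont.mul h'.cont).intervalIntegrable _ _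
  have e := intervalIntegral.integral_eq_sub_of_hasDerivAt_of_le (a := 0) (b := 1)
    (f := fun r => W r * F' r) (f' := fun r => r ^ (-β) * F r * F' r + W r * (-(μ' * W' r)))
    zero_le_one (h.cont.mul c').continuousOn (fun r hr => (h.hasDerivAt r hr).mul (h'.flux r))
    (i1.add ((h.cont.mul (continuous_const.mul h'.cont).neg).intervalIntegrable _ _))
  have e1 : (fun r => r ^ (-β) * F r * F' r + W r * (-(μ' * W' r)))
      = fun r => r ^ (-β) * F r * F' r - μ' * (W r * W' r) := by funext r; ring
  rw [e1, intervalIntegral.integral_sub i1 (i2.const_mul _), intervalIntegral.integral_const_mul,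
    h.one, h.zero] at e
  have e2 : inner ℝ (h.grad hβ) (h'.grad hβ) = ∫ r in (0 : ℝ)..1, r ^ (-β) * F r * F' r := by
    rw [L2Top.inner_eq, ← setIntegral_Ioo_eq zero_le_one]
    apply integral_congr_ae
    filter_upwards [h.grad_coe hβ, h'.grad_coe hβ, ae_restrict_mem measurableSet_Ioo] with r h1 h2 hr
    have e : r ^ (-β) = r ^ (-(β / 2)) * r ^ (-(β / 2)) := by
      rw [← Real.rpow_add hr.1]; congr 1; ring
    rw [h1, h2, e]; ring
  have e3 : inner ℝ (h.memLp.toLp) (h'.memLp.toLp : L2Top) = ∫ r in (0 : ℝ)..1, W r * W' r := by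
    rw [L2Top.inner_eq, ← setIntegral_Ioo_eq zero_le_one]
    apply integral_congr_ae
    filter_upwards [h.memLp.coeFn_toLp, h'.memLp.coeFn_toLp] with r h1 h2
    rw [h1, h2]
  rw [e2, e3]
  linarith

/-- The condition $W(1)=0$ is the orthogonality that lets the gradients be approximated. Convergence
of the functions then comes for free, since the bounded operator `voltOp` recovers them from their
weighted gradients. -/
lemma exists_test_approx (h : Mode β μ W F) (hβ₀ : 0 ≤ β) (hβ : β < 1) :
    ∃ (η : ℕ → ℝ → ℝ) (hη : ∀ n, IsTest (Ioo 0 1) (η n)),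
      Tendsto (fun n => ((hη n).memLp_one.toLp : L2Top)) atTop (𝓝 h.memLp.toLp) ∧
      Tendsto (fun n => (((hη n).memLp_wgrad β).toLp : L2Top)) atTop (𝓝 (h.grad hβ)) := by
  have h1 : h.grad hβ ∈ closure (gradTest β : Set L2Top) :=
    mem_closure_gradTest hβ₀ hβ (h.inner_wt_grad hβ)
  obtain ⟨x, hx, hxl⟩ := mem_closure_iff_seq_limit.1 h1
  choose η hη hxη using hx
  have hx' : x = fun n => (((hη n).memLp_wgrad β).toLp : L2Top) := funext hxη
  rw [hx'] at hxl
  refine ⟨η, hη, ?_, hxl⟩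
  have h2 := ((voltOp β hβ).continuous.tendsto _).comp hxl
  rw [h.voltOp_grad hβ] at h2
  refine h2.congr fun n => ?_
  apply Lp.ext
  simp only [Function.comp_apply]
  filter_upwards [voltOp_coe hβ (((hη n).memLp_wgrad β).toLp), (hη n).memLp_one.coeFn_toLp,
    ae_restrict_mem measurableSet_Ioo] with r h1 h2 hr
  rw [h1, h2, volt_congr ((hη n).memLp_wgrad β).coeFn_toLp (Ioo_subset_Icc_self hr), volt]
  have e : ∫ s in (0 : ℝ)..r, s ^ (-(β / 2)) * (s ^ (β / 2) * deriv (η n) s)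
      = ∫ s in (0 : ℝ)..r, deriv (η n) s := by
    refine intervalIntegral.integral_congr_ae (Eventually.of_forall fun s hs => ?_)
    rw [uIoc_of_le hr.1.le] at hs
    rw [← mul_assoc, ← Real.rpow_add hs.1]; simp
  rw [e, intervalIntegral.integral_deriv_eq_sub (fun s _ => (hη n).1.differentiable (by simp) s)
    (((hη n).1.continuous_deriv (by simp)).intervalIntegrable _ _),
    (hη n).eq_zero (x := 0) (by simp), sub_zero]

end Mode

/-! ### The spectral decomposition of the degenerate operator on the square -/

/-- Spectral data: orthonormal bases of `L²(0,1)` of eigenfunctions in the variables `θ` and `r`. -/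
structure Spec (α : ℝ) where
  α_pos : 0 < α
  α_lt : α < 1
  ι : Type
  κ : Type
  countable_ι : Countable ι
  countable_κ : Countable κ
  b : HilbertBasis ι ℝ L2Top
  c : HilbertBasis κ ℝ L2Top
  ν : ι → ℝ
  μ : κ → ℝ
  V : ι → ℝ → ℝ
  G : ι → ℝ → ℝ
  W : κ → ℝ → ℝ
  F : κ → ℝ → ℝ
  m : ℝ
  m_pos : 0 < m
  m_le : ∀ j, m ≤ μ j
  modeθ : ∀ i, Mode 0 (ν i) (V i) (G i)
  moder : ∀ j, Mode α (μ j) (W j) (F j)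
  b_coe : ∀ i, (b i : ℝ → ℝ) =ᵐ[volume.restrict (Ioo (0 : ℝ) 1)] V i
  c_coe : ∀ j, (c j : ℝ → ℝ) =ᵐ[volume.restrict (Ioo (0 : ℝ) 1)] W j

attribute [instance] Spec.countable_ι Spec.countable_κ

lemma nonempty_spec {α : ℝ} (h₀ : 0 < α) (h₁ : α < 1) : Nonempty (Spec α) := by
  obtain ⟨ι, b, ν, V, G, m, hι, hm, h⟩ := exists_modes (β := 0) (by norm_num)
  obtain ⟨κ, c, μ, W, F, m', hκ, hm', h'⟩ := exists_modes h₁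
  exact ⟨⟨h₀, h₁, ι, κ, hι, hκ, b, c, ν, μ, V, G, W, F, m', hm', fun j => (h' j).1,
    fun i => (h i).2.1, fun j => (h' j).2.1, fun i => (h i).2.2, fun j => (h' j).2.2⟩⟩

namespace Spec

variable {α : ℝ} (D : Spec α)

lemma b_eq (i : D.ι) : D.b i = (D.modeθ i).memLp.toLp :=
  Lp.ext ((D.b_coe i).trans (D.modeθ i).memLp.coeFn_toLp.symm)

lemma c_eq (j : D.κ) : D.c j = (D.moder j).memLp.toLp :=
  Lp.ext ((D.c_coe j).trans (D.moder j).memLp.coeFn_toLp.symm)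

/-- `V_i'` in `L²(0,1)`. -/
def bd (i : D.ι) : L2Top := (D.modeθ i).grad (by norm_num)

/-- `r^{α/2} W_j'` in `L²(0,1)`. -/
def cd (j : D.κ) : L2Top := (D.moder j).grad D.α_lt

lemma bd_coe (i : D.ι) : (D.bd i : ℝ → ℝ) =ᵐ[volume.restrict (Ioo (0 : ℝ) 1)] D.G i := by
  filter_upwards [(D.modeθ i).grad_coe (by norm_num)] with r hr
  rw [bd, hr]; simp

lemma cd_coe (j : D.κ) : (D.cd j : ℝ → ℝ) =ᵐ[volume.restrict (Ioo (0 : ℝ) 1)]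
    fun r => r ^ (-(α / 2)) * D.F j r := (D.moder j).grad_coe D.α_lt

lemma inner_b [DecidableEq D.ι] (i i' : D.ι) :
    inner ℝ (D.b i) (D.b i') = if i = i' then (1 : ℝ) else 0 :=
  orthonormal_iff_ite.1 D.b.orthonormal i i'

lemma inner_c [DecidableEq D.κ] (j j' : D.κ) :
    inner ℝ (D.c j) (D.c j') = if j = j' then (1 : ℝ) else 0 :=
  orthonormal_iff_ite.1 D.c.orthonormal j j'

lemma inner_bd [DecidableEq D.ι] (i i' : D.ι) :
    inner ℝ (D.bd i) (D.bd i') = if i = i' then D.ν i else 0 := by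
  rw [bd, bd, Mode.inner_grad, ← b_eq, ← b_eq, inner_b]
  split_ifs with h <;> simp [h]

lemma inner_cd [DecidableEq D.κ] (j j' : D.κ) :
    inner ℝ (D.cd j) (D.cd j') = if j = j' then D.μ j else 0 := by
  rw [cd, cd, Mode.inner_grad, ← c_eq, ← c_eq, inner_c]
  split_ifs with h <;> simp [h]

lemma ν_pos (i : D.ι) : 0 < D.ν i := (D.modeθ i).pos
lemma μ_pos (j : D.κ) : 0 < D.μ j := (D.moder j).pos

/-- The eigenvalues of the operator `𝒜`. -/
def lam (a : D.ι × D.κ) : ℝ := D.ν a.1 + D.μ a.2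

lemma lam_pos (a : D.ι × D.κ) : 0 < D.lam a := add_pos (D.ν_pos _) (D.μ_pos _)

lemma m_le_lam (a : D.ι × D.κ) : D.m ≤ D.lam a :=
  (D.m_le a.2).trans (le_add_of_nonneg_left (D.ν_pos _).le)

lemma orthonormal_tens : Orthonormal ℝ fun a : D.ι × D.κ => tens (D.b a.1) (D.c a.2) := by
  classical
  rw [orthonormal_iff_ite]
  rintro ⟨i, j⟩ ⟨i', j'⟩
  rw [inner_tens, inner_b, inner_c]
  simp only [Prod.mk.injEq]
  split_ifs <;> simp_all

/-- The orthonormal basis of eigenfunctions of `𝒜` in `L²(Ω)`. -/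
def basis : HilbertBasis (D.ι × D.κ) ℝ (L2 Ω) :=
  HilbertBasis.mkOfOrthogonalEqBot D.orthonormal_tens (by
    rw [eq_bot_iff]
    intro u hu
    rw [Submodule.mem_orthogonal] at hu
    exact eq_zero_of_inner_tens D.b D.c fun i j => hu _ (Submodule.subset_span ⟨(i, j), rfl⟩))

lemma basis_apply (a : D.ι × D.κ) : D.basis a = tens (D.b a.1) (D.c a.2) := by
  rw [basis, HilbertBasis.coe_mkOfOrthogonalEqBot]

/-- The triple `(e, ∂_θ e, r^{α/2} ∂_r e)` of an eigenfunction. -/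
def triple (a : D.ι × D.κ) : PiLp 2 (fun _ : Fin 3 => L2 Ω) :=
  WithLp.toLp 2 ![tens (D.b a.1) (D.c a.2), tens (D.bd a.1) (D.c a.2), tens (D.b a.1) (D.cd a.2)]

lemma isTest_prod {η ζ : ℝ → ℝ} (hη : IsTest (Ioo 0 1) η) (hζ : IsTest (Ioo 0 1) ζ) :
    IsTest Ω (fun z => η z.1 * ζ z.2) := by
  have hs : Function.support (fun z : ℝ × ℝ => η z.1 * ζ z.2) ⊆ tsupport η ×ˢ tsupport ζ := by
    intro z hz
    have := mul_ne_zero_iff.1 hz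
    exact ⟨subset_tsupport _ this.1, subset_tsupport _ this.2⟩
  refine ⟨(hη.1.comp contDiff_fst).mul (hζ.1.comp contDiff_snd),
    HasCompactSupport.of_support_subset_isCompact (hη.2.1.isCompact.prod hζ.2.1.isCompact) hs, ?_⟩
  exact (closure_minimal hs ((isClosed_tsupport η).prod (isClosed_tsupport ζ))).trans
    (prod_mono hη.2.2 hζ.2.2)

lemma testTriple_prod {η ζ : ℝ → ℝ} (hη : IsTest (Ioo 0 1) η) (hζ : IsTest (Ioo 0 1) ζ) :
    testTriple α (isTest_prod hη hζ) = WithLp.toLp 2 ![tens hη.memLp_one.toLp hζ.memLp_one.toLp,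
      tens (hη.memLp_wgrad 0).toLp hζ.memLp_one.toLp,
      tens hη.memLp_one.toLp (hζ.memLp_wgrad α).toLp] := by
  have hp := isTest_prod hη hζ
  ext i : 1
  fin_cases i
  · exact Lp.ext (hp.memLp.coeFn_toLp.trans
      (tens_coe' hη.memLp_one.coeFn_toLp hζ.memLp_one.coeFn_toLp).symm)
  · refine Lp.ext ((hp.memLp_fderiv eθ).coeFn_toLp.trans (Filter.EventuallyEq.trans ?_
      (tens_coe' (hη.memLp_wgrad 0).coeFn_toLp hζ.memLp_one.coeFn_toLp).symm))
    refine Eventually.of_forall fun z => ?_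
    have h := (hp.slice_fst z.2).2 z.1
    simp only [Prod.mk.eta] at h
    simp only [← h]
    rw [deriv_mul_const (hη.1.differentiable (by simp) _)]
    simp
  · refine Lp.ext ((hp.memLp_weight_fderiv (α / 2)).coeFn_toLp.trans (Filter.EventuallyEq.trans ?_
      (tens_coe' hη.memLp_one.coeFn_toLp (hζ.memLp_wgrad α).coeFn_toLp).symm))
    refine Eventually.of_forall fun z => ?_
    have h := (hp.slice_snd z.1).2 z.2
    simp only [Prod.mk.eta] at h
    simp only [← h]
    rw [deriv_const_mul _ (hζ.1.differentiable (by simp) _)]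
    ring

/-- Products of one-dimensional approximants are test functions on the square, and their triples
converge to `D.triple a`. The limit is therefore in the closed space `H1w α` and in the closure of
the smooth functions. -/
lemma exists_eigenvector (a : D.ι × D.κ) : ∃ u : H01 α, (incl u).1 = D.triple a := by
  obtain ⟨η, hη, h1, h2⟩ := (D.modeθ a.1).exists_test_approx le_rfl (by norm_num)
  obtain ⟨ζ, hζ, h3, h4⟩ := (D.moder a.2).exists_test_approx D.α_pos.le D.α_lt
  rw [← b_eq] at h1
  rw [← c_eq] at h3
  have hlim : Tendsto (fun n => testTriple α (isTest_prod (hη n) (hζ n))) atTop (𝓝 (D.triple a)) := by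
    have e : (fun n => testTriple α (isTest_prod (hη n) (hζ n))) = _ :=
      funext fun n => testTriple_prod (hη n) (hζ n)
    rw [e]
    refine ((PiLp.continuous_toLp 2 _).tendsto _).comp ?_
    rw [tendsto_pi_nhds]
    intro i
    fin_cases i
    · exact tendsto_tens h1 h3
    · exact tendsto_tens h2 h3
    · exact tendsto_tens h1 h4
  have hmem : D.triple a ∈ H1w α :=
    isClosed_H1w.mem_of_tendsto hlim (Eventually.of_forall fun n => testTriple_mem _)
  have hcl : (⟨D.triple a, hmem⟩ : H1w α) ∈ closure (smoothPart α : Set (H1w α)) := by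
    refine mem_closure_of_tendsto (b := atTop)
      (f := fun n => (⟨_, testTriple_mem (isTest_prod (hη n) (hζ n))⟩ : H1w α))
      (tendsto_subtype_rng.2 hlim) (Eventually.of_forall fun n => ?_)
    exact ⟨_, isTest_prod (hη n) (hζ n), (isTest_prod (hη n) (hζ n)).memLp.coeFn_toLp⟩
  exact ⟨(⟨⟨D.triple a, hmem⟩, hcl⟩ : H01sub α), rfl⟩

/-- The eigenfunctions of `𝒜` as elements of `H₀¹(Ω;w)`. -/
def e (a : D.ι × D.κ) : H01 α := (D.exists_eigenvector a).choose

lemma incl_e (a : D.ι × D.κ) : (incl (D.e a)).1 = D.triple a := (D.exists_eigenvector a).choose_spec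

lemma val_e (a : D.ι × D.κ) : val (D.e a) = D.basis a := by
  rw [val_apply, incl_e, basis_apply]; rfl

lemma dθ_e (a : D.ι × D.κ) : dθ (D.e a) = tens (D.bd a.1) (D.c a.2) := by
  rw [dθ, incl_e]; rfl

lemma wdr_e (a : D.ι × D.κ) : wdr (D.e a) = tens (D.b a.1) (D.cd a.2) := by
  rw [wdr, incl_e]; rfl

lemma V_cont (i : D.ι) : Continuous (D.V i) := (D.modeθ i).cont
lemma W_cont (j : D.κ) : Continuous (D.W j) := (D.moder j).cont
lemma G_cont (i : D.ι) : Continuous (D.G i) := (D.modeθ i).continuous_flux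
lemma F_cont (j : D.κ) : Continuous (D.F j) := (D.moder j).continuous_flux

lemma isWeakPartial_dθ_e (a : D.ι × D.κ) : IsWeakPartial Ω eθ (fun z => D.G a.1 z.1 * D.W a.2 z.2)
    (fun z => -D.ν a.1 * (D.V a.1 z.1 * D.W a.2 z.2)) := by
  have := D.V_cont a.1
  have := D.G_cont a.1
  have := D.W_cont a.2
  refine isWeakPartial_eθ (by fun_prop) (by fun_prop) fun r _ θ _ => ?_
  convert! ((D.modeθ a.1).flux θ).mul_const (D.W a.2 r) using 1
  ring

lemma isWeakPartial_flux_e (a : D.ι × D.κ) :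
    IsWeakPartial Ω er (fun z => D.V a.1 z.1 * D.F a.2 z.2)
    (fun z => -D.μ a.2 * (D.V a.1 z.1 * D.W a.2 z.2)) := by
  have := D.V_cont a.1
  have := D.F_cont a.2
  have := D.W_cont a.2
  refine isWeakPartial_er (by fun_prop) (by fun_prop) fun θ _ r _ => ?_
  convert! ((D.moder a.2).flux r).const_mul (D.V a.1 θ) using 1
  ring

lemma basis_coe (a : D.ι × D.κ) : (D.basis a : ℝ × ℝ → ℝ) =ᵐ[volume.restrict Ω]
    fun z => D.V a.1 z.1 * D.W a.2 z.2 := by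
  rw [basis_apply]; exact tens_coe' (D.b_coe _) (D.c_coe _)

lemma dθ_e_coe (a : D.ι × D.κ) : (dθ (D.e a) : ℝ × ℝ → ℝ) =ᵐ[volume.restrict Ω]
    fun z => D.G a.1 z.1 * D.W a.2 z.2 := by
  rw [dθ_e]; exact tens_coe' (D.bd_coe _) (D.c_coe _)

lemma wdr_e_coe (a : D.ι × D.κ) : (wdr (D.e a) : ℝ × ℝ → ℝ) =ᵐ[volume.restrict Ω]
    fun z => D.V a.1 z.1 * (z.2 ^ (-(α / 2)) * D.F a.2 z.2) := by
  rw [wdr_e]; exact tens_coe' (D.b_coe _) (D.cd_coe _)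

/-- The eigenfunctions satisfy the weak eigenvalue equation. -/
lemma energyInner_e (u : H01 α) (a : D.ι × D.κ) :
    energyInner u (D.e a) = D.lam a * inner ℝ (D.basis a) (val u) := by
  -- Both sides are continuous in $u$, so $u$ may be a test function; the derivatives are then moved
  -- to the eigenfunction, whose fluxes are differentiable in the classical sense.
  refine H01.induction_test (p := fun u => energyInner u (D.e a)
    = D.lam a * inner ℝ (D.basis a) (val u)) ?_ ?_ u
  · exact isClosed_eq (continuous_energyInner_left _) (by fun_prop)
  · intro ψ hψ
    rw [energyInner_eq, L2.inner_eq, L2.inner_eq, L2.inner_eq, lam, add_mul]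
    have e0 : ∫ z in Ω, D.basis a z * val (ofTest α hψ) z
        = ∫ z in Ω, D.V a.1 z.1 * D.W a.2 z.2 * ψ z := by
      apply integral_congr_ae
      filter_upwards [D.basis_coe a, val_ofTest hψ] with z h1 h2
      rw [h1, h2]
    rw [e0]
    congr 1
    · have h := D.isWeakPartial_dθ_e a ψ hψ
      simp only [neg_mul, integral_neg, neg_neg, mul_assoc] at h ⊢
      rw [← integral_const_mul, ← h]
      apply integral_congr_ae
      filter_upwards [D.dθ_e_coe a, dθ_ofTest hψ] with z h1 h2
      rw [h1, h2]; ring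
    · have h := D.isWeakPartial_flux_e a ψ hψ
      simp only [neg_mul, integral_neg, neg_neg, mul_assoc] at h ⊢
      rw [← integral_const_mul, ← h]
      apply integral_congr_ae
      filter_upwards [D.wdr_e_coe a, wdr_ofTest hψ, ae_restrict_mem measurableSet_Ω] with z h1 h2 hz
      rw [h1, h2]
      linear_combination (D.V a.1 z.1 * D.F a.2 z.2 * fderiv ℝ ψ z er) * mul_rpow_cancel hz (α / 2)

/-! ### Coefficients in the eigenbasis: Parseval identities in $L^2(\Omega)$ and $H^1_0(\Omega;w)$.
-/

/-- The coefficients of a function in the eigenbasis. -/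
def co (h : L2 Ω) (a : D.ι × D.κ) : ℝ := inner ℝ (D.basis a) h

lemma hasSum_co_mul (h k : L2 Ω) : HasSum (fun a => D.co h a * D.co k a) (inner ℝ h k) := by
  convert! D.basis.hasSum_inner_mul_inner h k using 2 with a
  rw [co, co, real_inner_comm]

lemma hasSum_co_sq (h : L2 Ω) : HasSum (fun a => D.co h a ^ 2) (‖h‖ ^ 2) := by
  have := D.hasSum_co_mul h h
  rw [real_inner_self_eq_norm_sq] at this
  simpa only [sq] using this

lemma co_val_e [DecidableEq (D.ι × D.κ)] (a a' : D.ι × D.κ) :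
    D.co (val (D.e a')) a = if a = a' then 1 else 0 := by
  rw [co, val_e]
  exact orthonormal_iff_ite.1 D.basis.orthonormal a a'

/-- The $L^2$ part contributes $1$ and the energy part $\lambda_a$: both are diagonal in the same
basis. -/
lemma inner_e (u : H01 α) (a : D.ι × D.κ) :
    inner ℝ u (D.e a) = (1 + D.lam a) * D.co (val u) a := by
  rw [H01.inner_eq, energyInner_e, val_e, co, real_inner_comm]
  ring

lemma inner_e_e [DecidableEq (D.ι × D.κ)] (a a' : D.ι × D.κ) :
    inner ℝ (D.e a) (D.e a') = if a = a' then 1 + D.lam a else 0 := by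
  rw [inner_e, co_val_e]
  split_ifs with h1 h2 h2
  · rw [h1, mul_one]
  · exact absurd h1.symm h2
  · exact absurd h2.symm h1
  · simp

/-- The normalized eigenfunctions in `H₀¹(Ω;w)`. -/
def en (a : D.ι × D.κ) : H01 α := (Real.sqrt (1 + D.lam a))⁻¹ • D.e a

lemma one_add_lam_pos (a : D.ι × D.κ) : 0 < 1 + D.lam a := by linarith [D.lam_pos a]

lemma inner_en (u : H01 α) (a : D.ι × D.κ) :
    inner ℝ u (D.en a) = Real.sqrt (1 + D.lam a) * D.co (val u) a := by
  have h := D.one_add_lam_pos a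
  have h2 := Real.mul_self_sqrt h.le
  have h3 := (Real.sqrt_pos.2 h).ne'
  rw [en, inner_smul_right, inner_e]
  field_simp
  rw [Real.sq_sqrt h.le]

lemma eq_zero_of_co {h : L2 Ω} (hh : ∀ a, D.co h a = 0) : h = 0 := by
  apply D.basis.repr.injective
  ext a
  rw [D.basis.repr_apply_apply, map_zero]
  exact hh a

lemma ext_co {h k : L2 Ω} (hh : ∀ a, D.co h a = D.co k a) : h = k := by
  rw [← sub_eq_zero]
  refine D.eq_zero_of_co fun a => ?_
  have := hh a
  simp only [co, inner_sub_right] at this ⊢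
  linarith

lemma orthonormal_en : Orthonormal ℝ D.en := by
  classical
  rw [orthonormal_iff_ite]
  intro a a'
  have h := D.one_add_lam_pos a
  have h2 := Real.mul_self_sqrt h.le
  have h3 := (Real.sqrt_pos.2 h).ne'
  rw [inner_en, en, map_smul]
  have : D.co ((Real.sqrt (1 + D.lam a))⁻¹ • val (D.e a)) a'
      = (Real.sqrt (1 + D.lam a))⁻¹ * D.co (val (D.e a)) a' := by
    simp [co, inner_smul_right]
  rw [this, co_val_e]
  split_ifs with h1 h2 h2
  · rw [h1, mul_one, mul_inv_cancel₀ h3]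
  · exact absurd h1.symm h2
  · exact absurd h2.symm h1
  · simp

/-- The normalized eigenfunctions form an orthonormal basis of `H₀¹(Ω;w)`. -/
def hbasis : HilbertBasis (D.ι × D.κ) ℝ (H01 α) :=
  HilbertBasis.mkOfOrthogonalEqBot D.orthonormal_en (by
    rw [eq_bot_iff]
    intro u hu
    rw [Submodule.mem_orthogonal'] at hu
    -- Orthogonality to an eigenfunction in $H^1_0(\Omega;w)$ is, up to a positive factor,
    -- orthogonality in $L^2(\Omega)$, so completeness is inherited from there.
    refine val_injective ?_
    rw [map_zero]
    refine D.eq_zero_of_co fun a => ?_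
    have := hu _ (Submodule.subset_span ⟨a, rfl⟩)
    rw [inner_en, mul_eq_zero] at this
    exact this.resolve_left (Real.sqrt_pos.2 (D.one_add_lam_pos a)).ne')

lemma hbasis_apply (a : D.ι × D.κ) : D.hbasis a = D.en a := by
  rw [hbasis, HilbertBasis.coe_mkOfOrthogonalEqBot]

/-- Parseval in $H^1_0(\Omega;w)$ minus Parseval in $L^2(\Omega)$; the factor is $(1+\lambda_a)-1$.
-/
lemma hasSum_energyInner (u v : H01 α) :
    HasSum (fun a => D.lam a * (D.co (val u) a * D.co (val v) a)) (energyInner u v) := by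
  have h1 := D.hbasis.hasSum_inner_mul_inner u v
  have h2 := D.hasSum_co_mul (val u) (val v)
  have h3 := h1.sub h2
  have e1 : inner ℝ u v - inner ℝ (val u) (val v) = energyInner u v := by
    rw [H01.inner_eq]; ring
  rw [e1] at h3
  convert! h3 using 2 with a
  rw [hbasis_apply, inner_en, real_inner_comm, inner_en]
  have h2 := Real.mul_self_sqrt (D.one_add_lam_pos a).le
  linear_combination (-(D.co (val u) a * D.co (val v) a)) * h2

lemma hasSum_energy (u : H01 α) :
    HasSum (fun a => D.lam a * D.co (val u) a ^ 2) (energyNorm u ^ 2) := by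
  rw [energyNorm_sq]
  simpa only [sq] using D.hasSum_energyInner u u

/-- Functionals on `H₀¹(Ω;w)` are determined by their values on the eigenfunctions. -/
lemma dual_ext {ℓ ℓ' : Hneg1 α} (h : ∀ a, ℓ (D.e a) = ℓ' (D.e a)) : ℓ = ℓ' := by
  refine ContinuousLinearMap.ext_on (s := range D.hbasis) ?_ ?_
  · have := D.hbasis.dense_span
    rw [← Submodule.dense_iff_topologicalClosure_eq_top] at this
    exact this
  · rintro _ ⟨a, rfl⟩
    rw [hbasis_apply, en, map_smul, map_smul, h]

/-- The two series are compared term by term, using the lower bound of the radial eigenvalues. -/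
lemma poincare (u : H01 α) : D.m * ‖val u‖ ^ 2 ≤ energyNorm u ^ 2 := by
  refine hasSum_le (fun a => ?_) ((D.hasSum_co_sq (val u)).mul_left D.m) (D.hasSum_energy u)
  exact mul_le_mul_of_nonneg_right (D.m_le_lam a) (sq_nonneg _)

lemma norm_sq_sum_smul_e (S : Finset (D.ι × D.κ)) (x : D.ι × D.κ → ℝ) :
    ‖∑ a ∈ S, x a • D.e a‖ ^ 2 = ∑ a ∈ S, (1 + D.lam a) * x a ^ 2 := by
  classical
  rw [← real_inner_self_eq_norm_sq, sum_inner]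
  refine Finset.sum_congr rfl fun a ha => ?_
  rw [inner_sum, Finset.sum_eq_single_of_mem a ha]
  · rw [inner_smul_left, inner_smul_right, inner_e_e]; simp; ring
  · intro a' _ h
    rw [inner_smul_left, inner_smul_right, inner_e_e, if_neg (Ne.symm h)]; simp

lemma norm_sq_sum_smul_basis (S : Finset (D.ι × D.κ)) (x : D.ι × D.κ → ℝ) :
    ‖∑ a ∈ S, x a • D.basis a‖ ^ 2 = ∑ a ∈ S, x a ^ 2 := by
  rw [← real_inner_self_eq_norm_sq, D.basis.orthonormal.inner_sum]
  simp [sq]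

end Spec

/-! ### The scalar oscillator -/

/-- `C'' + λ C = f` on `(0,T)`, with `D = C'`. -/
structure Osc (T lam : ℝ) (f C D : ℝ → ℝ) : Prop where
  fst : IsPrim T C D
  snd : IsPrim T D (fun t => f t - lam * C t)

lemma Osc.congr {T lam : ℝ} {f f' C D : ℝ → ℝ} (h : Osc T lam f C D) (hT : 0 ≤ T)
    (hf : f =ᵐ[volume.restrict (Ioo 0 T)] f') : Osc T lam f' C D := by
  refine ⟨h.fst, h.snd.congr ?_ hT⟩
  filter_upwards [hf] with t ht
  rw [ht]

lemma integrableOn_sq_of_continuousOn {T : ℝ} {u : ℝ → ℝ} (hu : ContinuousOn u (Icc 0 T)) :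
    IntegrableOn (fun t => u t ^ 2) (Ioo 0 T) :=
  (hu.pow 2).integrableOn_Icc.mono_set Ioo_subset_Icc_self

/-- The energy estimate. -/
lemma Osc.energy_le {T lam : ℝ} (hT : 0 < T) (hlam : 0 ≤ lam) {f C D : ℝ → ℝ}
    (h : Osc T lam f C D) (hf : MemLp f 2 (volume.restrict (Ioo 0 T))) {t : ℝ}
    (ht : t ∈ Icc 0 T) :
    D t ^ 2 + lam * C t ^ 2 ≤
      (2 + 4 * T) * (D 0 ^ 2 + lam * C 0 ^ 2 + ∫ s in Ioo 0 T, f s ^ 2) := by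
  set E : ℝ → ℝ := fun t => D t ^ 2 + lam * C t ^ 2 with hE
  have cC := h.fst.continuousOn hT.le
  have cD := h.snd.continuousOn hT.le
  have cE : ContinuousOn E (Icc 0 T) := (cD.pow 2).add ((cC.pow 2).const_mul lam)
  -- It suffices to bound the energy at its maximum: there the contribution of $D$ to the work of
  -- the force can be absorbed, with no need of Gronwall's inequality.
  obtain ⟨t₁, ht₁, hmax⟩ := isCompact_Icc.exists_isMaxOn ⟨0, by simp [hT.le]⟩ cE
  have hmax' : ∀ s ∈ Icc 0 T, E s ≤ E t₁ := fun s hs => hmax hs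
  have hp := (h.snd.mul hT.le h.snd).add ((h.fst.mul hT.le h.fst).const_mul lam)
  have e := hp.eq t₁ ht₁
  have i1 : IntegrableOn (fun s => f s ^ 2) (Ioo 0 T) := hf.integrable_sq
  have i2 : IntegrableOn (fun s => D s ^ 2) (Ioo 0 T) := integrableOn_sq_of_continuousOn cD
  have hfn : 0 ≤ ∫ s in Ioo 0 T, f s ^ 2 := integral_nonneg fun _ => sq_nonneg _
  have key : ∫ s in (0 : ℝ)..t₁, ((f s - lam * C s) * D s + D s * (f s - lam * C s)
      + lam * (D s * C s + C s * D s)) ≤ E t₁ / 2 + 2 * T * ∫ s in Ioo 0 T, f s ^ 2 := by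
    rw [intervalIntegral.integral_of_le ht₁.1, integral_Ioc_eq_integral_Ioo]
    have hi : IntegrableOn (fun s => (f s - lam * C s) * D s + D s * (f s - lam * C s)
      + lam * (D s * C s + C s * D s)) (Ioo 0 T) := by
      have := hp.integrable
      rwa [intervalIntegrable_iff_integrableOn_Ioo_of_le hT.le] at this
    have hsub : Ioo 0 t₁ ⊆ Ioo 0 T := Ioo_subset_Ioo_right ht₁.2
    have ic : IntegrableOn (fun _ : ℝ => E t₁ / (2 * T)) (Ioo 0 T) := integrableOn_const (by simp)
    calc ∫ s in Ioo 0 t₁, ((f s - lam * C s) * D s + D s * (f s - lam * C s)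
          + lam * (D s * C s + C s * D s))
        ≤ ∫ s in Ioo 0 t₁, (E t₁ / (2 * T) + 2 * T * f s ^ 2) := by
          refine setIntegral_mono_on (hi.mono_set hsub) ((ic.add (i1.const_mul _)).mono_set hsub)
            measurableSet_Ioo fun s hs => ?_
          have hs' : s ∈ Icc 0 T := Ioo_subset_Icc_self (hsub hs)
          have h1 : D s ^ 2 ≤ E t₁ := by
            refine le_trans ?_ (hmax' s hs')
            simp only [hE]
            have : 0 ≤ lam * C s ^ 2 := by positivity
            linarith
          have h2 : D s ^ 2 / (2 * T) ≤ E t₁ / (2 * T) := by gcongr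
          -- In the derivative of the energy the λ-terms cancel and $2fD$ remains. Young's
          -- inequality is weighted by $2T$ so that the integral over $(0,T)$ of the first term is
          -- at most half the maximal energy.
          have h3 : 2 * (f s * D s) ≤ D s ^ 2 / (2 * T) + 2 * T * f s ^ 2 := by
            have : 0 ≤ (D s - 2 * T * f s) ^ 2 / (2 * T) := by positivity
            have e : (D s - 2 * T * f s) ^ 2 / (2 * T)
              = D s ^ 2 / (2 * T) + 2 * T * f s ^ 2 - 2 * (f s * D s) := by
              field_simp; ring
            linarith
          linarith
      _ ≤ ∫ s in Ioo 0 T, (E t₁ / (2 * T) + 2 * T * f s ^ 2) := by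
          refine setIntegral_mono_set (ic.add (i1.const_mul _)) ?_ hsub.eventuallyLE
          refine Eventually.of_forall fun s => ?_
          have : 0 ≤ E t₁ := by simp only [hE]; positivity
          simp only [Pi.zero_apply]
          positivity
      _ = E t₁ / 2 + 2 * T * ∫ s in Ioo 0 T, f s ^ 2 := by
          rw [integral_add ic (i1.const_mul _), integral_const_mul]
          simp only [integral_const, MeasurableSet.univ, measureReal_restrict_apply, univ_inter,
            Real.volume_real_Ioo, sub_zero, max_eq_left hT.le, smul_eq_mul]
          field_simp
  -- Absorbing $E(t_1)/2$ doubles the rest: $E(t_1)\le 2E(0)+4T\int f^2$, whence the constant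
  -- $2+4T$, free of λ.
  have e0 : E t₁ ≤ E 0 + (E t₁ / 2 + 2 * T * ∫ s in Ioo 0 T, f s ^ 2) := by
    simp only [hE] at key ⊢
    nlinarith [e]
  have h0 : 0 ≤ E 0 := by simp only [hE]; positivity
  have := hmax' t ht
  simp only [hE] at *
  nlinarith [mul_nonneg hT.le h0, mul_nonneg hT.le hfn]

/-- Variation of constants: $C=A\cos\omega t+B\sin\omega t$ with $A'=-\omega^{-1}f\sin\omega t$,
$B'=\omega^{-1}f\cos\omega t$ and $\omega=\sqrt\lambda$. -/
lemma Osc.exists {T lam : ℝ} (hlam : 0 < lam) {f : ℝ → ℝ} (hf : IntervalIntegrable f volume 0 T)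
    (hT : 0 ≤ T) (c₀ d₀ : ℝ) : ∃ C D : ℝ → ℝ, Osc T lam f C D ∧ C 0 = c₀ ∧ D 0 = d₀ := by
  set om := Real.sqrt lam
  have hom : om ≠ 0 := (Real.sqrt_pos.2 hlam).ne'
  have hom2 : om * om = lam := Real.mul_self_sqrt hlam.le
  have hs : IsPrim T (fun t => Real.sin (om * t)) (fun t => om * Real.cos (om * t)) :=
    isPrim_of_hasDerivAt (fun t => by
      convert! ((hasDerivAt_id t).const_mul om).sin using 1
      simp; ring) (by fun_prop)
  have hc : IsPrim T (fun t => Real.cos (om * t)) (fun t => -(om * Real.sin (om * t))) :=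
    isPrim_of_hasDerivAt (fun t => by
      convert! ((hasDerivAt_id t).const_mul om).cos using 1
      simp; ring) (by fun_prop)
  have hA : IsPrim T (fun t => c₀ + ∫ s in (0 : ℝ)..t, -(om⁻¹ * Real.sin (om * s)) * f s)
      (fun s => -(om⁻¹ * Real.sin (om * s)) * f s) :=
    ⟨hf.continuousOn_mul (by fun_prop), fun t _ => by simp⟩
  have hB : IsPrim T (fun t => om⁻¹ * d₀ + ∫ s in (0 : ℝ)..t, (om⁻¹ * Real.cos (om * s)) * f s)
      (fun s => (om⁻¹ * Real.cos (om * s)) * f s) :=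
    ⟨hf.continuousOn_mul (by fun_prop), fun t _ => by simp⟩
  set A := fun t => c₀ + ∫ s in (0 : ℝ)..t, -(om⁻¹ * Real.sin (om * s)) * f s with hAd
  set B := fun t => om⁻¹ * d₀ + ∫ s in (0 : ℝ)..t, (om⁻¹ * Real.cos (om * s)) * f s with hBd
  refine ⟨fun t => A t * Real.cos (om * t) + B t * Real.sin (om * t),
    fun t => om * (-1 * (A t * Real.sin (om * t)) + B t * Real.cos (om * t)), ⟨?_, ?_⟩, ?_, ?_⟩
  · refine ((hA.mul hT hc).add (hB.mul hT hs)).congr (Eventually.of_forall fun t => ?_) hT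
    simp only
    ring
  · refine ((((hA.mul hT hs).const_mul (-1)).add (hB.mul hT hc)).const_mul om).congr
      (Eventually.of_forall fun t => ?_) hT
    simp only
    rw [← hom2]
    have h1 := Real.sin_sq_add_cos_sq (om * t)
    have h2 : om * om⁻¹ = 1 := mul_inv_cancel₀ hom
    linear_combination (f t) * h1 + (f t * (Real.sin (om * t) ^ 2 + Real.cos (om * t) ^ 2)) * h2
  · simp [hAd]
  · simp [hBd, hom]

lemma Osc.sub {T lam : ℝ} {f f' C C' D D' : ℝ → ℝ} (h : Osc T lam f C D) (h' : Osc T lam f' C' D')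
    (hT : 0 ≤ T) : Osc T lam (fun t => f t - f' t) (fun t => C t - C' t) (fun t => D t - D' t) := by
  have e1 := h.fst.add (h'.fst.const_mul (-1))
  have e2 := h.snd.add (h'.snd.const_mul (-1))
  have f1 : (fun t => C t + -1 * C' t) = fun t => C t - C' t := by funext t; ring
  have f2 : (fun t => D t + -1 * D' t) = fun t => D t - D' t := by funext t; ring
  rw [f1, f2] at e1
  rw [f2] at e2
  exact ⟨e1, e2.congr (Eventually.of_forall fun t => by simp only; ring) hT⟩

/-- An oscillator with regular forcing is differentiable once more. -/
lemma Osc.deriv {T lam : ℝ} {f f' C D : ℝ → ℝ} (h : Osc T lam f C D) (hf : IsPrim T f f')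
    (hT : 0 ≤ T) : Osc T lam f' D (fun t => f t - lam * C t) := by
  have h2 := (hf.add (h.fst.const_mul (-lam))).congr (g' := fun t => f' t - lam * D t)
    (Eventually.of_forall fun t => by simp only; ring) hT
  have e : (fun t => f t + -lam * C t) = fun t => f t - lam * C t := by funext t; ring
  rw [e] at h2
  exact ⟨h.snd, h2⟩

/-! ### Multiplication operators -/

lemma memLp_bdd_mul {X : Type*} [MeasurableSpace X] {μ ν : Measure X} (hν : ν ≤ μ) {w : X → ℝ}
    (hw : AEStronglyMeasurable w ν) {K : ℝ} (hK : ∀ᵐ x ∂ν, |w x| ≤ K) (f : Lp ℝ 2 μ) :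
    MemLp (fun x => w x * f x) 2 ν := by
  have hf := (Lp.memLp f).mono_measure hν
  refine MemLp.of_le_mul hf (hw.mul hf.1) (c := K) ?_
  filter_upwards [hK] with x h
  rw [norm_mul]
  exact mul_le_mul_of_nonneg_right h (norm_nonneg _)

lemma norm_toLp_le_of_measure_le {X : Type*} [MeasurableSpace X] {μ ν : Measure X} (hν : ν ≤ μ)
    (f : Lp ℝ 2 μ) : ‖((Lp.memLp f).mono_measure hν).toLp‖ ≤ ‖f‖ := by
  rw [Lp.norm_toLp, Lp.norm_def]
  exact ENNReal.toReal_mono (Lp.eLpNorm_ne_top f) (eLpNorm_mono_measure f hν)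

lemma norm_bdd_mul_le {X : Type*} [MeasurableSpace X] {μ ν : Measure X} (hν : ν ≤ μ) {w : X → ℝ}
    (hw : AEStronglyMeasurable w ν) {K : ℝ} (hK : ∀ᵐ x ∂ν, |w x| ≤ K) (hK0 : 0 ≤ K) (f : Lp ℝ 2 μ) :
    ‖(memLp_bdd_mul hν hw hK f).toLp‖ ≤ K * ‖f‖ := by
  refine le_trans (Lp.norm_le_mul_norm_of_ae_le_mul ?_)
    (mul_le_mul_of_nonneg_left (norm_toLp_le_of_measure_le hν f) hK0)
  filter_upwards [(memLp_bdd_mul hν hw hK f).coeFn_toLp,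
    ((Lp.memLp f).mono_measure hν).coeFn_toLp, hK] with x h1 h2 h3
  rw [h1, h2, norm_mul]
  exact mul_le_mul_of_nonneg_right h3 (norm_nonneg _)

/-- Restriction to a smaller measure followed by multiplication by an essentially bounded
function, on `L²`. -/
def mulOp {X : Type*} [MeasurableSpace X] {μ ν : Measure X} (hν : ν ≤ μ) (w : X → ℝ)
    (hw : AEStronglyMeasurable w ν) (K : ℝ) (hK : ∀ᵐ x ∂ν, |w x| ≤ K) (hK0 : 0 ≤ K) :
    Lp ℝ 2 μ →L[ℝ] Lp ℝ 2 ν :=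
  LinearMap.mkContinuous
    { toFun := fun f => (memLp_bdd_mul hν hw hK f).toLp
      map_add' := by
        intro f g
        rw [← MemLp.toLp_add]
        refine MemLp.toLp_congr _ _ ?_
        filter_upwards [ae_mono hν (Lp.coeFn_add f g)] with x hx
        simp only [hx, Pi.add_apply]
        ring
      map_smul' := by
        intro c f
        rw [RingHom.id_apply, ← MemLp.toLp_const_smul]
        refine MemLp.toLp_congr _ _ ?_
        filter_upwards [ae_mono hν (Lp.coeFn_smul c f)] with x hx
        simp only [hx, Pi.smul_apply, smul_eq_mul]
        ring } K (norm_bdd_mul_le hν hw hK hK0)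

lemma mulOp_coe {X : Type*} [MeasurableSpace X] {μ ν : Measure X} (hν : ν ≤ μ) {w : X → ℝ}
    (hw : AEStronglyMeasurable w ν) {K : ℝ} (hK : ∀ᵐ x ∂ν, |w x| ≤ K) (hK0 : 0 ≤ K) (f : Lp ℝ 2 μ) :
    (mulOp hν w hw K hK hK0 f : X → ℝ) =ᵐ[ν] fun x => w x * f x :=
  MemLp.coeFn_toLp (memLp_bdd_mul hν hw hK f)

lemma norm_mulOp_le {X : Type*} [MeasurableSpace X] {μ ν : Measure X} (hν : ν ≤ μ) {w : X → ℝ}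
    (hw : AEStronglyMeasurable w ν) {K : ℝ} (hK : ∀ᵐ x ∂ν, |w x| ≤ K) (hK0 : 0 ≤ K) (f : Lp ℝ 2 μ) :
    ‖mulOp hν w hw K hK hK0 f‖ ≤ K * ‖f‖ :=
  norm_bdd_mul_le hν hw hK hK0 f

/-! ### The multiplier method on the modes in the radial variable -/

namespace Spec

variable {α : ℝ} (D : Spec α)

lemma aesm_rpow (s : ℝ) :
    AEStronglyMeasurable (fun r : ℝ => r ^ s) (volume.restrict (Ioo (0 : ℝ) 1)) :=
  (measurable_id.pow_const s).aestronglyMeasurable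

lemma ae_abs_rpow_le {s : ℝ} (hs : 0 ≤ s) :
    ∀ᵐ r ∂(volume.restrict (Ioo (0 : ℝ) 1)), |r ^ s| ≤ 1 := by
  filter_upwards [ae_restrict_mem measurableSet_Ioo] with r hr
  rw [abs_of_nonneg (Real.rpow_nonneg hr.1.le _)]
  exact Real.rpow_le_one hr.1.le hr.2.le hs

lemma ae_abs_weight_le (D : Spec α) :
    ∀ᵐ r ∂(volume.restrict (Ioo (0 : ℝ) 1)), |r ^ (1 - α / 2)| ≤ 1 :=
  ae_abs_rpow_le (by linarith [D.α_lt])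

/-- `r W_j'`. -/
def rder (j : D.κ) : L2Top :=
  mulOp le_rfl (fun r : ℝ => r ^ (1 - α / 2)) (aesm_rpow _) 1 D.ae_abs_weight_le zero_le_one (D.cd j)

lemma rder_coe (j : D.κ) : (D.rder j : ℝ → ℝ) =ᵐ[volume.restrict (Ioo (0 : ℝ) 1)]
    fun r => r ^ (1 - α) * D.F j r := by
  filter_upwards [mulOp_coe le_rfl (aesm_rpow _) D.ae_abs_weight_le zero_le_one (D.cd j), D.cd_coe j,
    ae_restrict_mem measurableSet_Ioo] with r h1 h2 hr
  rw [rder, h1, h2, ← mul_assoc, ← Real.rpow_add hr.1]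
  congr 2; ring

/-- The matrix of the multiplier. -/
def M (i j : D.κ) : ℝ := inner ℝ (D.c i) (D.rder j)

lemma M_eq (i j : D.κ) : D.M i j = ∫ r in (0 : ℝ)..1, D.W i r * (r ^ (1 - α) * D.F j r) := by
  rw [M, L2Top.inner_eq, ← setIntegral_Ioo_eq zero_le_one]
  apply integral_congr_ae
  filter_upwards [D.c_coe i, D.rder_coe j] with r h1 h2
  rw [h1, h2]

lemma inner_c_eq (i j : D.κ) : inner ℝ (D.c i) (D.c j) = ∫ r in (0 : ℝ)..1, D.W i r * D.W j r := by
  rw [L2Top.inner_eq, ← setIntegral_Ioo_eq zero_le_one]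
  apply integral_congr_ae
  filter_upwards [D.c_coe i, D.c_coe j] with r h1 h2
  rw [h1, h2]

lemma inner_cd_eq (i j : D.κ) :
    inner ℝ (D.cd i) (D.cd j) = ∫ r in (0 : ℝ)..1, r ^ (-α) * (D.F i r * D.F j r) := by
  rw [L2Top.inner_eq, ← setIntegral_Ioo_eq zero_le_one]
  apply integral_congr_ae
  filter_upwards [D.cd_coe i, D.cd_coe j, ae_restrict_mem measurableSet_Ioo] with r h1 h2 hr
  have e : r ^ (-α) = r ^ (-(α / 2)) * r ^ (-(α / 2)) := by
    rw [← Real.rpow_add hr.1]; congr 1; ring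
  rw [h1, h2, e]; ring

lemma continuous_rpow_one_sub (D : Spec α) : Continuous fun r : ℝ => r ^ (1 - α) :=
  Real.continuous_rpow_const (by linarith [D.α_lt])

/-- The integral of $(rW_iW_j)'$ over $(0,1)$ is zero because $W_i(1)=0$; expanding it leaves the
orthonormality relation plus the two matrix entries. -/
lemma M_add_M [DecidableEq D.κ] (i j : D.κ) : D.M i j + D.M j i = if i = j then -1 else 0 := by
  have c1 := D.W_cont i
  have c2 := D.W_cont j
  have c3 := D.F_cont i
  have c4 := D.F_cont j
  have cr := D.continuous_rpow_one_sub
  have e := intervalIntegral.integral_eq_sub_of_hasDerivAt_of_le (a := 0) (b := 1)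
    (f := fun r => r * (D.W i r * D.W j r))
    (f' := fun r => D.W i r * D.W j r + (D.W i r * (r ^ (1 - α) * D.F j r)
      + D.W j r * (r ^ (1 - α) * D.F i r)))
    zero_le_one (by fun_prop) (fun r hr => by
      have e1 : r ^ (1 - α) = r * r ^ (-α) := by
        rw [sub_eq_add_neg, Real.rpow_add hr.1, Real.rpow_one]
      convert! (hasDerivAt_id r).mul (((D.moder i).hasDerivAt r hr).mul ((D.moder j).hasDerivAt r hr))
        using 1
      rw [e1]; simp; ring) (Continuous.intervalIntegrable (by fun_prop) _ _)
  rw [intervalIntegral.integral_add (Continuous.intervalIntegrable (by fun_prop) _ _)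
    (Continuous.intervalIntegrable (by fun_prop) _ _), intervalIntegral.integral_add
    (Continuous.intervalIntegrable (by fun_prop) _ _)
    (Continuous.intervalIntegrable (by fun_prop) _ _), ← M_eq, ← M_eq, ← inner_c_eq, inner_c,
    (D.moder i).one] at e
  split_ifs at e ⊢ <;> linarith

/-- A Rellich identity, obtained by integrating $(r^{1-\alpha}F_iF_j)'$. At $r=0$ the boundary term
vanishes since $\alpha<1$; at $r=1$ it is the product of the fluxes, the source of the trace
estimate. -/
lemma mu_M_add [DecidableEq D.κ] (i j : D.κ) : D.μ i * D.M i j + D.μ j * D.M j i =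
    (if i = j then (1 - α) * D.μ i else 0) - D.F i 1 * D.F j 1 := by
  have c1 := D.W_cont i
  have c2 := D.W_cont j
  have c3 := D.F_cont i
  have c4 := D.F_cont j
  have cr := D.continuous_rpow_one_sub
  have i1 : IntervalIntegrable (fun r => r ^ (-α) * (D.F i r * D.F j r)) volume 0 1 :=
    (intervalIntegrable_rpow_neg D.α_lt 0 1).mul_continuousOn (by fun_prop)
  have i2 : IntervalIntegrable (fun r => D.μ i * (D.W i r * (r ^ (1 - α) * D.F j r))
      + D.μ j * (D.W j r * (r ^ (1 - α) * D.F i r))) volume 0 1 :=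
    Continuous.intervalIntegrable (by fun_prop) _ _
  have e := intervalIntegral.integral_eq_sub_of_hasDerivAt_of_le (a := 0) (b := 1)
    (f := fun r => r ^ (1 - α) * (D.F i r * D.F j r))
    (f' := fun r => (1 - α) * (r ^ (-α) * (D.F i r * D.F j r))
      - (D.μ i * (D.W i r * (r ^ (1 - α) * D.F j r)) + D.μ j * (D.W j r * (r ^ (1 - α) * D.F i r))))
    zero_le_one (by fun_prop) (fun r hr => by
      have e1 : HasDerivAt (fun r : ℝ => r ^ (1 - α)) ((1 - α) * r ^ (-α)) r := by
        have := Real.hasDerivAt_rpow_const (x := r) (p := 1 - α) (Or.inl hr.1.ne')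
        convert! this using 3
        ring
      convert! e1.mul (((D.moder i).flux r).mul ((D.moder j).flux r)) using 1
      simp only [Pi.mul_apply]
      ring) ((i1.const_mul _).sub i2)
  rw [intervalIntegral.integral_sub (i1.const_mul _) i2, intervalIntegral.integral_const_mul,
    ← inner_cd_eq, inner_cd, intervalIntegral.integral_add
    (Continuous.intervalIntegrable (by fun_prop) _ _)
    (Continuous.intervalIntegrable (by fun_prop) _ _), intervalIntegral.integral_const_mul,
    intervalIntegral.integral_const_mul, ← M_eq, ← M_eq, Real.one_rpow,
    Real.zero_rpow (by linarith [D.α_lt])] at e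
  split_ifs at e ⊢ <;> linarith

lemma norm_sq_sum_cd (S : Finset D.κ) (y : D.κ → ℝ) :
    ‖∑ j ∈ S, y j • D.cd j‖ ^ 2 = ∑ j ∈ S, D.μ j * y j ^ 2 := by
  classical
  rw [← real_inner_self_eq_norm_sq, sum_inner]
  refine Finset.sum_congr rfl fun a ha => ?_
  rw [inner_sum, Finset.sum_eq_single_of_mem a ha]
  · rw [inner_smul_left, inner_smul_right, inner_cd]; simp; ring
  · intro a' _ h
    rw [inner_smul_left, inner_smul_right, inner_cd, if_neg (Ne.symm h)]; simp

/-- The double sum is the inner product of $\sum x_iW_i$ with $r\partial_r\sum y_jW_j$. Since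
$r^{1-\alpha/2}\le1$, the second factor is bounded by the weighted gradient. -/
lemma abs_sum_M_le (S : Finset D.κ) (x y : D.κ → ℝ) :
    |∑ i ∈ S, ∑ j ∈ S, D.M i j * (x i * y j)| ≤
      (∑ i ∈ S, x i ^ 2 + ∑ j ∈ S, D.μ j * y j ^ 2) / 2 := by
  have e1 : ∑ i ∈ S, ∑ j ∈ S, D.M i j * (x i * y j)
      = inner ℝ (∑ i ∈ S, x i • D.c i) (∑ j ∈ S, y j • D.rder j) := by
    rw [sum_inner]
    refine Finset.sum_congr rfl fun i _ => ?_
    rw [inner_sum]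
    refine Finset.sum_congr rfl fun j _ => ?_
    rw [inner_smul_left, inner_smul_right, M]
    simp; ring
  have e2 : ‖∑ j ∈ S, y j • D.rder j‖ ≤ ‖∑ j ∈ S, y j • D.cd j‖ := by
    have : ∑ j ∈ S, y j • D.rder j =
      mulOp le_rfl (fun r : ℝ => r ^ (1 - α / 2)) (aesm_rpow _) 1 D.ae_abs_weight_le zero_le_one
        (∑ j ∈ S, y j • D.cd j) := by
      simp only [map_sum, map_smul]; rfl
    rw [this]
    exact (norm_mulOp_le le_rfl (aesm_rpow _) D.ae_abs_weight_le zero_le_one (∑ j ∈ S, y j • D.cd j)).trans_eq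
      (one_mul _)
  have e3 : ‖∑ i ∈ S, x i • D.c i‖ ^ 2 = ∑ i ∈ S, x i ^ 2 := by
    rw [← real_inner_self_eq_norm_sq, D.c.orthonormal.inner_sum]
    simp [sq]
  rw [e1, ← e3, ← norm_sq_sum_cd]
  refine (abs_real_inner_le_norm _ _).trans ?_
  nlinarith [sq_nonneg (‖∑ i ∈ S, x i • D.c i‖ - ‖∑ j ∈ S, y j • D.rder j‖),
    norm_nonneg (∑ j ∈ S, y j • D.rder j), norm_nonneg (∑ j ∈ S, y j • D.cd j)]

lemma sum_mul_ite_eq {κ : Type*} [DecidableEq κ] (S : Finset κ) (x z : κ → ℝ) :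
    ∑ i ∈ S, ∑ j ∈ S, (if i = j then z i else 0) * (x i * x j) = ∑ i ∈ S, z i * x i ^ 2 := by
  refine Finset.sum_congr rfl fun i hi => ?_
  rw [Finset.sum_eq_single_of_mem i hi]
  · rw [if_pos rfl]; ring
  · intro j _ hj
    rw [if_neg (Ne.symm hj), zero_mul]

/-- A quadratic form sees only the symmetric part of its matrix, which `M_add_M` evaluates. -/
lemma sum_symm_M (S : Finset D.κ) (x : D.κ → ℝ) :
    ∑ i ∈ S, ∑ j ∈ S, D.M i j * (x i * x j) = -(∑ i ∈ S, x i ^ 2) / 2 := by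
  classical
  have h1 : ∑ i ∈ S, ∑ j ∈ S, D.M i j * (x i * x j)
      = ∑ i ∈ S, ∑ j ∈ S, D.M j i * (x i * x j) := by
    rw [Finset.sum_comm]
    refine Finset.sum_congr rfl fun i _ => Finset.sum_congr rfl fun j _ => by ring
  have h2 : ∑ i ∈ S, ∑ j ∈ S, D.M i j * (x i * x j) + ∑ i ∈ S, ∑ j ∈ S, D.M j i * (x i * x j)
      = ∑ i ∈ S, -1 * x i ^ 2 := by
    rw [← sum_mul_ite_eq S x (fun _ => -1), ← Finset.sum_add_distrib]
    refine Finset.sum_congr rfl fun i _ => ?_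
    rw [← Finset.sum_add_distrib]
    refine Finset.sum_congr rfl fun j _ => ?_
    rw [← add_mul, M_add_M]
  rw [← Finset.mul_sum] at h2
  linarith

/-- The same symmetrisation for $\mathrm{diag}(\mu)M$, with `mu_M_add`; the rank-one matrix
$F_i(1)F_j(1)$ becomes a perfect square. -/
lemma sum_mu_M (S : Finset D.κ) (x : D.κ → ℝ) :
    ∑ i ∈ S, ∑ j ∈ S, D.μ i * D.M i j * (x i * x j) =
      ((1 - α) * ∑ i ∈ S, D.μ i * x i ^ 2 - (∑ i ∈ S, x i * D.F i 1) ^ 2) / 2 := by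
  classical
  have h1 : ∑ i ∈ S, ∑ j ∈ S, D.μ i * D.M i j * (x i * x j)
      = ∑ i ∈ S, ∑ j ∈ S, D.μ j * D.M j i * (x i * x j) := by
    rw [Finset.sum_comm]
    refine Finset.sum_congr rfl fun i _ => Finset.sum_congr rfl fun j _ => by ring
  have h2 : ∑ i ∈ S, ∑ j ∈ S, D.μ i * D.M i j * (x i * x j)
      + ∑ i ∈ S, ∑ j ∈ S, D.μ j * D.M j i * (x i * x j)
      = ∑ i ∈ S, ((1 - α) * D.μ i) * x i ^ 2 - (∑ i ∈ S, x i * D.F i 1) ^ 2 := by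
    rw [← sum_mul_ite_eq S x (fun i => (1 - α) * D.μ i), sq, Finset.sum_mul_sum,
      ← Finset.sum_add_distrib, ← Finset.sum_sub_distrib]
    refine Finset.sum_congr rfl fun i _ => ?_
    rw [← Finset.sum_add_distrib, ← Finset.sum_sub_distrib]
    refine Finset.sum_congr rfl fun j _ => ?_
    rw [← add_mul, mu_M_add]
    ring
  simp only [mul_assoc (1 - α)] at h2
  rw [← Finset.mul_sum] at h2
  linarith

/-- The hidden regularity estimate for finitely many modes in the radial variable. -/
lemma hidden_regularity {T ν : ℝ} (hT : 0 < T) (hν : 0 ≤ ν) (S : Finset D.κ)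
    {f x y : D.κ → ℝ → ℝ} (h : ∀ j, Osc T (ν + D.μ j) (f j) (x j) (y j))
    (hf : ∀ j, MemLp (f j) 2 (volume.restrict (Ioo 0 T))) :
    ∫ t in Ioo 0 T, (∑ j ∈ S, x j t * D.F j 1) ^ 2 ≤ (5 + 14 * T + 12 * T ^ 2) *
      ∑ j ∈ S, (y j 0 ^ 2 + (ν + D.μ j) * x j 0 ^ 2 + ∫ t in Ioo 0 T, f j t ^ 2) := by
  set K := ∑ j ∈ S, (y j 0 ^ 2 + (ν + D.μ j) * x j 0 ^ 2 + ∫ t in Ioo 0 T, f j t ^ 2) with hK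
  have cx : ∀ j, ContinuousOn (x j) (Icc 0 T) := fun j => (h j).fst.continuousOn hT.le
  have hE : ∀ t ∈ Icc 0 T, ∑ j ∈ S, (y j t ^ 2 + (ν + D.μ j) * x j t ^ 2) ≤ (2 + 4 * T) * K := by
    intro t ht
    rw [hK, Finset.mul_sum]
    exact Finset.sum_le_sum fun j _ =>
      (h j).energy_le hT (add_nonneg hν (D.μ_pos j).le) (hf j) ht
  have hK0 : 0 ≤ K := Finset.sum_nonneg fun j _ => by
    have := D.μ_pos j
    have : 0 ≤ ∫ t in Ioo 0 T, f j t ^ 2 := integral_nonneg fun _ => sq_nonneg _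
    positivity
  have hE' : ∀ t, ∑ j ∈ S, (y j t ^ 2 + (ν + D.μ j) * x j t ^ 2) = ∑ j ∈ S, y j t ^ 2
      + ν * ∑ j ∈ S, x j t ^ 2 + ∑ j ∈ S, D.μ j * x j t ^ 2 := by
    intro t
    rw [Finset.mul_sum, ← Finset.sum_add_distrib, ← Finset.sum_add_distrib]
    exact Finset.sum_congr rfl fun j _ => by ring
  have n1 : ∀ t, 0 ≤ ∑ j ∈ S, y j t ^ 2 := fun t => Finset.sum_nonneg fun _ _ => sq_nonneg _
  have n2 : ∀ t, 0 ≤ ν * ∑ j ∈ S, x j t ^ 2 := fun t =>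
    mul_nonneg hν (Finset.sum_nonneg fun _ _ => sq_nonneg _)
  have n3 : ∀ t, 0 ≤ ∑ j ∈ S, D.μ j * x j t ^ 2 := fun t =>
    Finset.sum_nonneg fun j _ => mul_nonneg (D.μ_pos j).le (sq_nonneg _)
  -- In terms of the function $u=\sum x_jW_j$ this is $\int \partial_tu\,r\partial_ru\,dr$, the
  -- classical multiplier functional.
  set B : ℝ → ℝ := fun t => ∑ i ∈ S, ∑ j ∈ S, D.M i j * (y i t * x j t) with hB
  set B' : ℝ → ℝ := fun t => ∑ i ∈ S, ∑ j ∈ S, D.M i j *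
    ((f i t - (ν + D.μ i) * x i t) * x j t + y i t * y j t) with hB'
  have hp : IsPrim T B B' := IsPrim.sum S fun i _ => IsPrim.sum S fun j _ =>
    (((h i).snd.mul hT.le (h j).fst).const_mul (D.M i j))
  have hBle : ∀ t ∈ Icc 0 T, |B t| ≤ (1 + 2 * T) * K := by
    intro t ht
    have h1 := D.abs_sum_M_le S (fun i => y i t) (fun j => x j t)
    have h2 := hE t ht
    rw [hE'] at h2
    have := n2 t
    simp only [hB]
    linarith
  -- After insertion of the oscillator equations, all terms but the one with the force are quadratic
  -- forms in a single vector, so the symmetrised identities evaluate them.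
  have hB'eq : ∀ t, B' t = ∑ i ∈ S, ∑ j ∈ S, D.M i j * (f i t * x j t)
      + ν * (∑ j ∈ S, x j t ^ 2) / 2
      - ((1 - α) * ∑ i ∈ S, D.μ i * x i t ^ 2 - (∑ i ∈ S, x i t * D.F i 1) ^ 2) / 2
      - (∑ i ∈ S, y i t ^ 2) / 2 := by
    intro t
    have e1 := D.sum_symm_M S (fun i => x i t)
    have e2 := D.sum_symm_M S (fun i => y i t)
    have e3 := D.sum_mu_M S (fun i => x i t)
    have : B' t = ∑ i ∈ S, ∑ j ∈ S, D.M i j * (f i t * x j t)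
        - ν * ∑ i ∈ S, ∑ j ∈ S, D.M i j * (x i t * x j t)
        - ∑ i ∈ S, ∑ j ∈ S, D.μ i * D.M i j * (x i t * x j t)
        + ∑ i ∈ S, ∑ j ∈ S, D.M i j * (y i t * y j t) := by
      simp only [hB', Finset.mul_sum, ← Finset.sum_add_distrib, ← Finset.sum_sub_distrib]
      exact Finset.sum_congr rfl fun i _ => Finset.sum_congr rfl fun j _ => by ring
    rw [this, e1, e2, e3]
    ring
  -- The identity is solved for the squared boundary flux; what remains is bounded by the force and
  -- by a multiple of the energy, and $2B'$ integrates to boundary values in time.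
  have hpt : ∀ t ∈ Ioo 0 T, (∑ j ∈ S, x j t * D.F j 1) ^ 2 ≤
      2 * B' t + (∑ j ∈ S, f j t ^ 2) + 3 * ((2 + 4 * T) * K) := by
    intro t ht
    have h1 := hE t (Ioo_subset_Icc_self ht)
    rw [hE'] at h1
    have h2 := abs_le.1 (D.abs_sum_M_le S (fun i => f i t) (fun j => x j t))
    have h3 : (1 - α) * ∑ i ∈ S, D.μ i * x i t ^ 2 ≤ ∑ i ∈ S, D.μ i * x i t ^ 2 :=
      mul_le_of_le_one_left (n3 t) (by linarith [D.α_pos])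
    have := n1 t
    have := n2 t
    have := n3 t
    rw [hB'eq t]
    linarith [h2.1]
  have iB : IntegrableOn B' (Ioo 0 T) := by
    have := hp.integrable
    rwa [intervalIntegrable_iff_integrableOn_Ioo_of_le hT.le] at this
  have if' : ∀ j, IntegrableOn (fun t => f j t ^ 2) (Ioo 0 T) := fun j => (hf j).integrable_sq
  have iF : IntegrableOn (fun t => ∑ j ∈ S, f j t ^ 2) (Ioo 0 T) :=
    integrable_finsetSum _ fun j _ => if' j
  have ic : IntegrableOn (fun _ : ℝ => 3 * ((2 + 4 * T) * K)) (Ioo 0 T) := integrableOn_const (by simp)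
  have iG : IntegrableOn (fun t => (∑ j ∈ S, x j t * D.F j 1) ^ 2) (Ioo 0 T) :=
    integrableOn_sq_of_continuousOn (continuousOn_finsetSum S fun j _ =>
      (cx j).mul continuousOn_const)
  have i2 := (iB.const_mul 2).add iF
  have hint := setIntegral_mono_on iG (i2.add ic) measurableSet_Ioo hpt
  have e1 : ∫ t in Ioo 0 T, B' t = B T - B 0 := by
    rw [hp.eq T ⟨hT.le, le_rfl⟩, setIntegral_Ioo_eq hT.le]; ring
  have e2 : ∫ t in Ioo 0 T, ∑ j ∈ S, f j t ^ 2 ≤ K := by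
    rw [integral_finsetSum _ fun j _ => if' j, hK]
    refine Finset.sum_le_sum fun j _ => ?_
    have := D.μ_pos j
    have : 0 ≤ y j 0 ^ 2 + (ν + D.μ j) * x j 0 ^ 2 := by positivity
    linarith
  have e3 : ∫ t in Ioo 0 T, ((fun t => 2 * B' t) + fun t => ∑ j ∈ S, f j t ^ 2) t
      = 2 * (B T - B 0) + ∫ t in Ioo 0 T, ∑ j ∈ S, f j t ^ 2 := by
    rw [← e1, ← integral_const_mul]
    exact integral_add (iB.const_mul 2) iF
  have e4 : ∫ t in Ioo 0 T, (((fun t => 2 * B' t) + fun t => ∑ j ∈ S, f j t ^ 2)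
      + fun _ : ℝ => 3 * ((2 + 4 * T) * K)) t = 2 * (B T - B 0)
      + (∫ t in Ioo 0 T, ∑ j ∈ S, f j t ^ 2) + T * (3 * ((2 + 4 * T) * K)) := by
    rw [← e3]
    refine (integral_add i2 ic).trans ?_
    congr 1
    simp [hT.le]
  have hBT := abs_le.1 (hBle T ⟨hT.le, le_rfl⟩)
  have hB0 := abs_le.1 (hBle 0 ⟨le_rfl, hT.le⟩)
  -- The constant is $4(1+2T)$ from the two values of $B$, $1$ from the force and $3T(2+4T)$ from
  -- the energy.
  refine hint.trans ?_
  rw [e4]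
  nlinarith [hBT.2, hB0.1, mul_nonneg hT.le hK0, mul_nonneg (sq_nonneg T) hK0]

end Spec

/-! ### Bochner functions of time -/

section bochner

variable {X Y : Type*} [NormedAddCommGroup X] [NormedAddCommGroup Y]

lemma L2t.integrableOn {T : ℝ} (u : L2t T X) : IntegrableOn (fun t => u t) (Ioo 0 T) :=
  (Lp.memLp u).integrable (by norm_num)

lemma memLp_two_of_continuousOn {T : ℝ} {u : ℝ → X} (hu : ContinuousOn u (Icc 0 T)) :
    MemLp u 2 (volume.restrict (Ioo 0 T)) := by
  obtain ⟨C, hC⟩ := isCompact_Icc.exists_bound_of_continuousOn hu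
  refine MemLp.of_bound ((hu.aestronglyMeasurable_of_isCompact isCompact_Icc
    measurableSet_Icc).mono_measure (Measure.restrict_mono Ioo_subset_Icc_self le_rfl)) C ?_
  filter_upwards [ae_restrict_mem measurableSet_Ioo] with t ht
  exact hC t (Ioo_subset_Icc_self ht)

lemma eqOn_Icc_of_ae_eq {T : ℝ} (hT : 0 < T) {u v : ℝ → X} (hu : ContinuousOn u (Icc 0 T))
    (hv : ContinuousOn v (Icc 0 T)) (h : u =ᵐ[volume.restrict (Ioo 0 T)] v) :
    EqOn u v (Icc 0 T) := by
  refine Measure.eqOn_Icc_of_ae_eq volume hT.ne ?_ hu hv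
  rwa [← Measure.restrict_congr_set Ioo_ae_eq_Icc]

/-- Continuous sums of functions of time. -/
lemma continuousOn_tsum_of_norm_sq_sum_le [CompleteSpace X] {ι : Type*} {T : ℝ} {x : ι → ℝ → X}
    {m : ι → ℝ} (hx : ∀ i, ContinuousOn (x i) (Icc 0 T)) (hm : Summable m)
    (h : ∀ (S : Finset ι), ∀ t ∈ Icc 0 T, ‖∑ i ∈ S, x i t‖ ^ 2 ≤ ∑ i ∈ S, m i) :
    ContinuousOn (fun t => ∑' i, x i t) (Icc 0 T) ∧
      ∀ t ∈ Icc 0 T, HasSum (fun i => x i t) (∑' i, x i t) := by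
  have hp : ∀ t ∈ Icc 0 T, HasSum (fun i => x i t) (∑' i, x i t) := fun t ht =>
    (summable_of_norm_sq_sum_le hm fun S => h S t ht).hasSum
  refine ⟨?_, hp⟩
  by_cases hT : 0 ≤ T
  swap
  · rw [Icc_eq_empty hT]
    exact continuousOn_empty _
  -- The majorant does not depend on $t$, so the summability criterion applies in the Banach space
  -- of continuous functions, and the sum is continuous.
  let F : ι → C(Icc 0 T, X) := fun i => ⟨(Icc 0 T).domRestrict (x i), (hx i).domRestrict⟩
  have hF : Summable F := by
    refine summable_of_norm_sq_sum_le hm fun S => ?_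
    have h0 : 0 ≤ ∑ i ∈ S, m i := (sq_nonneg _).trans (h S 0 ⟨le_rfl, hT⟩)
    have : ‖∑ i ∈ S, F i‖ ≤ Real.sqrt (∑ i ∈ S, m i) := by
      rw [ContinuousMap.norm_le _ (Real.sqrt_nonneg _)]
      intro t
      rw [ContinuousMap.sum_apply]
      exact Real.le_sqrt_of_sq_le (h S t t.2)
    calc ‖∑ i ∈ S, F i‖ ^ 2 ≤ Real.sqrt (∑ i ∈ S, m i) ^ 2 := by gcongr
      _ = _ := Real.sq_sqrt h0
  rw [continuousOn_iff_continuous_domRestrict]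
  have : (Icc 0 T).domRestrict (fun t => ∑' i, x i t) = ⇑(∑' i, F i) := by
    funext t
    exact ContinuousMap.tsum_apply hF t
  rw [this]
  exact ContinuousMap.continuous _

variable [NormedSpace ℝ X] [NormedSpace ℝ Y]

lemma integrableOn_smul_of_hasCompactSupport {T : ℝ} {η : ℝ → ℝ} (hη : Continuous η)
    (hc : HasCompactSupport η) {u : ℝ → X} (hu : IntegrableOn u (Ioo 0 T)) :
    IntegrableOn (fun t => η t • u t) (Ioo 0 T) := by
  obtain ⟨C, hC⟩ := hη.bounded_above_of_compact_support hc
  exact Integrable.bdd_smul hu C hη.aestronglyMeasurable (Eventually.of_forall hC)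

lemma IsTest.integrableOn_smul {T : ℝ} {η : ℝ → ℝ} (hη : IsTest (Ioo 0 T) η) {u : ℝ → X}
    (hu : IntegrableOn u (Ioo 0 T)) : IntegrableOn (fun t => η t • u t) (Ioo 0 T) :=
  integrableOn_smul_of_hasCompactSupport hη.1.continuous hη.2.1 hu

lemma IsTest.integrableOn_deriv_smul {T : ℝ} {η : ℝ → ℝ} (hη : IsTest (Ioo 0 T) η) {u : ℝ → X}
    (hu : IntegrableOn u (Ioo 0 T)) : IntegrableOn (fun t => deriv η t • u t) (Ioo 0 T) :=
  integrableOn_smul_of_hasCompactSupport (hη.1.continuous_deriv (by simp)) hη.2.1.deriv hu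

lemma clm_integral_smul [CompleteSpace X] [CompleteSpace Y] (L : X →L[ℝ] Y) {T : ℝ} {η : ℝ → ℝ}
    {u : ℝ → X} (hu : IntegrableOn (fun t => η t • u t) (Ioo 0 T)) :
    L (∫ t in Ioo 0 T, η t • u t) = ∫ t in Ioo 0 T, η t • L (u t) := by
  rw [← L.integral_comp_comm hu]
  simp only [map_smul]

lemma IsWeakTimeDeriv.clm_comp [CompleteSpace X] [CompleteSpace Y] {T : ℝ} {u u' : ℝ → X}
    (h : IsWeakTimeDeriv T u u') (hu : IntegrableOn u (Ioo 0 T)) (hu' : IntegrableOn u' (Ioo 0 T))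
    (L : X →L[ℝ] Y) : IsWeakTimeDeriv T (fun t => L (u t)) (fun t => L (u' t)) := by
  intro η hη
  rw [← clm_integral_smul L (hη.integrableOn_deriv_smul hu),
    ← clm_integral_smul L (hη.integrableOn_smul hu'), h η hη, map_neg]

lemma IsWeakTimeDeriv.congr {T : ℝ} {u u' v v' : ℝ → X} (h : IsWeakTimeDeriv T u u')
    (hv : u =ᵐ[volume.restrict (Ioo 0 T)] v) (hv' : u' =ᵐ[volume.restrict (Ioo 0 T)] v') :
    IsWeakTimeDeriv T v v' := by
  intro η hη
  have e1 : ∫ t in Ioo 0 T, deriv η t • v t = ∫ t in Ioo 0 T, deriv η t • u t := by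
    apply integral_congr_ae
    filter_upwards [hv] with t ht
    rw [ht]
  have e2 : ∫ t in Ioo 0 T, η t • v' t = ∫ t in Ioo 0 T, η t • u' t := by
    apply integral_congr_ae
    filter_upwards [hv'] with t ht
    rw [ht]
  rw [e1, e2, h η hη]

end bochner

/-! ### Cauchy–Schwarz for the energy form, and the norm of $L^2(0,T;X)$. -/

section energy

variable {α : ℝ}

lemma abs_energyInner_le (u v : H01 α) : |energyInner u v| ≤ energyNorm u * energyNorm v := by
  refine abs_le_of_sq_le_sq ?_ (mul_nonneg (energyNorm_nonneg u) (energyNorm_nonneg v))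
  rw [mul_pow, energyNorm_sq, energyNorm_sq, energyInner_eq, energyInner_eq, energyInner_eq]
  simp only [real_inner_self_eq_norm_sq]
  have h1 := abs_le.1 (abs_real_inner_le_norm (dθ u) (dθ v))
  have h2 := abs_le.1 (abs_real_inner_le_norm (wdr u) (wdr v))
  have h3 : |inner ℝ (dθ u) (dθ v) + inner ℝ (wdr u) (wdr v)|
      ≤ ‖dθ u‖ * ‖dθ v‖ + ‖wdr u‖ * ‖wdr v‖ := abs_le.2 ⟨by linarith, by linarith⟩
  calc _ ≤ (‖dθ u‖ * ‖dθ v‖ + ‖wdr u‖ * ‖wdr v‖) ^ 2 := by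
        rw [← sq_abs]
        gcongr
    _ ≤ _ := by nlinarith [sq_nonneg (‖dθ u‖ * ‖wdr v‖ - ‖wdr u‖ * ‖dθ v‖)]

end energy

lemma L2t.norm_sq_eq {T : ℝ} {X : Type*} [NormedAddCommGroup X] [InnerProductSpace ℝ X]
    (f : L2t T X) : ‖f‖ ^ 2 = ∫ t in Ioo 0 T, ‖f t‖ ^ 2 := by
  rw [← real_inner_self_eq_norm_sq, MeasureTheory.L2.inner_def]
  simp only [real_inner_self_eq_norm_sq]

lemma L2t.integrable_norm_sq {T : ℝ} {X : Type*} [NormedAddCommGroup X]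
    (f : L2t T X) : IntegrableOn (fun t => ‖f t‖ ^ 2) (Ioo 0 T) :=
  (Lp.memLp f).integrable_norm_pow (by norm_num)

/-! ### Weak solutions and their coefficients -/

namespace Spec

variable {α : ℝ} (D : Spec α)

/-- The coefficient functional. -/
def coL (a : D.ι × D.κ) : L2 Ω →L[ℝ] ℝ := innerSL ℝ (D.basis a)

lemma coL_apply (a : D.ι × D.κ) (h : L2 Ω) : D.coL a h = D.co h a := rfl

/-- Evaluation of a functional at an eigenfunction. -/
def evL (a : D.ι × D.κ) : Hneg1 α →L[ℝ] ℝ := ContinuousLinearMap.apply ℝ ℝ (D.e a)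

lemma evL_apply (a : D.ι × D.κ) (ℓ : Hneg1 α) : D.evL a ℓ = ℓ (D.e a) := rfl

lemma toHneg1_e (h : L2 Ω) (a : D.ι × D.κ) : (toHneg1 h : Hneg1 α) (D.e a) = D.co h a := by
  rw [toHneg1_apply, val_e, co, real_inner_comm]

lemma co_sub (h k : L2 Ω) (a : D.ι × D.κ) : D.co (h - k) a = D.co h a - D.co k a :=
  map_sub (D.coL a) h k

lemma co_basis [DecidableEq (D.ι × D.κ)] (a a' : D.ι × D.κ) :
    D.co (D.basis a') a = if a = a' then 1 else 0 := by
  rw [← val_e, co_val_e]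

lemma co_of_hasSum {x : D.ι × D.κ → ℝ} {h : L2 Ω} (hh : HasSum (fun a => x a • D.basis a) h)
    (a : D.ι × D.κ) : D.co h a = x a := by
  classical
  have h2 : HasSum (fun a' => (D.coL a) (x a' • D.basis a')) (x a) := by
    convert! hasSum_ite_eq a (x a) using 2 with a'
    rw [map_smul, coL_apply, co_basis, smul_eq_mul]
    by_cases h : a' = a
    · simp [h]
    · simp [h, Ne.symm h]
  exact (hh.mapL (D.coL a)).unique h2

lemma co_val_of_hasSum {x : D.ι × D.κ → ℝ} {u : H01 α} (hu : HasSum (fun a => x a • D.e a) u)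
    (a : D.ι × D.κ) : D.co (val u) a = x a := by
  refine D.co_of_hasSum ?_ a
  simpa only [map_smul, val_e] using hu.mapL val

lemma memLp_co {T : ℝ} (f : L2t T (L2 Ω)) (a : D.ι × D.κ) :
    MemLp (fun t => D.co (f t) a) 2 (volume.restrict (Ioo 0 T)) :=
  (D.coL a).comp_memLp' (Lp.memLp f)

/-- The squared size of the data of a mode. -/
def data {T : ℝ} (φ0 : H01 α) (φ1 : L2 Ω) (f : L2t T (L2 Ω)) (a : D.ι × D.κ) : ℝ :=
  D.co φ1 a ^ 2 + D.lam a * D.co (val φ0) a ^ 2 + ∫ t in Ioo 0 T, D.co (f t) a ^ 2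

lemma data_nonneg {T : ℝ} (φ0 : H01 α) (φ1 : L2 Ω) (f : L2t T (L2 Ω)) (a : D.ι × D.κ) :
    0 ≤ D.data φ0 φ1 f a := by
  have := D.lam_pos a
  have : 0 ≤ ∫ t in Ioo 0 T, D.co (f t) a ^ 2 := integral_nonneg fun _ => sq_nonneg _
  unfold data
  positivity

lemma sum_co_sq_le (h : L2 Ω) (S : Finset (D.ι × D.κ)) : ∑ a ∈ S, D.co h a ^ 2 ≤ ‖h‖ ^ 2 :=
  sum_le_hasSum S (fun _ _ => sq_nonneg _) (D.hasSum_co_sq h)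

lemma sum_integral_co_sq_le {T : ℝ} (f : L2t T (L2 Ω)) (S : Finset (D.ι × D.κ)) :
    ∑ a ∈ S, ∫ t in Ioo 0 T, D.co (f t) a ^ 2 ≤ ‖f‖ ^ 2 := by
  rw [← integral_finsetSum _ fun a _ => (D.memLp_co f a).integrable_sq, L2t.norm_sq_eq]
  exact integral_mono (integrable_finsetSum _ fun a _ => (D.memLp_co f a).integrable_sq)
    (L2t.integrable_norm_sq f) fun t => D.sum_co_sq_le (f t) S

/-- Bessel's inequality for each of the three terms. This makes `data` the summable majorant of the
series of the existence and trace arguments. -/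
lemma sum_data_le {T : ℝ} (φ0 : H01 α) (φ1 : L2 Ω) (f : L2t T (L2 Ω)) (S : Finset (D.ι × D.κ)) :
    ∑ a ∈ S, D.data φ0 φ1 f a ≤ ‖φ1‖ ^ 2 + energyNorm φ0 ^ 2 + ‖f‖ ^ 2 := by
  simp only [data, Finset.sum_add_distrib]
  gcongr
  · exact D.sum_co_sq_le φ1 S
  · exact sum_le_hasSum S (fun a _ => mul_nonneg (D.lam_pos a).le (sq_nonneg _))
      (D.hasSum_energy φ0)
  · exact D.sum_integral_co_sq_le f S

lemma summable_data {T : ℝ} (φ0 : H01 α) (φ1 : L2 Ω) (f : L2t T (L2 Ω)) :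
    Summable (D.data φ0 φ1 f) :=
  summable_of_sum_le (D.data_nonneg φ0 φ1 f) (D.sum_data_le φ0 φ1 f)

/-- `x`, `y` are the coefficients in the eigenbasis of a weak solution `φ` and of `φt`. -/
structure IsCoeff {T : ℝ} (φ0 : H01 α) (φ1 : L2 Ω) (f : L2t T (L2 Ω)) (φ : L2t T (H01 α))
    (φt : L2t T (L2 Ω)) (φtt : L2t T (Hneg1 α)) (x y : D.ι × D.κ → ℝ → ℝ) : Prop where
  osc : ∀ a, Osc T (D.lam a) (fun t => D.co (f t) a) (x a) (y a)
  x_zero : ∀ a, x a 0 = D.co (val φ0) a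
  y_zero : ∀ a, y a 0 = D.co φ1 a
  co_val : ∀ᵐ t ∂(volume.restrict (Ioo 0 T)), ∀ a, D.co (val (φ t)) a = x a t
  co_deriv : ∀ᵐ t ∂(volume.restrict (Ioo 0 T)), ∀ a, D.co (φt t) a = y a t
  deriv_two : ∀ᵐ t ∂(volume.restrict (Ioo 0 T)), φtt t = toHneg1 (f t) - energyDual (φ t)

variable {T : ℝ} {φ0 : H01 α} {φ1 : L2 Ω} {f : L2t T (L2 Ω)} {φ : L2t T (H01 α)}
  {φt : L2t T (L2 Ω)} {φtt : L2t T (Hneg1 α)} {x y : D.ι × D.κ → ℝ → ℝ}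

lemma energyDual_e (u : H01 α) (a : D.ι × D.κ) :
    energyDual u (D.e a) = D.lam a * D.co (val u) a := by
  rw [energyDual_apply, energyInner_e, co]

/-- Testing with eigenfunctions turns the equation into scalar ones. Their weak derivatives are
integrable, so the coefficients have absolutely continuous representatives, which are oscillators.
-/
lemma exists_isCoeff (hT : 0 < T) (h : IsWeakSolution α T φ0 φ1 f φ φt φtt) :
    ∃ x y, D.IsCoeff φ0 φ1 f φ φt φtt x y := by
  have hval : IntegrableOn (fun t => val (φ t)) (Ioo 0 T) :=
    (val : H01 α →L[ℝ] L2 Ω).integrable_comp (L2t.integrableOn φ)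
  have hneg : IntegrableOn (fun t => (toHneg1 (φt t) : Hneg1 α)) (Ioo 0 T) :=
    (toHneg1L : L2 Ω →L[ℝ] Hneg1 α).integrable_comp (L2t.integrableOn φt)
  have hev : ∀ a, ∀ᵐ t ∂(volume.restrict (Ioo 0 T)),
      φtt t (D.e a) = D.co (f t) a - D.lam a * D.co (val (φ t)) a := by
    intro a
    filter_upwards [h.equation (D.e a)] with t ht
    rw [energyInner_e, val_e, real_inner_comm (D.basis a) (f t)] at ht
    simp only [co]
    linarith
  have h1 : ∀ a, ∃ v : ℝ → ℝ, IsPrim T v (fun t => D.co (φt t) a) ∧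
      (fun t => D.co (val (φ t)) a) =ᵐ[volume.restrict (Ioo 0 T)] v := fun a =>
    (h.deriv_one.clm_comp hval (L2t.integrableOn φt) (D.coL a)).exists_isPrim hT
      ((D.coL a).integrable_comp hval) ((D.coL a).integrable_comp (L2t.integrableOn φt))
  have h2 : ∀ a, ∃ v : ℝ → ℝ, IsPrim T v (fun t => φtt t (D.e a)) ∧
      (fun t => (toHneg1 (φt t) : Hneg1 α) (D.e a)) =ᵐ[volume.restrict (Ioo 0 T)] v := fun a =>
    (h.deriv_two.clm_comp hneg (L2t.integrableOn φtt) (D.evL a)).exists_isPrim hT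
      ((D.evL a).integrable_comp hneg) ((D.evL a).integrable_comp (L2t.integrableOn φtt))
  choose x hx hx' using h1
  choose y hy hy' using h2
  simp only [toHneg1_e] at hy'
  refine ⟨x, y, fun a => ⟨(hx a).congr (hy' a) hT.le, (hy a).congr ?_ hT.le⟩, ?_, ?_,
    ae_all_iff.2 hx', ae_all_iff.2 hy', ?_⟩
  · filter_upwards [hev a, hx' a] with t e1 e2
    rw [e1, e2]
  · intro a
    obtain ⟨v, hv, hv', hv0⟩ := h.init_zero
    rw [← hv0, ← coL_apply]
    -- Two continuous functions on $[0,T]$ that agree almost everywhere agree at $0$; this transfers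
    -- the initial value of the vector-valued representative to the coefficient.
    refine eqOn_Icc_of_ae_eq hT ((hx a).continuousOn hT.le)
      ((D.coL a).continuous.comp_continuousOn hv) ?_ ⟨le_rfl, hT.le⟩
    filter_upwards [hx' a, hv'] with t e1 e2
    rw [← e1, Function.comp_apply, e2, coL_apply]
  · intro a
    obtain ⟨v, hv, hv', hv0⟩ := h.init_one
    rw [← toHneg1_e, ← hv0, ← evL_apply]
    refine eqOn_Icc_of_ae_eq hT ((hy a).continuousOn hT.le)
      ((D.evL a).continuous.comp_continuousOn hv) ?_ ⟨le_rfl, hT.le⟩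
    filter_upwards [hy' a, hv'] with t e1 e2
    rw [← e1, Function.comp_apply, e2, evL_apply, toHneg1_e]
  -- The exceptional null set of the weak equation depends on the test vector. Countably many
  -- eigenfunctions have a common one, and they determine a functional.
  · filter_upwards [ae_all_iff.2 hev] with t ht
    refine D.dual_ext fun a => ?_
    rw [ht, sub_apply, toHneg1_e, energyDual_e]

namespace IsCoeff

variable {D}

lemma energy_le (h : D.IsCoeff φ0 φ1 f φ φt φtt x y) (hT : 0 < T) (a : D.ι × D.κ) {t : ℝ}
    (ht : t ∈ Icc 0 T) :
    y a t ^ 2 + D.lam a * x a t ^ 2 ≤ (2 + 4 * T) * D.data φ0 φ1 f a := by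
  have := (h.osc a).energy_le hT (D.lam_pos a).le (D.memLp_co f a) ht
  rwa [h.x_zero, h.y_zero] at this

lemma energyNorm_sq_add_le (h : D.IsCoeff φ0 φ1 f φ φt φtt x y) (hT : 0 < T) :
    ∀ᵐ t ∂(volume.restrict (Ioo 0 T)), energyNorm (φ t) ^ 2 + ‖φt t‖ ^ 2 ≤
      (2 + 4 * T) * (‖φ1‖ ^ 2 + energyNorm φ0 ^ 2 + ‖f‖ ^ 2) := by
  filter_upwards [h.co_val, h.co_deriv, ae_restrict_mem measurableSet_Ioo] with t h1 h2 ht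
  refine hasSum_le_of_sum_le ((D.hasSum_energy (φ t)).add (D.hasSum_co_sq (φt t))) fun S => ?_
  refine le_trans ?_ (mul_le_mul_of_nonneg_left (D.sum_data_le φ0 φ1 f S) (by positivity))
  rw [Finset.mul_sum]
  refine Finset.sum_le_sum fun a _ => ?_
  rw [h1, h2, add_comm]
  exact h.energy_le hT a (Ioo_subset_Icc_self ht)

end IsCoeff

/-- The difference of two coefficients is an oscillator without force and with zero data; the energy
estimate and $\lambda_a>0$ annihilate it. -/
lemma eq_of_isCoeff (hT : 0 < T) {φ' : L2t T (H01 α)} {φt' : L2t T (L2 Ω)}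
    {φtt' : L2t T (Hneg1 α)} {x' y' : D.ι × D.κ → ℝ → ℝ}
    (h : D.IsCoeff φ0 φ1 f φ φt φtt x y) (h' : D.IsCoeff φ0 φ1 f φ' φt' φtt' x' y') : φ = φ' := by
  have key : ∀ a, ∀ t ∈ Icc 0 T, x a t = x' a t := by
    intro a t ht
    have h0 := ((h.osc a).sub (h'.osc a) hT.le)
    simp only [sub_self] at h0
    have := h0.energy_le hT (D.lam_pos a).le (MemLp.zero' (ε := ℝ)) ht
    simp only [h.x_zero, h'.x_zero, h.y_zero, h'.y_zero, sub_self, ne_eq, OfNat.ofNat_ne_zero,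
      not_false_eq_true, zero_pow, mul_zero, integral_zero, add_zero] at this
    have h1 := D.lam_pos a
    have h2 : D.lam a * (x a t - x' a t) ^ 2 ≤ 0 := by nlinarith [sq_nonneg (y a t - y' a t)]
    have h3 : (x a t - x' a t) ^ 2 ≤ 0 := by
      by_contra! hc
      exact absurd h2 (not_le.2 (mul_pos h1 hc))
    exact sub_eq_zero.1 (pow_eq_zero_iff two_ne_zero |>.1 (le_antisymm h3 (sq_nonneg _)))
  refine Lp.ext ?_
  filter_upwards [h.co_val, h'.co_val, ae_restrict_mem measurableSet_Ioo] with t h1 h2 ht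
  refine val_injective (D.ext_co fun a => ?_)
  rw [h1, h2, key a t (Ioo_subset_Icc_self ht)]

lemma isWeakTimeDeriv_of_co {u u' : ℝ → L2 Ω} (hu : IntegrableOn u (Ioo 0 T))
    (hu' : IntegrableOn u' (Ioo 0 T))
    (h : ∀ a, IsWeakTimeDeriv T (fun t => D.co (u t) a) (fun t => D.co (u' t) a)) :
    IsWeakTimeDeriv T u u' := by
  intro η hη
  refine D.ext_co fun a => ?_
  rw [← coL_apply, ← coL_apply, map_neg, clm_integral_smul _ (hη.integrableOn_deriv_smul hu),
    clm_integral_smul _ (hη.integrableOn_smul hu')]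
  exact h a η hη

lemma isWeakTimeDeriv_of_e {u u' : ℝ → Hneg1 α} (hu : IntegrableOn u (Ioo 0 T))
    (hu' : IntegrableOn u' (Ioo 0 T))
    (h : ∀ a, IsWeakTimeDeriv T (fun t => u t (D.e a)) (fun t => u' t (D.e a))) :
    IsWeakTimeDeriv T u u' := by
  intro η hη
  refine D.dual_ext fun a => ?_
  rw [← evL_apply, ← evL_apply, map_neg, clm_integral_smul _ (hη.integrableOn_deriv_smul hu),
    clm_integral_smul _ (hη.integrableOn_smul hu')]
  exact h a η hη

/-- The squared norm of $e_a$ in $H^1_0(\Omega;w)$ is $1+\lambda_a$, whereas the oscillators control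
$\lambda_ax_a^2$; the spectral gap bridges the two. -/
lemma one_add_lam_le (a : D.ι × D.κ) : 1 + D.lam a ≤ (1 + D.m⁻¹) * D.lam a := by
  have h1 := D.m_le_lam a
  have h2 := D.m_pos
  have : 1 ≤ D.m⁻¹ * D.lam a := by
    rw [inv_mul_eq_div, le_div_iff₀ h2]
    linarith
  linarith

/-- Existence of weak solutions. -/
lemma exists_isWeakSolution (D : Spec α) (hT : 0 < T) (φ0 : H01 α) (φ1 : L2 Ω) (f : L2t T (L2 Ω)) :
    ∃ (φ : L2t T (H01 α)) (φt : L2t T (L2 Ω)) (φtt : L2t T (Hneg1 α)),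
      IsWeakSolution α T φ0 φ1 f φ φt φtt := by
  have hex : ∀ a, ∃ x y : ℝ → ℝ, Osc T (D.lam a) (fun t => D.co (f t) a) x y ∧
      x 0 = D.co (val φ0) a ∧ y 0 = D.co φ1 a := fun a =>
    Osc.exists (D.lam_pos a) (intervalIntegrable_of_memLp hT.le (D.memLp_co f a)) hT.le _ _
  choose x y hosc hx0 hy0 using hex
  have hen : ∀ a, ∀ t ∈ Icc 0 T,
      y a t ^ 2 + D.lam a * x a t ^ 2 ≤ (2 + 4 * T) * D.data φ0 φ1 f a := by
    intro a t ht
    have := (hosc a).energy_le hT (D.lam_pos a).le (D.memLp_co f a) ht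
    rwa [hx0, hy0] at this
  have cx : ∀ a, ContinuousOn (x a) (Icc 0 T) := fun a => (hosc a).fst.continuousOn hT.le
  have cy : ∀ a, ContinuousOn (y a) (Icc 0 T) := fun a => (hosc a).snd.continuousOn hT.le
  have hsum := D.summable_data φ0 φ1 f
  have hm : 0 < 1 + D.m⁻¹ := by have := D.m_pos; positivity
  -- The mode energies are bounded uniformly in time by a summable family, so the series for the
  -- solution converges in $C([0,T];H^1_0(\Omega;w))$; the next one, for its derivative, converges
  -- in $C([0,T];L^2(\Omega))$.
  obtain ⟨cu, hu⟩ := continuousOn_tsum_of_norm_sq_sum_le (T := T) (x := fun a t => x a t • D.e a)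
    (m := fun a => (1 + D.m⁻¹) * ((2 + 4 * T) * D.data φ0 φ1 f a))
    (fun a => (cx a).smul continuousOn_const) ((hsum.mul_left _).mul_left _) (by
      intro S t ht
      rw [norm_sq_sum_smul_e]
      refine Finset.sum_le_sum fun a _ => ?_
      calc (1 + D.lam a) * x a t ^ 2 ≤ (1 + D.m⁻¹) * D.lam a * x a t ^ 2 := by
            gcongr
            exact D.one_add_lam_le a
        _ ≤ _ := by
            rw [mul_assoc]
            refine mul_le_mul_of_nonneg_left ?_ hm.le
            linarith [hen a t ht, sq_nonneg (y a t)])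
  obtain ⟨cw, hw⟩ := continuousOn_tsum_of_norm_sq_sum_le (T := T)
    (x := fun a t => y a t • D.basis a) (m := fun a => (2 + 4 * T) * D.data φ0 φ1 f a)
    (fun a => (cy a).smul continuousOn_const) (hsum.mul_left _) (by
      intro S t ht
      rw [norm_sq_sum_smul_basis]
      refine Finset.sum_le_sum fun a _ => ?_
      have := hen a t ht
      have := D.lam_pos a
      nlinarith [sq_nonneg (x a t), mul_nonneg this.le (sq_nonneg (x a t))])
  set u : ℝ → H01 α := fun t => ∑' a, x a t • D.e a
  set w : ℝ → L2 Ω := fun t => ∑' a, y a t • D.basis a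
  have hcu : ∀ t ∈ Icc 0 T, ∀ a, D.co (val (u t)) a = x a t := fun t ht =>
    D.co_val_of_hasSum (hu t ht)
  have hcw : ∀ t ∈ Icc 0 T, ∀ a, D.co (w t) a = y a t := fun t ht => D.co_of_hasSum (hw t ht)
  set φ : L2t T (H01 α) := (memLp_two_of_continuousOn cu).toLp
  set φt : L2t T (L2 Ω) := (memLp_two_of_continuousOn cw).toLp
  have hφ : (φ : ℝ → H01 α) =ᵐ[volume.restrict (Ioo 0 T)] u := MemLp.coeFn_toLp _
  have hφt : (φt : ℝ → L2 Ω) =ᵐ[volume.restrict (Ioo 0 T)] w := MemLp.coeFn_toLp _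
  -- The second derivative is defined by the equation; that it is the weak derivative of
  -- $\partial_t\varphi$ is then checked on eigenfunctions.
  set φtt : L2t T (Hneg1 α) := (toHneg1L : L2 Ω →L[ℝ] Hneg1 α).compLp f
    - (energyDual : H01 α →L[ℝ] Hneg1 α).compLp φ with hφttd
  have hφtt : ∀ᵐ t ∂(volume.restrict (Ioo 0 T)), φtt t = toHneg1 (f t) - energyDual (φ t) := by
    filter_upwards [Lp.coeFn_sub ((toHneg1L : L2 Ω →L[ℝ] Hneg1 α).compLp f)
      ((energyDual : H01 α →L[ℝ] Hneg1 α).compLp φ),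
      (toHneg1L : L2 Ω →L[ℝ] Hneg1 α).coeFn_compLp f,
      (energyDual : H01 α →L[ℝ] Hneg1 α).coeFn_compLp φ] with t e1 e2 e3
    rw [hφttd, e1, Pi.sub_apply, e2, e3, toHneg1L_apply]
  have hcφ : ∀ᵐ t ∂(volume.restrict (Ioo 0 T)), ∀ a, D.co (val (φ t)) a = x a t := by
    filter_upwards [hφ, ae_restrict_mem measurableSet_Ioo] with t e ht a
    rw [e, hcu t (Ioo_subset_Icc_self ht)]
  have hcφt : ∀ᵐ t ∂(volume.restrict (Ioo 0 T)), ∀ a, D.co (φt t) a = y a t := by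
    filter_upwards [hφt, ae_restrict_mem measurableSet_Ioo] with t e ht a
    rw [e, hcw t (Ioo_subset_Icc_self ht)]
  have hval : IntegrableOn (fun t => val (φ t)) (Ioo 0 T) :=
    (val : H01 α →L[ℝ] L2 Ω).integrable_comp (L2t.integrableOn φ)
  have hneg : IntegrableOn (fun t => (toHneg1 (φt t) : Hneg1 α)) (Ioo 0 T) :=
    (toHneg1L : L2 Ω →L[ℝ] Hneg1 α).integrable_comp (L2t.integrableOn φt)
  refine ⟨φ, φt, φtt, ?_, ?_, ?_, ?_, ?_⟩
  · refine D.isWeakTimeDeriv_of_co hval (L2t.integrableOn φt) fun a => ?_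
    refine ((hosc a).fst.isWeakTimeDeriv hT).congr ?_ ?_
    · filter_upwards [hcφ] with t e
      rw [e]
    · filter_upwards [hcφt] with t e
      rw [e]
  · refine D.isWeakTimeDeriv_of_e hneg (L2t.integrableOn φtt) fun a => ?_
    refine ((hosc a).snd.isWeakTimeDeriv hT).congr ?_ ?_
    · filter_upwards [hcφt] with t e
      rw [toHneg1_e, e]
    · filter_upwards [hcφ, hφtt] with t e e'
      rw [e', sub_apply, toHneg1_e, energyDual_e, e]
  · intro v
    filter_upwards [hφtt] with t e
    rw [e, sub_apply, toHneg1_apply, energyDual_apply]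
    ring
  · refine ⟨fun t => val (u t), val.continuous.comp_continuousOn cu, ?_, ?_⟩
    · filter_upwards [hφ] with t e
      rw [e]
    · refine D.ext_co fun a => ?_
      rw [hcu 0 ⟨le_rfl, hT.le⟩, hx0]
  · refine ⟨fun t => toHneg1L (w t), toHneg1L.continuous.comp_continuousOn cw, ?_, ?_⟩
    · filter_upwards [hφt] with t e
      rw [e, toHneg1L_apply]
    · refine (toHneg1L_apply _).trans ?_
      congr 1
      refine D.ext_co fun a => ?_
      rw [hcw 0 ⟨le_rfl, hT.le⟩, hy0]

/-! ### The estimate of the second time derivative -/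

/-- On the unit ball of the energy norm the Poincaré inequality bounds the $L^2$ norm by $m^{-1/2}$.
-/
lemma hneg1Norm_le (u : H01 α) (h : L2 Ω) :
    hneg1Norm (toHneg1 h - energyDual u : Hneg1 α) ≤
      ENNReal.ofReal (Real.sqrt D.m⁻¹ * ‖h‖ + energyNorm u) := by
  refine iSup₂_le fun v hv => ?_
  rw [← ofReal_norm]
  refine ENNReal.ofReal_le_ofReal ?_
  rw [sub_apply, toHneg1_apply, energyDual_apply, Real.norm_eq_abs]
  have h1 : ‖val v‖ ≤ Real.sqrt D.m⁻¹ := by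
    refine Real.le_sqrt_of_sq_le ?_
    have h2 := D.poincare v
    have h3 : energyNorm v ^ 2 ≤ 1 := pow_le_one₀ (energyNorm_nonneg v) hv
    rw [← one_div, le_div_iff₀ D.m_pos]
    linarith
  have h2 := abs_real_inner_le_norm h (val v)
  have h3 := abs_energyInner_le u v
  have h4 : ‖h‖ * ‖val v‖ ≤ Real.sqrt D.m⁻¹ * ‖h‖ := by
    rw [mul_comm]
    exact mul_le_mul_of_nonneg_right h1 (norm_nonneg _)
  have h5 : energyNorm u * energyNorm v ≤ energyNorm u :=
    mul_le_of_le_one_right (energyNorm_nonneg u) hv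
  exact (abs_sub _ _).trans (by linarith)

/-- The energy estimate. -/
lemma energy_estimate (hT : 0 < T) (h : D.IsCoeff φ0 φ1 f φ φt φtt x y) :
    essSup (fun t => ENNReal.ofReal (energyNorm (φ t)) + ‖φt t‖ₑ) (volume.restrict (Ioo 0 T))
        + (∫⁻ t in Ioo 0 T, hneg1Norm (φtt t) ^ 2) ^ (1 / 2 : ℝ) ≤
      ENNReal.ofReal ((2 * Real.sqrt (2 + 4 * T) + Real.sqrt (2 * D.m⁻¹ + 2 * T * (2 + 4 * T)))
        * (energyNorm φ0 + ‖φ1‖ + ‖f‖)) := by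
  set N := energyNorm φ0 + ‖φ1‖ + ‖f‖ with hN
  have n1 := energyNorm_nonneg φ0
  have n2 := norm_nonneg φ1
  have n3 := norm_nonneg f
  have hN0 : 0 ≤ N := by positivity
  have hNsq : ‖φ1‖ ^ 2 + energyNorm φ0 ^ 2 + ‖f‖ ^ 2 ≤ N ^ 2 := by
    rw [hN]
    nlinarith [mul_nonneg n1 n2, mul_nonneg n1 n3, mul_nonneg n2 n3]
  have hmain : ∀ᵐ t ∂(volume.restrict (Ioo 0 T)),
      energyNorm (φ t) ^ 2 + ‖φt t‖ ^ 2 ≤ (2 + 4 * T) * N ^ 2 := by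
    filter_upwards [h.energyNorm_sq_add_le hT] with t ht
    exact ht.trans (by gcongr)
  rw [add_mul, ENNReal.ofReal_add (by positivity) (by positivity)]
  refine add_le_add ?_ ?_
  · refine essSup_le_of_ae_le _ ?_
    filter_upwards [hmain] with t ht
    rw [← ofReal_norm, ← ENNReal.ofReal_add (energyNorm_nonneg _) (norm_nonneg _)]
    refine ENNReal.ofReal_le_ofReal ?_
    have e : Real.sqrt (2 + 4 * T) * N = Real.sqrt ((2 + 4 * T) * N ^ 2) := by
      rw [Real.sqrt_mul (by positivity), Real.sqrt_sq hN0]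
    have h1 : energyNorm (φ t) ≤ Real.sqrt (2 + 4 * T) * N := by
      rw [e]
      exact Real.le_sqrt_of_sq_le (by nlinarith [sq_nonneg ‖φt t‖])
    have h2 : ‖φt t‖ ≤ Real.sqrt (2 + 4 * T) * N := by
      rw [e]
      exact Real.le_sqrt_of_sq_le (by nlinarith [sq_nonneg (energyNorm (φ t))])
    linarith
  · have hf := L2t.integrable_norm_sq f
    have ic : IntegrableOn (fun _ : ℝ => 2 * ((2 + 4 * T) * N ^ 2)) (Ioo 0 T) :=
      integrableOn_const (by simp)
    have hm := D.m_pos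
    -- By $(p+q)^2\le2p^2+2q^2$ the force contributes $2m^{-1}\|f\|^2$, and the energy, bounded
    -- uniformly in time, contributes its bound times $2T$.
    have hle : ∫⁻ t in Ioo 0 T, hneg1Norm (φtt t) ^ 2 ≤
        ENNReal.ofReal ((2 * D.m⁻¹ + 2 * T * (2 + 4 * T)) * N ^ 2) := by
      calc ∫⁻ t in Ioo 0 T, hneg1Norm (φtt t) ^ 2
          ≤ ∫⁻ t in Ioo 0 T, ENNReal.ofReal (2 * D.m⁻¹ * ‖f t‖ ^ 2 + 2 * ((2 + 4 * T) * N ^ 2)) := by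
            refine lintegral_mono_ae ?_
            filter_upwards [hmain, h.deriv_two] with t h1 h2
            rw [h2]
            refine (pow_le_pow_left' (D.hneg1Norm_le (φ t) (f t)) 2).trans ?_
            rw [← ENNReal.ofReal_pow (add_nonneg (by positivity) (energyNorm_nonneg _))]
            refine ENNReal.ofReal_le_ofReal ?_
            have e : (Real.sqrt D.m⁻¹ * ‖f t‖) ^ 2 = D.m⁻¹ * ‖f t‖ ^ 2 := by
              rw [mul_pow, Real.sq_sqrt (by positivity)]
            nlinarith [sq_nonneg (Real.sqrt D.m⁻¹ * ‖f t‖ - energyNorm (φ t)), sq_nonneg ‖φt t‖]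
        _ = ENNReal.ofReal (∫ t in Ioo 0 T, (2 * D.m⁻¹ * ‖f t‖ ^ 2 + 2 * ((2 + 4 * T) * N ^ 2))) :=
            (ofReal_integral_eq_lintegral_ofReal ((hf.const_mul _).add ic)
              (Eventually.of_forall fun t =>
              (by positivity : (0 : ℝ) ≤ 2 * D.m⁻¹ * ‖f t‖ ^ 2 + 2 * ((2 + 4 * T) * N ^ 2)))).symm
        _ ≤ _ := by
            refine ENNReal.ofReal_le_ofReal ?_
            rw [integral_add (hf.const_mul _) ic, integral_const_mul, ← L2t.norm_sq_eq]
            simp only [integral_const, MeasurableSet.univ, measureReal_restrict_apply, univ_inter,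
              Real.volume_real_Ioo, sub_zero, max_eq_left hT.le, smul_eq_mul]
            have h4 : D.m⁻¹ * ‖f‖ ^ 2 ≤ D.m⁻¹ * N ^ 2 := by
              gcongr
              nlinarith [sq_nonneg ‖φ1‖, sq_nonneg (energyNorm φ0)]
            nlinarith
    refine (ENNReal.rpow_le_rpow hle (by norm_num)).trans ?_
    rw [ENNReal.ofReal_rpow_of_nonneg (by positivity) (by norm_num), ← Real.sqrt_eq_rpow,
      Real.sqrt_mul (by positivity), Real.sqrt_sq hN0]

end Spec

/-! ### Slices of functions on the side -/

section slice

variable {T : ℝ} {χ : ℝ × ℝ → ℝ}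

/-- The slice `χ(·,t)`. -/
def slice (hχ : Continuous χ) (t : ℝ) : L2Top :=
  (memLp_of_continuousOn (f := fun θ => χ (θ, t)) (by fun_prop)).toLp

lemma slice_coe (hχ : Continuous χ) (t : ℝ) :
    (slice hχ t : ℝ → ℝ) =ᵐ[volume.restrict (Ioo (0 : ℝ) 1)] fun θ => χ (θ, t) :=
  MemLp.coeFn_toLp _

lemma norm_slice_sq_le (hχ : Continuous χ) {M : ℝ} (hM : ∀ z, |χ z| ≤ M) (t : ℝ) :
    ‖slice hχ t‖ ^ 2 ≤ M ^ 2 := by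
  refine norm_sq_le_of_ae ?_
  filter_upwards [slice_coe hχ t] with θ h
  rw [h]
  exact sq_le_sq' (abs_le.1 (hM _)).1 (abs_le.1 (hM _)).2

lemma continuous_slice (hχ : Continuous χ) (hc : HasCompactSupport χ) :
    Continuous (slice hχ) := by
  rw [Metric.continuous_iff]
  intro t ε hε
  obtain ⟨δ, hδ, h⟩ := Metric.uniformContinuous_iff.1 (hc.uniformContinuous_of_continuous hχ)
    (ε / 2) (by positivity)
  refine ⟨δ, hδ, fun s hs => ?_⟩
  rw [dist_eq_norm]
  have : ‖slice hχ s - slice hχ t‖ ^ 2 ≤ (ε / 2) ^ 2 := by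
    refine norm_sq_le_of_ae ?_
    filter_upwards [Lp.coeFn_sub (slice hχ s) (slice hχ t), slice_coe hχ s, slice_coe hχ t]
      with θ h1 h2 h3
    rw [h1, Pi.sub_apply, h2, h3]
    have h4 := h (a := (θ, s)) (b := (θ, t)) (by
      rw [Prod.dist_eq, dist_self]; exact max_lt hδ hs)
    rw [Real.dist_eq] at h4
    have := abs_le.1 h4.le
    exact sq_le_sq' this.1 this.2
  have := abs_le_of_sq_le_sq this (by positivity)
  linarith [le_abs_self ‖slice hχ s - slice hχ t‖]

lemma IsTest.exists_abs_le {U : Set (ℝ × ℝ)} (hχ : IsTest U χ) : ∃ M, ∀ z, |χ z| ≤ M :=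
  hχ.1.continuous.bounded_above_of_compact_support hχ.2.1

lemma inner_slice {v : L2Top} {V : ℝ → ℝ} (hV : v =ᵐ[volume.restrict (Ioo (0 : ℝ) 1)] V)
    (hχ : Continuous χ) (t : ℝ) :
    inner ℝ v (slice hχ t) = ∫ θ in Ioo (0 : ℝ) 1, V θ * χ (θ, t) := by
  rw [L2Top.inner_eq]
  apply integral_congr_ae
  filter_upwards [hV, slice_coe hχ t] with θ h1 h2
  rw [h1, h2]

/-- Differentiation under the integral sign. The second coordinate of χ is time here, so `er` is the
time direction. -/
lemma hasDerivAt_inner_slice {U : Set (ℝ × ℝ)} (hχ : IsTest U χ) {v : L2Top} {V : ℝ → ℝ}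
    (hV : v =ᵐ[volume.restrict (Ioo (0 : ℝ) 1)] V) (cV : Continuous V) (t : ℝ) :
    HasDerivAt (fun t => inner ℝ v (slice hχ.1.continuous t))
      (inner ℝ v (slice (hχ.fderiv_apply er).1.continuous t)) t := by
  simp only [inner_slice hV]
  obtain ⟨M, hM⟩ := (hχ.fderiv_apply er).exists_abs_le
  have c1 := hχ.1.continuous
  have c2 := (hχ.fderiv_apply er).1.continuous
  have ci : ∀ {g : ℝ → ℝ}, Continuous g → Integrable g (volume.restrict (Ioo (0 : ℝ) 1)) :=
    fun hg => (hg.integrableOn_Icc (a := 0) (b := 1)).mono_set Ioo_subset_Icc_self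
  refine (hasDerivAt_integral_of_dominated_loc_of_deriv_le (s := univ)
    (F := fun s θ => V θ * χ (θ, s)) (F' := fun s θ => V θ * fderiv ℝ χ (θ, s) er)
    (bound := fun θ => |V θ| * M) univ_mem (Eventually.of_forall fun s => ?_) ?_ ?_
    (Eventually.of_forall fun θ s _ => ?_) ?_ (Eventually.of_forall fun θ s _ => ?_)).2
  · exact Continuous.aestronglyMeasurable (by fun_prop)
  · exact ci (by fun_prop)
  · exact Continuous.aestronglyMeasurable (by fun_prop)
  · rw [norm_mul]
    exact mul_le_mul_of_nonneg_left (hM _) (norm_nonneg _)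
  · exact ci (by fun_prop)
  · have h1 : HasFDerivAt χ (fderiv ℝ χ (θ, s)) (θ, s) :=
      (hχ.1.differentiable (by simp) (θ, s)).hasFDerivAt
    have h2 : HasDerivAt (fun s : ℝ => (θ, s)) er s := (hasDerivAt_const s θ).prodMk (hasDerivAt_id s)
    exact (h1.comp_hasDerivAt s h2).const_mul (V θ)

lemma IsTest.inner_slice_eq_zero {A : Set ℝ} (hχ : IsTest (A ×ˢ Ioo 0 T) χ) (v : L2Top) {t : ℝ}
    (ht : t ∉ Ioo 0 T) : inner ℝ v (slice hχ.1.continuous t) = 0 := by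
  have : slice hχ.1.continuous t = 0 := by
    refine Lp.ext ?_
    filter_upwards [slice_coe hχ.1.continuous t, Lp.coeFn_zero ℝ 2 (volume.restrict (Ioo (0 : ℝ) 1))]
      with θ h1 h2
    rw [h1, h2, Pi.zero_apply]
    exact hχ.eq_zero fun h => ht h.2
  rw [this, inner_zero_right]

end slice

/-- Testing an oscillator with a function vanishing at both ends. -/
lemma Osc.lam_mul_integral {T lam : ℝ} (hT : 0 < T) {f C D ξ ξ' ξ'' : ℝ → ℝ} (h : Osc T lam f C D)
    (hf : MemLp f 2 (volume.restrict (Ioo 0 T))) (h1 : ∀ t, HasDerivAt ξ (ξ' t) t)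
    (h2 : ∀ t, HasDerivAt ξ' (ξ'' t) t) (c : Continuous ξ'') (a0 : ξ 0 = 0) (aT : ξ T = 0)
    (b0 : ξ' 0 = 0) (bT : ξ' T = 0) :
    lam * ∫ t in Ioo 0 T, C t * ξ t = (∫ t in Ioo 0 T, f t * ξ t) - ∫ t in Ioo 0 T, C t * ξ'' t := by
  have cξ : Continuous ξ := continuous_iff_continuousAt.2 fun t => (h1 t).continuousAt
  have cξ' : Continuous ξ' := continuous_iff_continuousAt.2 fun t => (h2 t).continuousAt
  have cC := h.fst.continuousOn hT.le
  -- The derivative of $D\xi-C\xi'$ is integrated over $(0,T)$: the products $D\xi'$ cancel, and the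
  -- vanishing end values of ξ and $\xi'$ remove the boundary terms.
  have e := ((h.snd.mul hT.le (isPrim_of_hasDerivAt h1 cξ')).add
    ((h.fst.mul hT.le (isPrim_of_hasDerivAt h2 c)).const_mul (-1))).eq T ⟨hT.le, le_rfl⟩
  simp only [a0, aT, b0, bT, mul_zero, add_zero, zero_add] at e
  rw [← setIntegral_Ioo_eq hT.le] at e
  have i1 : IntegrableOn (fun t => f t * ξ t) (Ioo 0 T) :=
    hf.integrable_mul (memLp_two_of_continuousOn cξ.continuousOn)
  have i2 : IntegrableOn (fun t => C t * ξ t) (Ioo 0 T) :=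
    (cC.mul cξ.continuousOn).integrableOn_Icc.mono_set Ioo_subset_Icc_self
  have i3 : IntegrableOn (fun t => C t * ξ'' t) (Ioo 0 T) :=
    (cC.mul c.continuousOn).integrableOn_Icc.mono_set Ioo_subset_Icc_self
  have e2 : ∫ t in Ioo 0 T, ((f t - lam * C t) * ξ t + D t * ξ' t
      + -1 * (D t * ξ' t + C t * ξ'' t)) =
      ∫ t in Ioo 0 T, ((f t * ξ t - C t * ξ'' t) - lam * (C t * ξ t)) := by
    congr 1
    funext t
    ring
  have e4 : ∫ t in Ioo 0 T, ((f t * ξ t - C t * ξ'' t) - lam * (C t * ξ t)) =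
      (∫ t in Ioo 0 T, (f t * ξ t - C t * ξ'' t)) - ∫ t in Ioo 0 T, lam * (C t * ξ t) :=
    integral_sub (i1.sub i3) (i2.const_mul lam)
  rw [e2, e4, integral_const_mul] at e
  have e3 : ∫ t in Ioo 0 T, (f t * ξ t - C t * ξ'' t)
      = (∫ t in Ioo 0 T, f t * ξ t) - ∫ t in Ioo 0 T, C t * ξ'' t := integral_sub i1 i3
  linarith

/-- The weighted radial derivative, as a bounded operator. -/
def wdrL {α : ℝ} : H01 α →L[ℝ] L2 Ω :=
  (PiLp.proj 2 (fun _ : Fin 3 => L2 Ω) 2).comp ((H1w α).subtypeL.comp incl)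

lemma wdrL_apply {α : ℝ} (u : H01 α) : wdrL u = wdr u := rfl

lemma norm_wdr_le {α : ℝ} (u : H01 α) : ‖wdr u‖ ≤ ‖u‖ := by
  refine abs_le_of_sq_le_sq' ?_ (norm_nonneg u) |>.2
  rw [H01.norm_sq_eq, energyInner_eq, real_inner_self_eq_norm_sq, real_inner_self_eq_norm_sq]
  nlinarith [sq_nonneg ‖val u‖, sq_nonneg ‖dθ u‖]

lemma norm_tens (f g : L2Top) : ‖tens f g‖ = ‖f‖ * ‖g‖ := by
  have h := inner_tens f g f g
  simp only [real_inner_self_eq_norm_sq] at h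
  rw [← mul_pow] at h
  exact (pow_left_inj₀ (norm_nonneg _) (by positivity) two_ne_zero).1 h

namespace Spec

variable {α : ℝ} (D : Spec α)

/-! ### The radial averages near the side `r = 1` -/

/-- The average of `W_j'` over `(1-h,1)` for `0 < h ≤ 1/2`, and `W_j'(1)` for `h = 0`. -/
def avg (j : D.κ) (h : ℝ) : ℝ :=
  ∫ s in (0 : ℝ)..1, (max (1 - h * s) (1 / 2)) ^ (-α) * D.F j (1 - h * s)

lemma continuous_cutoff_rpow (s : ℝ) : Continuous fun r : ℝ => (max r (1 / 2)) ^ s :=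
  (continuous_id.max continuous_const).rpow_const fun r =>
    Or.inl (lt_of_lt_of_le (by norm_num) (le_max_right r (1 / 2))).ne'

/-- The substitution $r=1-hs$ has put the average over a fixed interval, so that it extends
continuously to $h=0$. The cutoff at $1/2$ is inactive for $0\le h\le1/2$ and removes the
singularity of $r^{-\alpha}$ for other $h$. -/
lemma continuous_avg (j : D.κ) : Continuous (D.avg j) := by
  have c1 := D.F_cont j
  have c2 := continuous_cutoff_rpow (-α)
  refine intervalIntegral.continuous_parametric_intervalIntegral_of_continuous' ?_ 0 1
  have c3 : Continuous fun p : ℝ × ℝ => 1 - p.1 * p.2 := by fun_prop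
  exact (c2.comp c3).mul (c1.comp c3)

lemma avg_zero (j : D.κ) : D.avg j 0 = D.F j 1 := by
  have : max (1 : ℝ) (1 / 2) = 1 := by norm_num
  simp [avg]
  rw [show max (1 : ℝ) 2⁻¹ = 1 by norm_num, Real.one_rpow, one_mul]

lemma mul_avg (j : D.κ) {h : ℝ} (h0 : 0 < h) (h1 : h ≤ 1 / 2) :
    h * D.avg j h = ∫ r in (1 - h)..1, r ^ (-α) * D.F j r := by
  have e := intervalIntegral.integral_comp_sub_mul (a := 0) (b := 1)
    (fun r : ℝ => (max r (1 / 2)) ^ (-α) * D.F j r) h0.ne' 1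
  rw [avg, e, smul_eq_mul, mul_inv_cancel_left₀ h0.ne', mul_one, mul_zero, sub_zero]
  refine intervalIntegral.integral_congr fun r hr => ?_
  rw [uIcc_of_le (by linarith)] at hr
  rw [max_eq_left (by linarith [hr.1])]

lemma norm_sq_sum_c (S : Finset D.κ) (x : D.κ → ℝ) :
    ‖∑ j ∈ S, x j • D.c j‖ ^ 2 = ∑ j ∈ S, x j ^ 2 := by
  rw [← real_inner_self_eq_norm_sq, D.c.orthonormal.inner_sum]
  simp [sq]

lemma norm_sq_sum_b (S : Finset D.ι) (x : D.ι → ℝ) :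
    ‖∑ i ∈ S, x i • D.b i‖ ^ 2 = ∑ i ∈ S, x i ^ 2 := by
  rw [← real_inner_self_eq_norm_sq, D.b.orthonormal.inner_sum]
  simp [sq]

lemma sum_c_coe (S : Finset D.κ) (x : D.κ → ℝ) :
    ((∑ j ∈ S, x j • D.c j : L2Top) : ℝ → ℝ) =ᵐ[volume.restrict (Ioo (0 : ℝ) 1)]
      fun r => ∑ j ∈ S, x j * D.W j r := by
  have h1 : ∀ᵐ r ∂(volume.restrict (Ioo (0 : ℝ) 1)), ∀ j, (x j • D.c j : L2Top) r = x j * D.W j r := by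
    rw [ae_all_iff]
    intro j
    filter_upwards [Lp.coeFn_smul (x j) (D.c j), D.c_coe j] with r e1 e2
    rw [e1, Pi.smul_apply, e2, smul_eq_mul]
  filter_upwards [Lp.coeFn_finsetSum S fun j => x j • D.c j, h1] with r e1 e2
  rw [e1, Finset.sum_apply]
  exact Finset.sum_congr rfl fun j _ => e2 j

/-- The flux of a combination of radial modes is bounded by its second-order part. -/
lemma sq_sum_F_le (S : Finset D.κ) (x : D.κ → ℝ) {r : ℝ} (hr : r ∈ Icc (0 : ℝ) 1) :
    (∑ j ∈ S, x j * D.F j r) ^ 2 ≤ ∑ j ∈ S, D.μ j ^ 2 * x j ^ 2 := by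
  have cW : Continuous fun r => ∑ j ∈ S, x j * D.W j r :=
    continuous_finsetSum _ fun j _ => continuous_const.mul (D.W_cont j)
  -- Rolle's theorem: the combination vanishes at both ends, so its derivative, and hence its flux,
  -- vanishes at an interior point.
  obtain ⟨c, hc, hc0⟩ := exists_hasDerivAt_eq_zero (f := fun r => ∑ j ∈ S, x j * D.W j r)
    (f' := fun r => ∑ j ∈ S, x j * (r ^ (-α) * D.F j r)) (a := 0) (b := 1) zero_lt_one
    cW.continuousOn (by simp [(D.moder _).zero, (D.moder _).one])
    (fun r hr => HasDerivAt.fun_sum fun j _ => ((D.moder j).hasDerivAt r hr).const_mul (x j))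
  have hc1 : ∑ j ∈ S, x j * D.F j c = 0 := by
    have : c ^ (-α) * ∑ j ∈ S, x j * D.F j c = 0 := by
      rw [← hc0, Finset.mul_sum]
      exact Finset.sum_congr rfl fun j _ => by ring
    exact (mul_eq_zero.1 this).resolve_left (Real.rpow_pos_of_pos hc.1 _).ne'
  set g : ℝ → ℝ := fun r => ∑ j ∈ S, (D.μ j * x j) * D.W j r with hg
  have cg : Continuous g := continuous_finsetSum _ fun j _ => continuous_const.mul (D.W_cont j)
  -- From that zero the flux is integrated; its derivative is $-g$, whose $L^2$ norm squared is the
  -- right-hand side by orthonormality.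
  have e1 : ∑ j ∈ S, x j * D.F j r = - ∫ s in c..r, g s := by
    rw [← intervalIntegral.integral_neg]
    have := intervalIntegral.integral_eq_sub_of_hasDerivAt (a := c) (b := r)
      (f := fun r => ∑ j ∈ S, x j * D.F j r) (f' := fun r => -g r) (fun s _ => by
        have := HasDerivAt.fun_sum (u := S) fun j _ => ((D.moder j).flux s).const_mul (x j)
        convert! this using 1
        rw [hg, ← Finset.sum_neg_distrib]
        exact Finset.sum_congr rfl fun j _ => by ring) (cg.neg.intervalIntegrable _ _)
    rw [this, hc1, sub_zero]
  have e2 : |∫ s in c..r, g s| ≤ ∫ s in Ioo (0 : ℝ) 1, |g s| := by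
    refine (intervalIntegral.norm_integral_le_integral_norm_uIoc (f := g)).trans ?_
    rw [← integral_Ioc_eq_integral_Ioo]
    refine setIntegral_mono_set ?_ (Eventually.of_forall fun _ => abs_nonneg _)
      (LE.le.eventuallyLE fun s hs => ?_)
    · exact cg.abs.integrableOn_Ioc
    · exact ⟨lt_of_le_of_lt (le_min hc.1.le hr.1) hs.1, hs.2.trans (max_le hc.2.le hr.2)⟩
  have e3 := sq_integral_mul_le (μ := volume.restrict (Ioo (0 : ℝ) 1)) (f := fun s => |g s|)
    (g := fun _ => 1) (memLp_of_continuousOn cg.abs.continuousOn)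
    (memLp_of_continuousOn continuousOn_const)
  have e4 : ∫ s in Ioo (0 : ℝ) 1, |g s| ^ 2 = ∑ j ∈ S, D.μ j ^ 2 * x j ^ 2 := by
    have : ∑ j ∈ S, D.μ j ^ 2 * x j ^ 2 = ∑ j ∈ S, (D.μ j * x j) ^ 2 :=
      Finset.sum_congr rfl fun j _ => by ring
    rw [this, ← norm_sq_sum_c, ← real_inner_self_eq_norm_sq, L2Top.inner_eq]
    apply integral_congr_ae
    filter_upwards [D.sum_c_coe S fun j => D.μ j * x j] with s h
    rw [h, sq_abs, sq]
  simp only [mul_one, one_pow, e4, integral_const, MeasurableSet.univ, measureReal_restrict_apply,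
    univ_inter, Real.volume_real_Ioo, sub_zero, smul_eq_mul] at e3
  rw [max_eq_left zero_le_one, mul_one] at e3
  rw [e1, neg_sq, ← sq_abs]
  exact (pow_le_pow_left₀ (abs_nonneg _) e2 2).trans e3

/-- The average of $r^{-\alpha}$ times the flux over a layer where $r\ge1/2$; there
$r^{-\alpha}\le2^\alpha\le2$, whence the factor $4$. The bound is uniform down to $h=0$. -/
lemma sq_sum_avg_le (S : Finset D.κ) (x : D.κ → ℝ) {h : ℝ} (hh : h ∈ Icc (0 : ℝ) (1 / 2)) :
    (∑ j ∈ S, x j * D.avg j h) ^ 2 ≤ 4 * ∑ j ∈ S, D.μ j ^ 2 * x j ^ 2 := by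
  set K := ∑ j ∈ S, D.μ j ^ 2 * x j ^ 2 with hK
  have hK0 : 0 ≤ K := Finset.sum_nonneg fun j _ => by positivity
  have c1 : ∀ j, Continuous fun s => (max (1 - h * s) (1 / 2)) ^ (-α) * D.F j (1 - h * s) := by
    intro j
    have c3 : Continuous fun s : ℝ => 1 - h * s := by fun_prop
    exact ((continuous_cutoff_rpow (-α)).comp c3).mul ((D.F_cont j).comp c3)
  have e : ∑ j ∈ S, x j * D.avg j h = ∫ s in (0 : ℝ)..1,
      (max (1 - h * s) (1 / 2)) ^ (-α) * ∑ j ∈ S, x j * D.F j (1 - h * s) := by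
    simp only [avg, ← intervalIntegral.integral_const_mul]
    rw [← intervalIntegral.integral_finsetSum fun j _ =>
      ((c1 j).const_mul (x j)).intervalIntegrable _ _]
    congr 1
    funext s
    rw [Finset.mul_sum]
    exact Finset.sum_congr rfl fun j _ => by ring
  have hb : ‖∫ s in (0 : ℝ)..1, (max (1 - h * s) (1 / 2)) ^ (-α)
      * ∑ j ∈ S, x j * D.F j (1 - h * s)‖ ≤ (2 * Real.sqrt K) * |(1 : ℝ) - 0| := by
    refine intervalIntegral.norm_integral_le_of_norm_le_const fun s hs => ?_
    rw [uIoc_of_le zero_le_one] at hs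
    have h1 : 1 - h * s ∈ Icc (0 : ℝ) 1 := by
      constructor
      · nlinarith [hh.1, hh.2, hs.1, hs.2]
      · nlinarith [hh.1, hh.2, hs.1, hs.2]
    have h2 : |∑ j ∈ S, x j * D.F j (1 - h * s)| ≤ Real.sqrt K :=
      Real.abs_le_sqrt (D.sq_sum_F_le S x h1)
    set m := max (1 - h * s) (1 / 2)
    have hm : 1 / 2 ≤ m := le_max_right _ _
    have h3 : m ^ (-α) ≤ 2 := by
      calc m ^ (-α) ≤ (1 / 2 : ℝ) ^ (-α) :=
            Real.rpow_le_rpow_of_nonpos (by norm_num) hm (by linarith [D.α_pos])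
        _ = 2 ^ α := by
            rw [Real.rpow_neg (by norm_num), ← Real.inv_rpow (by norm_num)]
            norm_num
        _ ≤ 2 ^ (1 : ℝ) := Real.rpow_le_rpow_of_exponent_le (by norm_num) D.α_lt.le
        _ = 2 := Real.rpow_one 2
    have h4 : 0 ≤ m ^ (-α) := Real.rpow_nonneg (by linarith) _
    rw [norm_mul, Real.norm_eq_abs, Real.norm_eq_abs, abs_of_nonneg h4]
    exact mul_le_mul h3 h2 (abs_nonneg _) (by norm_num)
  rw [← e, sub_zero, abs_one, mul_one, Real.norm_eq_abs] at hb
  calc (∑ j ∈ S, x j * D.avg j h) ^ 2 = |∑ j ∈ S, x j * D.avg j h| ^ 2 := (sq_abs _).symm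
    _ ≤ (2 * Real.sqrt K) ^ 2 := pow_le_pow_left₀ (abs_nonneg _) hb 2
    _ = 4 * K := by rw [mul_pow, Real.sq_sqrt hK0]; norm_num

/-! ### The layer integrals of a function of `H₀¹` -/

lemma hasSum_e (u : H01 α) : HasSum (fun a => D.co (val u) a • D.e a) u := by
  convert! D.hbasis.hasSum_repr u using 2 with a
  have h0 := D.one_add_lam_pos a
  rw [D.hbasis.repr_apply_apply, hbasis_apply, real_inner_comm, inner_en, en, smul_smul]
  congr 1
  field_simp

lemma norm_sum_co_smul_e_le (u : H01 α) (S : Finset (D.ι × D.κ)) :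
    ‖∑ a ∈ S, D.co (val u) a • D.e a‖ ≤ ‖u‖ := by
  refine abs_le_of_sq_le_sq' ?_ (norm_nonneg u) |>.2
  rw [norm_sq_sum_smul_e, H01.norm_sq_eq, ← energyNorm_sq]
  refine le_trans (le_of_eq ?_) (sum_le_hasSum S (fun a _ => ?_)
    ((D.hasSum_co_sq (val u)).add (D.hasSum_energy u)))
  · exact Finset.sum_congr rfl fun a _ => by ring
  · have := D.lam_pos a
    positivity

lemma memLp_layer (D : Spec α) (h : ℝ) :
    MemLp ((Ioo (1 - h) 1).indicator fun r : ℝ => r ^ (-(α / 2))) 2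
      (volume.restrict (Ioo (0 : ℝ) 1)) :=
  (memLp_rpow D.α_lt).indicator measurableSet_Ioo

/-- The weight `r^{-α/2}` on the layer `1 - h < r < 1`. -/
def layer (h : ℝ) : L2Top := (D.memLp_layer h).toLp

lemma layer_coe (h : ℝ) : (D.layer h : ℝ → ℝ) =ᵐ[volume.restrict (Ioo (0 : ℝ) 1)]
    (Ioo (1 - h) 1).indicator fun r : ℝ => r ^ (-(α / 2)) :=
  MemLp.coeFn_toLp _

lemma inner_layer_cd (j : D.κ) {h : ℝ} (h0 : 0 < h) (h1 : h ≤ 1 / 2) :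
    inner ℝ (D.layer h) (D.cd j) = h * D.avg j h := by
  rw [D.mul_avg j h0 h1, L2Top.inner_eq, intervalIntegral.integral_of_le (by linarith),
    integral_Ioc_eq_integral_Ioo]
  have : ∫ r in Ioo (0 : ℝ) 1, D.layer h r * D.cd j r = ∫ r in Ioo (0 : ℝ) 1,
      (Ioo (1 - h) 1).indicator (fun r => r ^ (-α) * D.F j r) r := by
    apply integral_congr_ae
    filter_upwards [D.layer_coe h, D.cd_coe j, ae_restrict_mem measurableSet_Ioo] with r e1 e2 hr
    rw [e1, e2]
    by_cases hm : r ∈ Ioo (1 - h) 1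
    · have e : r ^ (-α) = r ^ (-(α / 2)) * r ^ (-(α / 2)) := by
        rw [← Real.rpow_add hr.1]; congr 1; ring
      rw [indicator_of_mem hm, indicator_of_mem hm, e]; ring
    · rw [indicator_of_notMem hm, indicator_of_notMem hm, zero_mul]
  rw [this, setIntegral_indicator measurableSet_Ioo,
    inter_eq_self_of_subset_right (Ioo_subset_Ioo_left (by linarith))]

/-- The factor $r^{-\alpha/2}$ in $\partial_ru$ is carried by the layer function, so for each fixed
$h$ the layer integral is a bounded functional of the weighted derivative. -/
lemma integral_layer {χ : ℝ × ℝ → ℝ} (hχ : Continuous χ) (u : H01 α) (t : ℝ) {h : ℝ} (h1 : h ≤ 1) :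
    ∫ z in Ioo 0 1 ×ˢ Ioo (1 - h) 1, dr u z * χ (z.1, t)
      = inner ℝ (tens (slice hχ t) (D.layer h)) (wdr u) := by
  have hs : (Ioo (0 : ℝ) 1 ×ˢ Ioo (1 - h) 1) ⊆ Ω :=
    prod_mono_right (Ioo_subset_Ioo_left (by linarith))
  rw [L2.inner_eq]
  have : ∫ z in Ω, tens (slice hχ t) (D.layer h) z * wdr u z = ∫ z in Ω,
      (Ioo (0 : ℝ) 1 ×ˢ Ioo (1 - h) 1).indicator (fun z => dr u z * χ (z.1, t)) z := by
    apply integral_congr_ae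
    filter_upwards [tens_coe' (slice_coe hχ t) (D.layer_coe h), ae_restrict_mem measurableSet_Ω]
      with z e hz
    rw [e]
    by_cases hm : z.2 ∈ Ioo (1 - h) 1
    · rw [indicator_of_mem hm, indicator_of_mem (show z ∈ Ioo (0 : ℝ) 1 ×ˢ Ioo (1 - h) 1 from
        ⟨hz.1, hm⟩), dr]
      ring
    · rw [indicator_of_notMem hm, indicator_of_notMem fun h => hm h.2]
      ring
  rw [this, setIntegral_indicator (measurableSet_Ioo.prod measurableSet_Ioo),
    inter_eq_self_of_subset_right hs]

lemma inner_layer_e {χ : ℝ × ℝ → ℝ} (hχ : Continuous χ) (a : D.ι × D.κ) (t : ℝ) {h : ℝ}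
    (h0 : 0 < h) (h1 : h ≤ 1 / 2) :
    inner ℝ (tens (slice hχ t) (D.layer h)) (wdr (D.e a))
      = inner ℝ (D.b a.1) (slice hχ t) * (h * D.avg a.2 h) := by
  rw [wdr_e, inner_tens, D.inner_layer_cd a.2 h0 h1, real_inner_comm]

/-! ### Convergence of the layer averages -/

/-- The pairing of a coefficient with the corresponding coefficient of a test function. -/
def pair (T : ℝ) (x : D.ι × D.κ → ℝ → ℝ) {χ : ℝ × ℝ → ℝ} (hχ : Continuous χ) (a : D.ι × D.κ) : ℝ :=
  ∫ t in Ioo 0 T, x a t * inner ℝ (D.b a.1) (slice hχ t)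

variable {T : ℝ} {φ0 : H01 α} {φ1 : L2 Ω} {f : L2t T (L2 Ω)} {φ : L2t T (H01 α)}
  {φt : L2t T (L2 Ω)} {φtt : L2t T (Hneg1 α)} {x y : D.ι × D.κ → ℝ → ℝ} {χ : ℝ × ℝ → ℝ}

/-- For fixed $h$ the layer functional is bounded on $H^1_0(\Omega;w)$ and may be applied termwise
to the eigenfunction expansion of $\varphi(t)$. Dominated convergence, along the finite sets of a
countable index set, moves the sum out of the time integral. -/
lemma hasSum_layer (hT : 0 < T) (hc : D.IsCoeff φ0 φ1 f φ φt φtt x y)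
    (hχ : IsTest (Ioo 0 1 ×ˢ Ioo 0 T) χ) {h : ℝ} (h0 : 0 < h) (h1 : h ≤ 1 / 2) :
    HasSum (fun a => D.pair T x hχ.1.continuous a * D.avg a.2 h)
      (h⁻¹ * ∫ t in Ioo 0 T, ∫ z in Ioo 0 1 ×ˢ Ioo (1 - h) 1, dr (φ t) z * χ (z.1, t)) := by
  set hχc := hχ.1.continuous
  obtain ⟨M, hM⟩ := hχ.exists_abs_le
  have cs := continuous_slice hχc hχ.2.1
  have cxi : ∀ a, ContinuousOn (fun t => x a t * inner ℝ (D.b a.1) (slice hχc t)) (Icc 0 T) :=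
    fun a => ((hc.osc a).fst.continuousOn hT.le).mul (continuous_const.inner cs).continuousOn
  have ii : ∀ a, IntegrableOn (fun t => x a t * inner ℝ (D.b a.1) (slice hχc t)) (Ioo 0 T) :=
    fun a => (cxi a).integrableOn_Icc.mono_set Ioo_subset_Icc_self
  have hF : Tendsto (fun S : Finset (D.ι × D.κ) => ∫ t in Ioo 0 T,
      ∑ a ∈ S, x a t * inner ℝ (D.b a.1) (slice hχc t) * (h * D.avg a.2 h)) atTop
      (𝓝 (∫ t in Ioo 0 T, ∫ z in Ioo 0 1 ×ˢ Ioo (1 - h) 1, dr (φ t) z * χ (z.1, t))) := by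
    refine tendsto_integral_filter_of_dominated_convergence
      (fun t => |M| * ‖D.layer h‖ * ‖φ t‖) ?_ ?_ ?_ ?_
    · exact Eventually.of_forall fun S =>
        (integrable_finsetSum S fun a _ => (ii a).mul_const _).aestronglyMeasurable
    · refine Eventually.of_forall fun S => ?_
      filter_upwards [hc.co_val] with t ht
      have e : ∑ a ∈ S, x a t * inner ℝ (D.b a.1) (slice hχc t) * (h * D.avg a.2 h)
          = inner ℝ (tens (slice hχc t) (D.layer h))
            (wdrL (∑ a ∈ S, D.co (val (φ t)) a • D.e a)) := by
        rw [map_sum, inner_sum]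
        refine Finset.sum_congr rfl fun a _ => ?_
        rw [map_smul, inner_smul_right, wdrL_apply, D.inner_layer_e hχc a t h0 h1, ht a, mul_assoc]
      rw [e, wdrL_apply]
      refine (norm_inner_le_norm _ _).trans ?_
      rw [norm_tens]
      refine mul_le_mul (mul_le_mul_of_nonneg_right ?_ (norm_nonneg _)) ?_ (norm_nonneg _)
        (by positivity)
      · refine abs_le_of_sq_le_sq' ?_ (abs_nonneg M) |>.2
        rw [sq_abs]
        exact norm_slice_sq_le hχc hM t
      · exact (norm_wdr_le _).trans (D.norm_sum_co_smul_e_le _ S)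
    · exact (L2t.integrableOn φ).norm.const_mul _
    · filter_upwards [hc.co_val] with t ht
      rw [D.integral_layer hχc (φ t) t (by linarith)]
      have hs := (D.hasSum_e (φ t)).mapL ((innerSL ℝ (tens (slice hχc t) (D.layer h))).comp wdrL)
      refine Tendsto.congr (fun S => ?_) hs
      refine Finset.sum_congr rfl fun a _ => ?_
      change ((innerSL ℝ (tens (slice hχc t) (D.layer h))).comp wdrL)
        (D.co (val (φ t)) a • D.e a) = _
      rw [map_smul, ContinuousLinearMap.comp_apply, innerSL_apply_apply, wdrL_apply,
        D.inner_layer_e hχc a t h0 h1, ht a, smul_eq_mul, mul_assoc]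
  have hF' : HasSum (fun a => D.pair T x hχc a * (h * D.avg a.2 h))
      (∫ t in Ioo 0 T, ∫ z in Ioo 0 1 ×ˢ Ioo (1 - h) 1, dr (φ t) z * χ (z.1, t)) := by
    refine Tendsto.congr (fun S => ?_) hF
    rw [integral_finsetSum _ fun a _ => (ii a).mul_const _]
    exact Finset.sum_congr rfl fun a _ => by rw [integral_mul_const]; rfl
  convert! hF'.mul_left h⁻¹ using 2 with a
  field_simp

lemma integral_x_sq_le (hT : 0 < T) (hc : D.IsCoeff φ0 φ1 f φ φt φtt x y) (a : D.ι × D.κ) :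
    ∫ t in Ioo 0 T, x a t ^ 2 ≤ T * (D.m⁻¹ * ((2 + 4 * T) * D.data φ0 φ1 f a)) := by
  have hm := D.m_pos
  calc ∫ t in Ioo 0 T, x a t ^ 2
      ≤ ∫ t in Ioo 0 T, D.m⁻¹ * ((2 + 4 * T) * D.data φ0 φ1 f a) := by
        refine setIntegral_mono_on (integrableOn_sq_of_continuousOn
          ((hc.osc a).fst.continuousOn hT.le)) (integrableOn_const (by simp)) measurableSet_Ioo
          fun t ht => ?_
        have h1 := hc.energy_le hT a (Ioo_subset_Icc_self ht)
        rw [inv_mul_eq_div, le_div_iff₀ hm]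
        nlinarith [sq_nonneg (y a t), mul_le_mul_of_nonneg_right (D.m_le_lam a) (sq_nonneg (x a t))]
    _ = _ := by simp [hT.le]

/-- Moving two time derivatives to χ gains a factor $\lambda_a\ge\mu_j$ over the energy bound. The
bound is a factor depending on $i$ alone, summable by Bessel's inequality in θ, times the data of
the mode: the form needed for Cauchy–Schwarz over $i$. -/
lemma sq_mu_pair_le (hT : 0 < T) (hc : D.IsCoeff φ0 φ1 f φ φt φtt x y)
    (hχ : IsTest (Ioo 0 1 ×ˢ Ioo 0 T) χ) (a : D.ι × D.κ) :
    D.μ a.2 ^ 2 * D.pair T x hχ.1.continuous a ^ 2 ≤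
      ((∫ t in Ioo 0 T, inner ℝ (D.b a.1) (slice hχ.1.continuous t) ^ 2)
        + ∫ t in Ioo 0 T, inner ℝ (D.b a.1)
          (slice ((hχ.fderiv_apply er).fderiv_apply er).1.continuous t) ^ 2) *
      (2 * (1 + T * (D.m⁻¹ * (2 + 4 * T))) * D.data φ0 φ1 f a) := by
  have d1 := hasDerivAt_inner_slice hχ (D.b_coe a.1) (D.V_cont a.1)
  have d2 := hasDerivAt_inner_slice (hχ.fderiv_apply er) (D.b_coe a.1) (D.V_cont a.1)
  have n0 : (0 : ℝ) ∉ Ioo 0 T := by simp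
  have nT : T ∉ Ioo 0 T := by simp
  have c0 := continuous_slice hχ.1.continuous hχ.2.1
  have c2 := continuous_slice ((hχ.fderiv_apply er).fderiv_apply er).1.continuous
    ((hχ.fderiv_apply er).fderiv_apply er).2.1
  have ci := continuous_const (y := (D.b a.1 : L2Top)).inner c0 (𝕜 := ℝ)
  have ci2 := continuous_const (y := (D.b a.1 : L2Top)).inner c2 (𝕜 := ℝ)
  have cx := (hc.osc a).fst.continuousOn hT.le
  have e := (hc.osc a).lam_mul_integral hT (D.memLp_co f a) d1 d2 ci2
    (hχ.inner_slice_eq_zero _ n0) (hχ.inner_slice_eq_zero _ nT)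
    ((hχ.fderiv_apply er).inner_slice_eq_zero _ n0) ((hχ.fderiv_apply er).inner_slice_eq_zero _ nT)
  have q1 := sq_integral_mul_le (D.memLp_co f a)
    (memLp_two_of_continuousOn (T := T) ci.continuousOn)
  have q2 := sq_integral_mul_le (memLp_two_of_continuousOn cx)
    (memLp_two_of_continuousOn (T := T) ci2.continuousOn)
  set A := ∫ t in Ioo 0 T, inner ℝ (D.b a.1) (slice hχ.1.continuous t) ^ 2
  set B := ∫ t in Ioo 0 T, inner ℝ (D.b a.1)
    (slice ((hχ.fderiv_apply er).fderiv_apply er).1.continuous t) ^ 2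
  have hA : 0 ≤ A := integral_nonneg fun _ => sq_nonneg _
  have hB : 0 ≤ B := integral_nonneg fun _ => sq_nonneg _
  change D.lam a * D.pair T x hχ.1.continuous a = _ at e
  set p := D.pair T x hχ.1.continuous a
  set P := ∫ t in Ioo 0 T, D.co (f t) a * inner ℝ (D.b a.1) (slice hχ.1.continuous t)
  set Q := ∫ t in Ioo 0 T, x a t * inner ℝ (D.b a.1)
    (slice ((hχ.fderiv_apply er).fderiv_apply er).1.continuous t)
  have k1 : D.μ a.2 ^ 2 * p ^ 2 ≤ (P - Q) ^ 2 := by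
    rw [← e, mul_pow]
    have := D.μ_pos a.2
    have h2 : D.μ a.2 ≤ D.lam a := by
      have := D.ν_pos a.1
      rw [lam]
      linarith
    gcongr
  have hd := D.data_nonneg φ0 φ1 f a
  have k2 : ∫ t in Ioo 0 T, D.co (f t) a ^ 2 ≤ D.data φ0 φ1 f a := by
    have := D.lam_pos a
    rw [data]
    have : 0 ≤ D.co φ1 a ^ 2 + D.lam a * D.co (val φ0) a ^ 2 := by positivity
    linarith
  have k3 := D.integral_x_sq_le hT hc a
  have hm := D.m_pos
  have k4 : P ^ 2 ≤ D.data φ0 φ1 f a * A := q1.trans (mul_le_mul_of_nonneg_right k2 hA)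
  have k5 : Q ^ 2 ≤ T * (D.m⁻¹ * ((2 + 4 * T) * D.data φ0 φ1 f a)) * B :=
    q2.trans (mul_le_mul_of_nonneg_right k3 hB)
  have k6 : 0 ≤ D.data φ0 φ1 f a * B := mul_nonneg hd hB
  have k7 : 0 ≤ T * (D.m⁻¹ * ((2 + 4 * T) * D.data φ0 φ1 f a)) * A := by positivity
  calc _ ≤ (P - Q) ^ 2 := k1
    _ ≤ 2 * P ^ 2 + 2 * Q ^ 2 := by nlinarith [sq_nonneg (P + Q)]
    _ ≤ 2 * (D.data φ0 φ1 f a * A) + 2 * (T * (D.m⁻¹ * ((2 + 4 * T) * D.data φ0 φ1 f a)) * B)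
        + 2 * (D.data φ0 φ1 f a * B)
        + 2 * (T * (D.m⁻¹ * ((2 + 4 * T) * D.data φ0 φ1 f a)) * A) := by linarith
    _ = _ := by ring

lemma sum_integral_inner_b_sq_le (hT : 0 < T) {U : Set (ℝ × ℝ)} (hχ : IsTest U χ) {M : ℝ}
    (hM : ∀ z, |χ z| ≤ M) (s : Finset D.ι) :
    ∑ i ∈ s, ∫ t in Ioo 0 T, inner ℝ (D.b i) (slice hχ.1.continuous t) ^ 2 ≤ T * M ^ 2 := by
  have cs := continuous_slice hχ.1.continuous hχ.2.1
  have ii : ∀ i, IntegrableOn (fun t => inner ℝ (D.b i) (slice hχ.1.continuous t) ^ 2) (Ioo 0 T) :=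
    fun i => integrableOn_sq_of_continuousOn (continuous_const.inner cs).continuousOn
  rw [← integral_finsetSum _ fun i _ => ii i]
  calc _ ≤ ∫ t in Ioo 0 T, M ^ 2 := by
        refine setIntegral_mono_on (integrable_finsetSum _ fun i _ => ii i)
          (integrableOn_const (by simp)) measurableSet_Ioo fun t _ => ?_
        refine le_trans ?_ (norm_slice_sq_le hχ.1.continuous hM t)
        have := D.b.orthonormal.sum_inner_products_le (slice hχ.1.continuous t) (s := s)
        simpa using this
    _ = _ := by simp [hT.le]

lemma sum_fibers [DecidableEq D.ι] [DecidableEq D.κ] (S : Finset (D.ι × D.κ)) {X : Type*}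
    [AddCommMonoid X] (g : D.ι × D.κ → X) : ∑ a ∈ S, g a =
      ∑ i ∈ S.image Prod.fst, ∑ j ∈ (S.filter fun a => a.1 = i).image Prod.snd, g (i, j) := by
  refine Finset.sum_finset_product S _ _ fun p => ?_
  simp only [Finset.mem_image, Finset.mem_filter, Prod.exists]
  constructor
  · intro h
    exact ⟨⟨p.1, p.2, h, rfl⟩, p.1, p.2, ⟨h, rfl⟩, rfl⟩
  · rintro ⟨-, a, b, ⟨h1, h2⟩, h3⟩
    have : p = (a, b) := Prod.ext h2.symm h3.symm
    rwa [this]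

/-- The layer averages of a weak solution are, uniformly in the layer, a convergent series. -/
lemma exists_summable_bound (hT : 0 < T) (hc : D.IsCoeff φ0 φ1 f φ φt φtt x y)
    (hχ : IsTest (Ioo 0 1 ×ˢ Ioo 0 T) χ) :
    ∃ m : D.ι × D.κ → ℝ, Summable m ∧ ∀ (S : Finset (D.ι × D.κ)), ∀ h ∈ Icc (0 : ℝ) (1 / 2),
      ‖∑ a ∈ S, D.pair T x hχ.1.continuous a * D.avg a.2 h‖ ^ 2 ≤ ∑ a ∈ S, m a := by
  classical
  obtain ⟨M, hM⟩ := hχ.exists_abs_le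
  have hχ2 := (hχ.fderiv_apply er).fderiv_apply er
  obtain ⟨M₂, hM₂⟩ := hχ2.exists_abs_le
  set K := 2 * (1 + T * (D.m⁻¹ * (2 + 4 * T)))
  have hK : 0 ≤ K := by have := D.m_pos; positivity
  set N : D.ι → ℝ := fun i => (∫ t in Ioo 0 T, inner ℝ (D.b i) (slice hχ.1.continuous t) ^ 2)
        + ∫ t in Ioo 0 T, inner ℝ (D.b i) (slice hχ2.1.continuous t) ^ 2 with hN
  have hN0 : ∀ i, 0 ≤ N i := fun i => add_nonneg (integral_nonneg fun _ => sq_nonneg _)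
    (integral_nonneg fun _ => sq_nonneg _)
  refine ⟨fun a => (T * M ^ 2 + T * M₂ ^ 2) * (4 * (K * D.data φ0 φ1 f a)),
    (((D.summable_data φ0 φ1 f).mul_left _).mul_left _).mul_left _, fun S h hh => ?_⟩
  rw [Real.norm_eq_abs, sq_abs, ← Finset.mul_sum, D.sum_fibers S fun a =>
    D.pair T x hχ.1.continuous a * D.avg a.2 h, D.sum_fibers S fun a =>
    4 * (K * D.data φ0 φ1 f a)]
  -- The sum is grouped by $i$, because the flux bound concerns radial sums only, and the groups are
  -- added by Cauchy–Schwarz.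
  refine (Finset.sum_sq_le_sum_mul_sum_of_sq_le_mul (f := N) _ (fun i _ => hN0 i)
    (fun i _ => Finset.sum_nonneg fun j _ => ?_) (fun i _ => ?_)).trans
    (mul_le_mul_of_nonneg_right ?_ ?_)
  · have := D.data_nonneg φ0 φ1 f (i, j)
    positivity
  · refine (D.sq_sum_avg_le _ (fun j => D.pair T x hχ.1.continuous (i, j)) hh).trans ?_
    rw [Finset.mul_sum, Finset.mul_sum]
    refine Finset.sum_le_sum fun j _ => ?_
    have := D.sq_mu_pair_le hT hc hχ (i, j)
    simp only at this
    simp only [hN]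
    linarith
  · rw [Finset.sum_add_distrib]
    exact add_le_add (D.sum_integral_inner_b_sq_le hT hχ hM _)
      (D.sum_integral_inner_b_sq_le hT hχ2 hM₂ _)
  · refine Finset.sum_nonneg fun i _ => Finset.sum_nonneg fun j _ => ?_
    have := D.data_nonneg φ0 φ1 f (i, j)
    positivity

/-! ### The trace -/

lemma memLp_traceTerm (hT : 0 < T) (hc : D.IsCoeff φ0 φ1 f φ φt φtt x y) (a : D.ι × D.κ) :
    MemLp (fun t => (x a t * D.F a.2 1) • D.b a.1) 2 (volume.restrict (Ioo 0 T)) :=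
  memLp_two_of_continuousOn
    ((((hc.osc a).fst.continuousOn hT.le).mul continuousOn_const).smul continuousOn_const)

/-- The normal derivative of a single mode on the side `r = 1`. -/
def traceTerm (hT : 0 < T) (hc : D.IsCoeff φ0 φ1 f φ φt φtt x y) (a : D.ι × D.κ) : L2t T L2Top :=
  (D.memLp_traceTerm hT hc a).toLp

lemma traceTerm_coe (hT : 0 < T) (hc : D.IsCoeff φ0 φ1 f φ φt φtt x y) (a : D.ι × D.κ) :
    (D.traceTerm hT hc a : ℝ → L2Top) =ᵐ[volume.restrict (Ioo 0 T)]
      fun t => (x a t * D.F a.2 1) • D.b a.1 :=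
  MemLp.coeFn_toLp _

/-- The functions $b_i$ are orthonormal on the side, so the squared norm splits over $i$; each piece
is `hidden_regularity` with $\nu=\nu_i$. -/
lemma norm_sq_sum_traceTerm_le (hT : 0 < T) (hc : D.IsCoeff φ0 φ1 f φ φt φtt x y)
    (S : Finset (D.ι × D.κ)) : ‖∑ a ∈ S, D.traceTerm hT hc a‖ ^ 2 ≤
      ∑ a ∈ S, (5 + 14 * T + 12 * T ^ 2) * D.data φ0 φ1 f a := by
  classical
  have e : ∀ᵐ t ∂(volume.restrict (Ioo 0 T)), ‖(∑ a ∈ S, D.traceTerm hT hc a : L2t T L2Top) t‖ ^ 2 =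
      ∑ i ∈ S.image Prod.fst, (∑ j ∈ (S.filter fun a => a.1 = i).image Prod.snd,
        x (i, j) t * D.F j 1) ^ 2 := by
    filter_upwards [Lp.coeFn_finsetSum S fun a => D.traceTerm hT hc a,
      ae_all_iff.2 fun a => D.traceTerm_coe hT hc a] with t e1 e2
    rw [e1, Finset.sum_apply, Finset.sum_congr rfl fun a _ => e2 a, sum_fibers]
    simp only [← Finset.sum_smul]
    rw [norm_sq_sum_b]
  have ii : ∀ i, IntegrableOn (fun t => (∑ j ∈ (S.filter fun a => a.1 = i).image Prod.snd,
        x (i, j) t * D.F j 1) ^ 2) (Ioo 0 T) := fun i =>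
    integrableOn_sq_of_continuousOn (continuousOn_finsetSum _ fun j _ =>
      ((hc.osc (i, j)).fst.continuousOn hT.le).mul continuousOn_const)
  rw [L2t.norm_sq_eq, integral_congr_ae e, integral_finsetSum _ fun i _ => ii i,
    sum_fibers]
  refine Finset.sum_le_sum fun i _ => ?_
  rw [← Finset.mul_sum]
  refine (D.hidden_regularity hT (D.ν_pos i).le _ (f := fun j t => D.co (f t) (i, j))
    (x := fun j => x (i, j)) (y := fun j => y (i, j)) (fun j => hc.osc (i, j))
    (fun j => D.memLp_co f (i, j))).trans_eq ?_
  congr 1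
  refine Finset.sum_congr rfl fun j _ => ?_
  rw [hc.x_zero, hc.y_zero]
  rfl

lemma integral_mul_test_eq_inner (hχ : IsTest (Ioo 0 1 ×ˢ Ioo 0 T) χ) (g : L2t T L2Top) :
    ∫ t in Ioo 0 T, ∫ θ in Ioo 0 1, g t θ * χ (θ, t) =
      inner ℝ ((memLp_two_of_continuousOn (T := T)
        (continuous_slice hχ.1.continuous hχ.2.1).continuousOn).toLp : L2t T L2Top) g := by
  rw [MeasureTheory.L2.inner_def]
  apply integral_congr_ae
  filter_upwards [(memLp_two_of_continuousOn (T := T)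
        (continuous_slice hχ.1.continuous hχ.2.1).continuousOn).coeFn_toLp] with t e
  rw [e, real_inner_comm]
  exact (inner_slice (EventuallyEq.refl _ _) hχ.1.continuous t).symm

/-- Hidden regularity: the trace of the normal derivative on the side `r = 1`. -/
lemma exists_isTopTrace (hT : 0 < T) (hc : D.IsCoeff φ0 φ1 f φ φt φtt x y) :
    ∃ g : L2t T L2Top, IsTopTrace T φ g ∧ ‖g‖ ^ 2 ≤
      (5 + 14 * T + 12 * T ^ 2) * (‖φ1‖ ^ 2 + energyNorm φ0 ^ 2 + ‖f‖ ^ 2) := by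
  have hd := D.summable_data φ0 φ1 f
  have hs := summable_of_norm_sq_sum_le (hd.mul_left (5 + 14 * T + 12 * T ^ 2))
    (D.norm_sq_sum_traceTerm_le hT hc)
  refine ⟨∑' a, D.traceTerm hT hc a, fun χ hχ => ?_, ?_⟩
  · obtain ⟨m, hm, hb⟩ := D.exists_summable_bound hT hc hχ
    -- The variable is now the width $h\in[0,1/2]$ rather than time: the sum of the layer averages
    -- is continuous up to $h=0$.
    obtain ⟨cs, hsum⟩ := continuousOn_tsum_of_norm_sq_sum_le (T := 1 / 2)
      (x := fun a h => D.pair T x hχ.1.continuous a * D.avg a.2 h)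
      (fun a => (continuous_const.mul (D.continuous_avg a.2)).continuousOn) hm hb
    have h0 : (0 : ℝ) ∈ Icc (0 : ℝ) (1 / 2) := ⟨le_rfl, by norm_num⟩
    -- At $h=0$ the averages are the boundary fluxes, and the series is the pairing of χ with the
    -- sum of the traces of the modes.
    have e0 : ∑' a, D.pair T x hχ.1.continuous a * D.avg a.2 0 =
        ∫ t in Ioo 0 T, ∫ θ in Ioo 0 1, (∑' a, D.traceTerm hT hc a : L2t T L2Top) t θ
          * χ (θ, t) := by
      rw [integral_mul_test_eq_inner hχ]
      have h1 := hs.hasSum.mapL (innerSL ℝ ((memLp_two_of_continuousOn (T := T)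
        (continuous_slice hχ.1.continuous hχ.2.1).continuousOn).toLp : L2t T L2Top))
      refine (hsum 0 h0).unique ?_
      convert! h1 using 2 with a
      rw [innerSL_apply_apply, MeasureTheory.L2.inner_def, avg_zero, pair, ← integral_mul_const]
      apply integral_congr_ae
      filter_upwards [(memLp_two_of_continuousOn (T := T)
        (continuous_slice hχ.1.continuous hχ.2.1).continuousOn).coeFn_toLp,
        D.traceTerm_coe hT hc a] with t e1 e2
      rw [e1, e2, inner_smul_right, real_inner_comm (D.b a.1)]
      ring
    rw [← e0, ← nhdsWithin_Ioc_eq_nhdsGT (show (0 : ℝ) < 1 / 2 by norm_num)]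
    have ht : Tendsto (fun h => ∑' a, D.pair T x hχ.1.continuous a * D.avg a.2 h)
        (𝓝[Ioc 0 (1 / 2)] 0) (𝓝 (∑' a, D.pair T x hχ.1.continuous a * D.avg a.2 0)) :=
      (cs 0 h0).mono_left (nhdsWithin_mono _ Ioc_subset_Icc_self)
    refine ht.congr' ?_
    filter_upwards [self_mem_nhdsWithin] with h hh
    exact (D.hasSum_layer hT hc hχ hh.1 hh.2).tsum_eq
  · refine (norm_sq_tsum_le (hd.mul_left (5 + 14 * T + 12 * T ^ 2))
      (D.norm_sq_sum_traceTerm_le hT hc)).trans ?_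
    rw [tsum_mul_left]
    have := hd.tsum_le_of_sum_le (D.sum_data_le φ0 φ1 f)
    gcongr

end Spec

/-! ### Pointwise bounds in time -/

/-- The Sobolev inequality in one dimension: $u(t)^2\le2u(s)^2+2(u(t)-u(s))^2$, the increment
squared is at most $T\int g^2$, and the result is averaged over $s\in(0,T)$. -/
lemma IsPrim.sq_le {T : ℝ} (hT : 0 < T) {u g : ℝ → ℝ} (h : IsPrim T u g)
    (hg : MemLp g 2 (volume.restrict (Ioo 0 T))) {t : ℝ} (ht : t ∈ Icc 0 T) :
    u t ^ 2 ≤ (2 / T) * (∫ s in Ioo 0 T, u s ^ 2) + 2 * T * ∫ s in Ioo 0 T, g s ^ 2 := by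
  have key : ∀ s ∈ Ioo 0 T, (u t - u s) ^ 2 ≤ T * ∫ s in Ioo 0 T, g s ^ 2 := by
    intro s hs
    have hs' := Ioo_subset_Icc_self hs
    have e : u t - u s = ∫ r in s..t, g r := by
      rw [h.eq t ht, h.eq s hs', ← intervalIntegral.integral_interval_sub_left
        (h.integrable_sub ht) (h.integrable_sub hs')]
      ring
    have e2 : |∫ r in s..t, g r| ≤ ∫ r in Ioo 0 T, |g r| := by
      refine (intervalIntegral.norm_integral_le_integral_norm_uIoc (f := g)).trans ?_
      rw [← integral_Ioc_eq_integral_Ioo]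
      refine setIntegral_mono_set ?_ (Eventually.of_forall fun _ => abs_nonneg _)
        (LE.le.eventuallyLE fun r hr => ?_)
      · have := h.integrable.1
        exact this.norm
      · exact ⟨lt_of_le_of_lt (le_min hs'.1 ht.1) hr.1, hr.2.trans (max_le hs'.2 ht.2)⟩
    have e3 := sq_integral_mul_le hg.abs
      (memLp_two_of_continuousOn (T := T) (u := fun _ => (1 : ℝ)) continuousOn_const)
    simp only [mul_one, one_pow, integral_const, MeasurableSet.univ, measureReal_restrict_apply,
      univ_inter, Real.volume_real_Ioo, sub_zero, smul_eq_mul, max_eq_left hT.le, Pi.abs_apply,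
      sq_abs] at e3
    rw [e, ← sq_abs, mul_comm]
    exact (pow_le_pow_left₀ (abs_nonneg _) e2 2).trans e3
  have iu := integrableOn_sq_of_continuousOn (h.continuousOn hT.le)
  have hI : ∫ s in Ioo 0 T, u t ^ 2 ≤
      ∫ s in Ioo 0 T, (2 * u s ^ 2 + 2 * (T * ∫ s in Ioo 0 T, g s ^ 2)) := by
    refine setIntegral_mono_on (integrableOn_const (by simp))
      ((iu.const_mul 2).add (integrableOn_const (by simp))) measurableSet_Ioo fun s hs => ?_
    have := key s hs
    nlinarith [sq_nonneg (u t - 2 * u s)]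
  rw [integral_add (iu.const_mul 2) (integrableOn_const (by simp)), integral_const_mul] at hI
  simp only [integral_const, MeasurableSet.univ, measureReal_restrict_apply,
      univ_inter, Real.volume_real_Ioo, sub_zero, smul_eq_mul, max_eq_left hT.le] at hI
  rw [← mul_le_mul_iff_of_pos_left hT]
  refine hI.trans (le_of_eq ?_)
  field_simp

/-! ### Weak derivatives of convergent series -/

lemma IsTest.mono {U U' : Set (ℝ × ℝ)} (h : U ⊆ U') {ψ : ℝ × ℝ → ℝ} (hψ : IsTest U ψ) :
    IsTest U' ψ :=
  ⟨hψ.1, hψ.2.1, hψ.2.2.trans h⟩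

lemma IsTest.setIntegral_mul_eq {U U' : Set (ℝ × ℝ)} (h : U ⊆ U') (hU : MeasurableSet U')
    {ψ : ℝ × ℝ → ℝ} (hψ : IsTest U ψ) (g : ℝ × ℝ → ℝ) :
    ∫ z in U', g z * ψ z = ∫ z in U, g z * ψ z :=
  setIntegral_eq_of_subset_of_forall_sdiff_eq_zero hU h fun z hz => by
    rw [hψ.eq_zero hz.2, mul_zero]

lemma IsWeakPartial.mono {U U' : Set (ℝ × ℝ)} (h : U ⊆ U') (hU : MeasurableSet U') {e : ℝ × ℝ}
    {u v : ℝ × ℝ → ℝ} (huv : IsWeakPartial U' e u v) : IsWeakPartial U e u v := by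
  intro ψ hψ
  rw [← hψ.setIntegral_mul_eq h hU, ← (hψ.fderiv_apply e).setIntegral_mul_eq h hU]
  exact huv ψ (hψ.mono h)

/-- For a fixed test function both sides of the defining identity are bounded functionals on
$L^2(U)$, so they commute with the sums. -/
lemma isWeakPartial_of_hasSum {U : Set (ℝ × ℝ)} {e : ℝ × ℝ} {ι : Type*} {x : ι → ℝ}
    {p q : ι → L2 U} {P Q : L2 U} (h : ∀ a, IsWeakPartial U e (p a) (q a))
    (hP : HasSum (fun a => x a • p a) P) (hQ : HasSum (fun a => x a • q a) Q) :
    IsWeakPartial U e P Q := by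
  intro ψ hψ
  rw [integral_coe_mul_eq_inner _ (hψ.memLp_fderiv e), integral_coe_mul_eq_inner _ hψ.memLp]
  refine (hP.mapL (innerSL ℝ ((hψ.memLp_fderiv e).toLp))).unique ?_
  convert! (hQ.mapL (innerSL ℝ (hψ.memLp.toLp))).neg using 2 with a
  rw [map_smul, map_smul, innerSL_apply_apply, innerSL_apply_apply,
    ← integral_coe_mul_eq_inner, ← integral_coe_mul_eq_inner, h a ψ hψ, smul_neg]

/-! ### The interior region -/

section interior

lemma Ωsharp_subset : Ωsharp (1 / 8) ⊆ Ω := fun _ hz =>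
  ⟨⟨lt_trans (by norm_num) hz.1.1, lt_trans hz.1.2 (by norm_num)⟩,
    ⟨lt_trans (by norm_num) hz.2.1, hz.2.2⟩⟩

lemma measurableSet_Ωsharp (δ : ℝ) : MeasurableSet (Ωsharp δ) :=
  measurableSet_Ioo.prod measurableSet_Ioo

lemma restrict_Ωsharp_le :
    (volume.restrict (Ωsharp (1 / 8)) : Measure (ℝ × ℝ)) ≤ volume.restrict Ω :=
  Measure.restrict_mono Ωsharp_subset le_rfl

lemma aesm_weight (s : ℝ) : AEStronglyMeasurable (fun z : ℝ × ℝ => z.2 ^ (-s))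
    (volume.restrict (Ωsharp (1 / 8))) :=
  (measurable_snd.pow_const _).aestronglyMeasurable

lemma ae_weight_le {s : ℝ} (hs : 0 ≤ s) :
    ∀ᵐ z ∂(volume.restrict (Ωsharp (1 / 8))), |z.2 ^ (-s)| ≤ (8 : ℝ) ^ s := by
  filter_upwards [ae_restrict_mem (measurableSet_Ωsharp _)] with z hz
  have h0 : (1 / 8 : ℝ) < z.2 := hz.2.1
  rw [abs_of_nonneg (Real.rpow_nonneg (by linarith) _)]
  calc z.2 ^ (-s) ≤ (1 / 8 : ℝ) ^ (-s) :=
        Real.rpow_le_rpow_of_nonpos (by norm_num) h0.le (by linarith)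
    _ = 8 ^ s := by
        rw [Real.rpow_neg (by norm_num), ← Real.inv_rpow (by norm_num)]
        norm_num

/-- `u ↦ r^{-s} u` from `L²(Ω)` to `L²` of the interior region. -/
def weightOp {s : ℝ} (hs : 0 ≤ s) : L2 Ω →L[ℝ] L2 (Ωsharp (1 / 8)) :=
  mulOp restrict_Ωsharp_le (fun z => z.2 ^ (-s)) (aesm_weight s) ((8 : ℝ) ^ s) (ae_weight_le hs)
    (by positivity)

lemma weightOp_coe {s : ℝ} (hs : 0 ≤ s) (u : L2 Ω) :
    (weightOp hs u : ℝ × ℝ → ℝ) =ᵐ[volume.restrict (Ωsharp (1 / 8))] fun z => z.2 ^ (-s) * u z :=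
  mulOp_coe _ _ _ _ u

lemma norm_weightOp_le {s : ℝ} (hs : 0 ≤ s) (u : L2 Ω) : ‖weightOp hs u‖ ≤ 8 ^ s * ‖u‖ :=
  norm_mulOp_le _ _ _ _ u

lemma norm_weightOp_sq_le {s : ℝ} (hs : 0 ≤ s) {u : L2 Ω} {c : ℝ} (hu : ‖u‖ ^ 2 ≤ c) :
    ‖weightOp hs u‖ ^ 2 ≤ (8 ^ s) ^ 2 * c := by
  calc ‖weightOp hs u‖ ^ 2 ≤ (8 ^ s * ‖u‖) ^ 2 :=
        pow_le_pow_left₀ (norm_nonneg _) (norm_weightOp_le hs u) 2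
    _ = (8 ^ s) ^ 2 * ‖u‖ ^ 2 := mul_pow _ _ _
    _ ≤ _ := by gcongr

end interior

/-! ### The weak form of $\mathcal A$. -/

section operator

variable {α : ℝ}

/-- The derivative in `θ`, as a bounded operator. -/
def dθL : H01 α →L[ℝ] L2 Ω :=
  (PiLp.proj 2 (fun _ : Fin 3 => L2 Ω) 1).comp ((H1w α).subtypeL.comp incl)

lemma dθL_apply (u : H01 α) : dθL u = dθ u := rfl

/-- Both sides are continuous in $v$ and test functions are dense, so the distributional equation
extends to the whole space. -/
lemma isA_iff {u : H01 α} {h : L2 Ω} :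
    IsA u h ↔ ∀ v : H01 α, energyInner u v = inner ℝ h (val v) := by
  have key : ∀ {ψ : ℝ × ℝ → ℝ} (hψ : IsTest Ω ψ),
      (∫ z in Ω, (dθ u z * fderiv ℝ ψ z eθ + z.2 ^ α * (dr u z * fderiv ℝ ψ z er)) =
        energyInner u (ofTest α hψ)) ∧ ∫ z in Ω, h z * ψ z = inner ℝ h (val (ofTest α hψ)) := by
    intro ψ hψ
    constructor
    · apply integral_congr_ae
      filter_upwards [dθ_ofTest hψ (α := α), wdr_ofTest hψ (α := α),
        ae_restrict_mem measurableSet_Ω] with z h1 h2 hz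
      have h3 : dr (ofTest α hψ) z = fderiv ℝ ψ z er := by
        rw [dr, h2, ← mul_assoc, mul_rpow_cancel hz, one_mul]
      rw [h1, h3]
    · rw [L2.inner_eq]
      apply integral_congr_ae
      filter_upwards [val_ofTest hψ (α := α)] with z h1
      rw [h1]
  constructor
  · intro hA v
    refine H01.induction_test (p := fun v => energyInner u v = inner ℝ h (val v)) ?_ ?_ v
    · refine isClosed_eq ?_ (by fun_prop)
      exact (continuous_energyInner_left u).congr fun v => energyInner_comm v u
    · intro ψ hψ
      rw [← (key hψ).1, ← (key hψ).2]
      exact hA ψ hψ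
  · intro hA ψ hψ
    rw [(key hψ).1, (key hψ).2]
    exact hA _

end operator

namespace Spec

variable {α : ℝ} (D : Spec α)

/-- In the eigenbasis $\mathcal A$ is multiplication by the eigenvalues; this reduces elliptic
regularity to inequalities between $\nu_i$, $\mu_j$ and $\lambda_a$. -/
lemma isA_iff_co {u : H01 α} {h : L2 Ω} : IsA u h ↔ ∀ a, D.co h a = D.lam a * D.co (val u) a := by
  rw [isA_iff]
  constructor
  · intro hA a
    rw [← energyDual_e, energyDual_apply, hA, val_e, co, real_inner_comm]
  · intro hA v
    refine (D.hasSum_energyInner u v).unique ?_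
    convert! D.hasSum_co_mul h (val v) using 2 with a
    rw [hA]
    ring

lemma exists_co {x m : D.ι × D.κ → ℝ} (hm : Summable m) (h : ∀ a, x a ^ 2 ≤ m a) :
    ∃ k : L2 Ω, ∀ a, D.co k a = x a := by
  refine ⟨∑' a, x a • D.basis a, fun a => D.co_of_hasSum (Summable.hasSum
    (summable_of_norm_sq_sum_le hm fun S => ?_)) a⟩
  rw [norm_sq_sum_smul_basis]
  exact Finset.sum_le_sum fun a _ => h a

lemma exists_co_val {x m : D.ι × D.κ → ℝ} (hm : Summable m) (h : ∀ a, D.lam a * x a ^ 2 ≤ m a) :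
    ∃ v : H01 α, ∀ a, D.co (val v) a = x a := by
  have hm0 : 0 < 1 + D.m⁻¹ := by have := D.m_pos; positivity
  refine ⟨∑' a, x a • D.e a, fun a => D.co_val_of_hasSum (Summable.hasSum
    (summable_of_norm_sq_sum_le (hm.mul_left (1 + D.m⁻¹)) fun S => ?_)) a⟩
  rw [norm_sq_sum_smul_e]
  refine Finset.sum_le_sum fun a _ => ?_
  calc (1 + D.lam a) * x a ^ 2 ≤ (1 + D.m⁻¹) * D.lam a * x a ^ 2 := by
        gcongr
        exact D.one_add_lam_le a
    _ ≤ _ := by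
        rw [mul_assoc]
        exact mul_le_mul_of_nonneg_left (h a) hm0.le

/-! ### Elliptic regularity -/

section elliptic

variable {u : H01 α} {h : L2 Ω}

lemma IsA.energyNorm_sq_le (hA : ∀ a, D.co h a = D.lam a * D.co (val u) a) :
    energyNorm u ^ 2 ≤ D.m⁻¹ * ‖h‖ ^ 2 := by
  refine hasSum_le (fun a => ?_) (D.hasSum_energy u) ((D.hasSum_co_sq h).mul_left D.m⁻¹)
  have hm := D.m_pos
  rw [hA, inv_mul_eq_div, le_div_iff₀ hm]
  have := D.m_le_lam a
  have h1 : 0 ≤ D.lam a * D.co (val u) a ^ 2 := mul_nonneg (D.lam_pos a).le (sq_nonneg _)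
  nlinarith

lemma IsA.norm_val_sq_le (hA : ∀ a, D.co h a = D.lam a * D.co (val u) a) :
    ‖val u‖ ^ 2 ≤ D.m⁻¹ * (D.m⁻¹ * ‖h‖ ^ 2) := by
  have h1 := IsA.energyNorm_sq_le D hA
  have h2 := D.poincare u
  have hm := D.m_pos
  rw [inv_mul_eq_div, le_div_iff₀ hm]
  linarith

lemma normDA_le (hA : IsA u h) :
    normDA u ≤ ENNReal.ofReal (Real.sqrt (D.m⁻¹ * D.m⁻¹ + D.m⁻¹ + 1) * ‖h‖) := by
  have hco := D.isA_iff_co.1 hA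
  have hm := D.m_pos
  refine (iInf₂_le h hA).trans (ENNReal.ofReal_le_ofReal ?_)
  rw [← Real.sqrt_sq (norm_nonneg h), ← Real.sqrt_mul (by positivity), Real.sqrt_sq (norm_nonneg h)]
  refine Real.sqrt_le_sqrt ?_
  rw [H01.norm_sq_eq, ← energyNorm_sq]
  linarith [IsA.energyNorm_sq_le D hco, IsA.norm_val_sq_le D hco]

/-- The mixed second derivative `r^{α/2} ∂_θ∂_r` of an eigenfunction. -/
def mixed (a : D.ι × D.κ) : L2 Ω := tens (D.bd a.1) (D.cd a.2)

lemma norm_sq_sum_mixed (S : Finset (D.ι × D.κ)) (x : D.ι × D.κ → ℝ) :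
    ‖∑ a ∈ S, x a • D.mixed a‖ ^ 2 = ∑ a ∈ S, D.ν a.1 * D.μ a.2 * x a ^ 2 := by
  classical
  rw [← real_inner_self_eq_norm_sq, sum_inner]
  refine Finset.sum_congr rfl fun a ha => ?_
  rw [inner_sum, Finset.sum_eq_single_of_mem a ha]
  · rw [inner_smul_left, inner_smul_right, mixed, inner_tens, inner_bd, inner_cd, if_pos rfl,
      if_pos rfl]
    simp only [conj_trivial]
    ring
  · intro a' _ hne
    rw [inner_smul_left, inner_smul_right, mixed, mixed, inner_tens, inner_bd, inner_cd]
    by_cases h1 : a.1 = a'.1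
    · have h2 : a.2 ≠ a'.2 := fun h2 => hne (Prod.ext h1.symm h2.symm)
      rw [if_neg h2, mul_zero, mul_zero, mul_zero]
    · rw [if_neg h1, zero_mul, mul_zero, mul_zero]

lemma continuousOn_weight (s : ℝ) : ContinuousOn (fun z : ℝ × ℝ => z.2 ^ s) Ω := by
  refine ContinuousOn.rpow_const continuousOn_snd fun z hz => Or.inl ?_
  exact (hz.2.1).ne'

lemma isWeakPartial_er_dθ_e (a : D.ι × D.κ) : IsWeakPartial Ω er
    (fun z => D.G a.1 z.1 * D.W a.2 z.2) (fun z => D.G a.1 z.1 * (z.2 ^ (-α) * D.F a.2 z.2)) := by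
  have c1 := D.G_cont a.1
  have c2 := D.F_cont a.2
  have c3 := D.W_cont a.2
  refine isWeakPartial_er (by fun_prop) ?_ fun θ _ r hr => ?_
  · exact (c1.comp continuous_fst).continuousOn.mul
      ((continuousOn_weight _).mul (c2.comp continuous_snd).continuousOn)
  · exact ((D.moder a.2).hasDerivAt r hr).const_mul (D.G a.1 θ)

/-- The radial derivative is $r^{-\alpha}$ times the flux, and the flux is differentiable; no second
derivative of $W_j$ has to be known beforehand. -/
lemma isWeakPartial_er_dr_e (a : D.ι × D.κ) : IsWeakPartial Ω er
    (fun z => D.V a.1 z.1 * (z.2 ^ (-α) * D.F a.2 z.2))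
    (fun z => D.V a.1 z.1 * (-α * z.2 ^ (-α - 1) * D.F a.2 z.2
      + z.2 ^ (-α) * -(D.μ a.2 * D.W a.2 z.2))) := by
  have c1 := (D.V_cont a.1).comp (continuous_fst (X := ℝ) (Y := ℝ))
  have c2 := (D.F_cont a.2).comp (continuous_snd (X := ℝ) (Y := ℝ))
  have c3 := (D.W_cont a.2).comp (continuous_snd (X := ℝ) (Y := ℝ))
  refine isWeakPartial_er ?_ ?_ fun θ _ r hr => ?_
  · exact c1.continuousOn.mul ((continuousOn_weight _).mul c2.continuousOn)
  · exact c1.continuousOn.mul (((continuousOn_const.mul (continuousOn_weight _)).mul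
      c2.continuousOn).add ((continuousOn_weight _).mul (continuousOn_const.mul c3.continuousOn).neg))
  · exact ((Real.hasDerivAt_rpow_const (p := -α) (Or.inl hr.1.ne')).fun_mul
      ((D.moder a.2).flux r)).const_mul (D.V a.1 θ)

/-- The constant in the interior `H²` estimate. -/
def regConst : ℝ :=
  (8 ^ (0 : ℝ)) ^ 2 * (D.m⁻¹ * D.m⁻¹) + (8 ^ (0 : ℝ)) ^ 2 * D.m⁻¹ + (8 ^ (α / 2)) ^ 2 * D.m⁻¹
    + (8 ^ (0 : ℝ)) ^ 2 + (8 ^ (α / 2)) ^ 2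
    + 2 * ((8 ^ (α / 2 + 1)) ^ 2 * D.m⁻¹ + (8 ^ α) ^ 2)

lemma regConst_nonneg : 0 ≤ D.regConst := by
  have := D.m_pos
  unfold regConst
  positivity

/-- Interior `H²` regularity up to the side `r = 1`. -/
lemma normH2_le (hA : IsA u h) :
    normH2 (Ωsharp (1 / 8)) (val u) ≤ ENNReal.ofReal (Real.sqrt D.regConst * ‖h‖) := by
  have hco := D.isA_iff_co.1 hA
  have hm := D.m_pos
  have hα := D.α_pos
  set x := D.co (val u) with hx
  have hsq := D.hasSum_co_sq h
  -- The three series are $\partial_{\theta\theta}u$, $\partial_r(r^\alpha\partial_ru)$ and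
  -- $r^{\alpha/2}\partial_\theta\partial_ru$. They are dominated by $\mathcal Au$ because
  -- $\nu\le\lambda$, $\mu\le\lambda$ and $\nu\mu\le\lambda^2$.
  have hν : ∀ S : Finset (D.ι × D.κ), ‖∑ a ∈ S, x a • (-D.ν a.1 • D.basis a)‖ ^ 2
      ≤ ∑ a ∈ S, D.co h a ^ 2 := by
    intro S
    simp only [smul_smul]
    rw [norm_sq_sum_smul_basis]
    refine Finset.sum_le_sum fun a _ => ?_
    rw [hco, mul_pow, mul_pow, mul_comm, neg_sq]
    have h1 := D.ν_pos a.1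
    have h2 := D.μ_pos a.2
    have h3 : D.ν a.1 ≤ D.lam a := by rw [lam]; linarith
    gcongr
  have hμ : ∀ S : Finset (D.ι × D.κ), ‖∑ a ∈ S, x a • (-D.μ a.2 • D.basis a)‖ ^ 2
      ≤ ∑ a ∈ S, D.co h a ^ 2 := by
    intro S
    simp only [smul_smul]
    rw [norm_sq_sum_smul_basis]
    refine Finset.sum_le_sum fun a _ => ?_
    rw [hco, mul_pow, mul_pow, mul_comm, neg_sq]
    have h1 := D.ν_pos a.1
    have h2 := D.μ_pos a.2
    have h3 : D.μ a.2 ≤ D.lam a := by rw [lam]; linarith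
    gcongr
  have hmix : ∀ S : Finset (D.ι × D.κ), ‖∑ a ∈ S, x a • D.mixed a‖ ^ 2
      ≤ ∑ a ∈ S, D.co h a ^ 2 := by
    intro S
    rw [norm_sq_sum_mixed]
    refine Finset.sum_le_sum fun a _ => ?_
    rw [hco, mul_pow]
    have h1 := D.ν_pos a.1
    have h2 := D.μ_pos a.2
    refine mul_le_mul_of_nonneg_right ?_ (sq_nonneg _)
    rw [lam]
    nlinarith [mul_pos h1 h2]
  have sν := (summable_of_norm_sq_sum_le hsq.summable hν).hasSum
  have sμ := (summable_of_norm_sq_sum_le hsq.summable hμ).hasSum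
  have smix := (summable_of_norm_sq_sum_le hsq.summable hmix).hasSum
  have nν := (norm_sq_tsum_le hsq.summable hν).trans_eq hsq.tsum_eq
  have nμ := (norm_sq_tsum_le hsq.summable hμ).trans_eq hsq.tsum_eq
  have nmix := (norm_sq_tsum_le hsq.summable hmix).trans_eq hsq.tsum_eq
  set s₁ := ∑' a, x a • (-D.ν a.1 • D.basis a)
  set s₂ := ∑' a, x a • (-D.μ a.2 • D.basis a)
  set s₃ := ∑' a, x a • D.mixed a
  have su := D.hasSum_e u
  have sθ : HasSum (fun a => x a • dθ (D.e a)) (dθ u) := by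
    simpa only [map_smul, dθL_apply] using su.mapL dθL
  have sr : HasSum (fun a => x a • wdr (D.e a)) (wdr u) := by
    simpa only [map_smul, wdrL_apply] using su.mapL wdrL
  -- Exponent zero makes `weightOp` the plain restriction to the interior region, so all derivatives
  -- can be handled by the same operator.
  have h0 : (0 : ℝ) ≤ 0 := le_rfl
  have h1 : 0 ≤ α / 2 := by positivity
  have h2 : 0 ≤ α := hα.le
  have h3 : 0 ≤ α / 2 + 1 := by positivity
  set U := Ωsharp (1 / 8)
  have mU : ∀ᵐ z ∂(volume.restrict U), z ∈ Ω := by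
    filter_upwards [ae_restrict_mem (measurableSet_Ωsharp _)] with z hz
    exact Ωsharp_subset hz
  have hae : ∀ {p : ℝ × ℝ → Prop}, (∀ᵐ z ∂(volume.restrict Ω), p z) →
      ∀ᵐ z ∂(volume.restrict U), p z := fun hp => ae_mono restrict_Ωsharp_le hp
  have cz : ∀ v : L2 Ω, (weightOp h0 v : ℝ × ℝ → ℝ) =ᵐ[volume.restrict U] v := by
    intro v
    filter_upwards [weightOp_coe h0 v] with z hz
    rw [hz, neg_zero, Real.rpow_zero, one_mul]
  have wmono : ∀ {e : ℝ × ℝ} {f g : ℝ × ℝ → ℝ}, IsWeakPartial Ω e f g → IsWeakPartial U e f g :=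
    fun hw => hw.mono Ωsharp_subset measurableSet_Ω
  have pθ : IsWeakPartial U eθ (weightOp h0 (val u)) (weightOp h0 (dθ u)) :=
    (wmono (incl u).2.1).congr (cz _).symm (cz _).symm
  have pr : IsWeakPartial U er (weightOp h0 (val u)) (weightOp h1 (wdr u)) :=
    (wmono (incl u).2.2).congr (cz _).symm (weightOp_coe h1 _).symm
  have pθθ : IsWeakPartial U eθ (weightOp h0 (dθ u)) (weightOp h0 s₁) := by
    refine isWeakPartial_of_hasSum (x := x) (p := fun a => weightOp h0 (dθ (D.e a)))
      (q := fun a => weightOp h0 (-D.ν a.1 • D.basis a)) (fun a => ?_) ?_ ?_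
    · refine (wmono (D.isWeakPartial_dθ_e a)).congr ?_ ?_
      · filter_upwards [cz (dθ (D.e a)), hae (D.dθ_e_coe a)] with z e1 e2
        rw [e1, e2]
      · filter_upwards [cz (-D.ν a.1 • D.basis a), hae (Lp.coeFn_smul (-D.ν a.1) (D.basis a)),
          hae (D.basis_coe a)] with z e1 e2 e3
        rw [e1, e2, Pi.smul_apply, e3, smul_eq_mul]
    · simpa only [map_smul] using sθ.mapL (weightOp h0)
    · simpa only [map_smul] using sν.mapL (weightOp h0)
  have pθr : IsWeakPartial U er (weightOp h0 (dθ u)) (weightOp h1 s₃) := by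
    refine isWeakPartial_of_hasSum (x := x) (p := fun a => weightOp h0 (dθ (D.e a)))
      (q := fun a => weightOp h1 (D.mixed a)) (fun a => ?_) ?_ ?_
    · refine (wmono (D.isWeakPartial_er_dθ_e a)).congr ?_ ?_
      · filter_upwards [cz (dθ (D.e a)), hae (D.dθ_e_coe a)] with z e1 e2
        rw [e1, e2]
      · filter_upwards [weightOp_coe h1 (D.mixed a),
          hae (tens_coe' (D.bd_coe a.1) (D.cd_coe a.2)), mU] with z e1 e2 hz
        have e : z.2 ^ (-α) = z.2 ^ (-(α / 2)) * z.2 ^ (-(α / 2)) := by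
          rw [← Real.rpow_add hz.2.1]; congr 1; ring
        rw [e1, mixed, e2, e]
        ring
    · simpa only [map_smul] using sθ.mapL (weightOp h0)
    · simpa only [map_smul] using smix.mapL (weightOp h1)
  -- $\partial_{rr}u=-\alpha r^{-1}\partial_ru+r^{-\alpha}\partial_r(r^\alpha\partial_ru)$, with
  -- $r^{-1}\partial_ru=r^{-(\alpha/2+1)}\,r^{\alpha/2}\partial_ru$.
  set s₄ : L2 U := (-α) • weightOp h3 (wdr u) + weightOp h2 s₂
  have prr : IsWeakPartial U er (weightOp h1 (wdr u)) s₄ := by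
    refine isWeakPartial_of_hasSum (x := x) (p := fun a => weightOp h1 (wdr (D.e a)))
      (q := fun a => (-α) • weightOp h3 (wdr (D.e a)) + weightOp h2 (-D.μ a.2 • D.basis a))
      (fun a => ?_) ?_ ?_
    · refine (wmono (D.isWeakPartial_er_dr_e a)).congr ?_ ?_
      · filter_upwards [weightOp_coe h1 (wdr (D.e a)), hae (D.wdr_e_coe a), mU] with z e1 e2 hz
        have e : z.2 ^ (-α) = z.2 ^ (-(α / 2)) * z.2 ^ (-(α / 2)) := by
          rw [← Real.rpow_add hz.2.1]; congr 1; ring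
        rw [e1, e2, e]
        ring
      · filter_upwards [weightOp_coe h3 (wdr (D.e a)), hae (D.wdr_e_coe a), mU,
          weightOp_coe h2 (-D.μ a.2 • D.basis a), hae (Lp.coeFn_smul (-D.μ a.2) (D.basis a)),
          hae (D.basis_coe a), Lp.coeFn_add ((-α) • weightOp h3 (wdr (D.e a)))
            (weightOp h2 (-D.μ a.2 • D.basis a)),
          Lp.coeFn_smul (-α) (weightOp h3 (wdr (D.e a)))] with z e1 e2 hz e3 e4 e5 e6 e7
        have e : z.2 ^ (-α - 1) = z.2 ^ (-(α / 2 + 1)) * z.2 ^ (-(α / 2)) := by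
          rw [← Real.rpow_add hz.2.1]; congr 1; ring
        rw [e6, Pi.add_apply, e7, Pi.smul_apply, e1, e2, e3, e4, Pi.smul_apply, e5, e]
        simp only [smul_eq_mul]
        ring
    · simpa only [map_smul] using sr.mapL (weightOp h1)
    · have t1 := ((sr.mapL (weightOp h3)).const_smul (-α)).add (sμ.mapL (weightOp h2))
      refine t1.congr_fun ?_
      intro a
      simp only [map_smul, smul_add]
      rw [smul_comm]
  have b1 := IsA.energyNorm_sq_le D hco
  have b2 := IsA.norm_val_sq_le D hco
  rw [energyNorm_sq, energyInner_eq, real_inner_self_eq_norm_sq, real_inner_self_eq_norm_sq] at b1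
  have b3 : ‖dθ u‖ ^ 2 ≤ D.m⁻¹ * ‖h‖ ^ 2 := by linarith [sq_nonneg ‖wdr u‖]
  have b4 : ‖wdr u‖ ^ 2 ≤ D.m⁻¹ * ‖h‖ ^ 2 := by linarith [sq_nonneg ‖dθ u‖]
  refine (iInf_le_of_le (weightOp h0 (val u)) <| iInf_le_of_le (weightOp h0 (dθ u)) <|
    iInf_le_of_le (weightOp h1 (wdr u)) <| iInf_le_of_le (weightOp h0 s₁) <|
    iInf_le_of_le (weightOp h1 s₃) <|
    iInf_le_of_le s₄ <|
    iInf_le_of_le (cz _).symm <| iInf_le_of_le pθ <| iInf_le_of_le pr <| iInf_le_of_le pθθ <|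
    iInf_le_of_le pθr <| iInf_le_of_le prr le_rfl).trans (ENNReal.ofReal_le_ofReal ?_)
  rw [← Real.sqrt_sq (norm_nonneg h), ← Real.sqrt_mul D.regConst_nonneg]
  refine Real.sqrt_le_sqrt ?_
  have c1 := norm_weightOp_sq_le h0 b2
  have c2 := norm_weightOp_sq_le h0 b3
  have c3 := norm_weightOp_sq_le h1 b4
  have c4 := norm_weightOp_sq_le h0 nν
  have c5 := norm_weightOp_sq_le h1 nmix
  have c6 := norm_weightOp_sq_le h3 b4
  have c7 := norm_weightOp_sq_le h2 nμ
  have c8 : ‖s₄‖ ^ 2 ≤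
      2 * (‖weightOp h3 (wdr u)‖ ^ 2 + ‖weightOp h2 s₂‖ ^ 2) := by
    have d1 : ‖(-α) • weightOp h3 (wdr u)‖ ≤ ‖weightOp h3 (wdr u)‖ := by
      rw [norm_smul, norm_neg, Real.norm_eq_abs, abs_of_pos hα]
      exact mul_le_of_le_one_left (norm_nonneg _) D.α_lt.le
    have d2 := norm_add_le ((-α) • weightOp h3 (wdr u)) (weightOp h2 s₂)
    calc _ ≤ (‖weightOp h3 (wdr u)‖ + ‖weightOp h2 s₂‖) ^ 2 :=
          pow_le_pow_left₀ (norm_nonneg _) (by linarith) 2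
      _ ≤ _ := by nlinarith [sq_nonneg (‖weightOp h3 (wdr u)‖ - ‖weightOp h2 s₂‖)]
  unfold regConst
  linarith

end elliptic

/-! ### Higher regularity in time -/

variable {T : ℝ} {φ0 φ1 : H01 α} {f f' : L2t T (L2 Ω)} {φ : L2t T (H01 α)}
  {φt : L2t T (L2 Ω)} {φtt : L2t T (Hneg1 α)} {x y : D.ι × D.κ → ℝ → ℝ} {h₀ : L2 Ω}

/-- The squared size of the regular data of a mode. -/
def regData (h₀ : L2 Ω) (φ1 : H01 α) (f f' : L2t T (L2 Ω)) (a : D.ι × D.κ) : ℝ :=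
  D.co h₀ a ^ 2 + D.lam a * D.co (val φ1) a ^ 2 + (∫ t in Ioo 0 T, D.co (f t) a ^ 2)
    + ∫ t in Ioo 0 T, D.co (f' t) a ^ 2

lemma regData_nonneg (a : D.ι × D.κ) : 0 ≤ D.regData h₀ φ1 f f' a := by
  have := D.lam_pos a
  have h1 : 0 ≤ ∫ t in Ioo 0 T, D.co (f t) a ^ 2 := integral_nonneg fun _ => sq_nonneg _
  have h2 : 0 ≤ ∫ t in Ioo 0 T, D.co (f' t) a ^ 2 := integral_nonneg fun _ => sq_nonneg _
  unfold regData
  positivity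

lemma sum_regData_le (S : Finset (D.ι × D.κ)) : ∑ a ∈ S, D.regData h₀ φ1 f f' a ≤
    ‖h₀‖ ^ 2 + energyNorm φ1 ^ 2 + ‖f‖ ^ 2 + ‖f'‖ ^ 2 := by
  simp only [regData, Finset.sum_add_distrib]
  gcongr
  · exact D.sum_co_sq_le h₀ S
  · exact sum_le_hasSum S (fun a _ => mul_nonneg (D.lam_pos a).le (sq_nonneg _))
      (D.hasSum_energy φ1)
  · exact D.sum_integral_co_sq_le f S
  · exact D.sum_integral_co_sq_le f' S

lemma summable_regData : Summable (D.regData h₀ φ1 f f') :=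
  summable_of_sum_le D.regData_nonneg D.sum_regData_le

/-- The constant in the regularity estimate of a mode. -/
def modeConst (T : ℝ) : ℝ := 2 * ((2 / T + 2 * T) + (2 + 4 * T) * (2 * (2 / T + 2 * T) + 3))

lemma modeConst_nonneg (hT : 0 < T) : 0 ≤ modeConst T := by
  unfold modeConst
  positivity

/-- The velocity $y_a$ is itself an oscillator, forced by the coefficient of $f'$, with initial data
the coefficient of $\varphi^1$ and $f_a(0)-(\mathcal A\varphi^0)_a$. Its energy bounds
$\lambda_ay_a^2$ and $(f_a-\lambda_ax_a)^2$, and $\lambda_ax_a$ is recovered from the latter with a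
pointwise bound of $f_a$. -/
lemma mode_regularity (hT : 0 < T) (hA : IsA φ0 h₀) (hf : IsWeakTimeDeriv T f f')
    (hc : D.IsCoeff φ0 (val φ1) f φ φt φtt x y) (a : D.ι × D.κ) :
    ∀ᵐ t ∂(volume.restrict (Ioo 0 T)),
      (D.lam a * D.co (val (φ t)) a) ^ 2 ≤ modeConst T * D.regData h₀ φ1 f f' a ∧
      D.lam a * D.co (φt t) a ^ 2 ≤ modeConst T * D.regData h₀ φ1 f f' a ∧
      (D.co (f t) a - D.lam a * D.co (val (φ t)) a) ^ 2 ≤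
        modeConst T * D.regData h₀ φ1 f f' a := by
  have hd := hf.clm_comp (L2t.integrableOn f) (L2t.integrableOn f') (D.coL a)
  -- The absolutely continuous representative of the coefficient of $f$; its values at $0$ and $t$
  -- are meaningful, unlike those of the $L^2$ class.
  obtain ⟨F, hF, hFf⟩ := hd.exists_isPrim hT ((D.coL a).integrable_comp (L2t.integrableOn f))
    ((D.coL a).integrable_comp (L2t.integrableOn f'))
  have hosc := (hc.osc a).congr hT.le hFf
  have hder := hosc.deriv hF hT.le
  have hm' : MemLp (fun t => (D.coL a) (f' t)) 2 (volume.restrict (Ioo 0 T)) := D.memLp_co f' a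
  have hlam := D.lam_pos a
  have eF : ∫ t in Ioo 0 T, F t ^ 2 = ∫ t in Ioo 0 T, D.co (f t) a ^ 2 := by
    apply integral_congr_ae
    filter_upwards [hFf] with t ht
    rw [← ht, coL_apply]
  have hreg : D.regData h₀ φ1 f f' a = D.co h₀ a ^ 2 + D.lam a * D.co (val φ1) a ^ 2
    + (∫ t in Ioo 0 T, D.co (f t) a ^ 2) + ∫ t in Ioo 0 T, D.co (f' t) a ^ 2 := rfl
  have p1 : 0 ≤ ∫ t in Ioo 0 T, D.co (f t) a ^ 2 := integral_nonneg fun _ => sq_nonneg _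
  have p2 : 0 ≤ ∫ t in Ioo 0 T, D.co (f' t) a ^ 2 := integral_nonneg fun _ => sq_nonneg _
  have p3 : 0 ≤ D.lam a * D.co (val φ1) a ^ 2 := by positivity
  set R := D.regData h₀ φ1 f f' a
  have hR : 0 ≤ R := D.regData_nonneg a
  have hFle : ∀ t ∈ Icc 0 T, F t ^ 2 ≤ (2 / T + 2 * T) * R := by
    intro t ht
    have h1 := hF.sq_le hT hm' ht
    rw [eF] at h1
    have q1 : 2 / T * (∫ t in Ioo 0 T, D.co (f t) a ^ 2) ≤ 2 / T * R := by
      gcongr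
      rw [hreg]
      linarith [sq_nonneg (D.co h₀ a)]
    have q2 : 2 * T * (∫ t in Ioo 0 T, D.co (f' t) a ^ 2) ≤ 2 * T * R := by
      gcongr
      rw [hreg]
      linarith [sq_nonneg (D.co h₀ a)]
    simp only [coL_apply] at h1
    linarith
  set L := 2 / T + 2 * T with hL
  have hL0 : 0 ≤ L := by positivity
  filter_upwards [hFf, hc.co_val, hc.co_deriv, ae_restrict_mem measurableSet_Ioo]
    with t e1 e2 e3 ht
  have ht' := Ioo_subset_Icc_self ht
  have h0 : (0 : ℝ) ∈ Icc 0 T := ⟨le_rfl, hT.le⟩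
  have hE := hder.energy_le hT hlam.le hm' ht'
  simp only [coL_apply] at hE e1
  rw [hc.x_zero, hc.y_zero, ← D.isA_iff_co.1 hA a] at hE
  have k0 := hFle 0 h0
  have kt := hFle t ht'
  -- The initial energy of the differentiated oscillator: $2L$ comes from $F(0)$, and the constant
  -- $3$ generously covers the remaining data.
  have k1 : (F 0 - D.co h₀ a) ^ 2 + D.lam a * D.co (val φ1) a ^ 2
      + ∫ t in Ioo 0 T, D.co (f' t) a ^ 2 ≤ (2 * L + 3) * R := by
    have : (F 0 - D.co h₀ a) ^ 2 ≤ 2 * F 0 ^ 2 + 2 * D.co h₀ a ^ 2 := by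
      nlinarith [sq_nonneg (F 0 + D.co h₀ a)]
    nlinarith [sq_nonneg (D.co h₀ a)]
  have k2 : (F t - D.lam a * x a t) ^ 2 + D.lam a * y a t ^ 2 ≤ (2 + 4 * T) * ((2 * L + 3) * R) :=
    hE.trans (mul_le_mul_of_nonneg_left k1 (by positivity))
  have k3 : 0 ≤ D.lam a * y a t ^ 2 := by positivity
  have k4 : 0 ≤ L * R := by positivity
  have k5 : 0 ≤ (2 + 4 * T) * ((2 * L + 3) * R) := by positivity
  have k6 : modeConst T * R = 2 * (L * R) + 2 * ((2 + 4 * T) * ((2 * L + 3) * R)) := by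
    rw [modeConst, ← hL]
    ring
  rw [e1, e2, e3, k6]
  refine ⟨?_, ?_, ?_⟩
  · nlinarith [sq_nonneg (2 * F t - D.lam a * x a t)]
  · linarith [sq_nonneg (F t - D.lam a * x a t)]
  · linarith

lemma norm_sq_le_of_co {k : L2 Ω} {m : D.ι × D.κ → ℝ} {c : ℝ} (h : ∀ a, D.co k a ^ 2 ≤ m a)
    (hm : ∀ S : Finset (D.ι × D.κ), ∑ a ∈ S, m a ≤ c) : ‖k‖ ^ 2 ≤ c :=
  hasSum_le_of_sum_le (D.hasSum_co_sq k) fun S =>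
    (Finset.sum_le_sum fun a _ => h a).trans (hm S)

lemma energyNorm_sq_le_of_co {v : H01 α} {m : D.ι × D.κ → ℝ} {c : ℝ}
    (h : ∀ a, D.lam a * D.co (val v) a ^ 2 ≤ m a)
    (hm : ∀ S : Finset (D.ι × D.κ), ∑ a ∈ S, m a ≤ c) : energyNorm v ^ 2 ≤ c :=
  hasSum_le_of_sum_le (D.hasSum_energy v) fun S =>
    (Finset.sum_le_sum fun a _ => h a).trans (hm S)

/-- The constant in the regularity estimate. -/
def solConst (T : ℝ) : ℝ :=
  (Real.sqrt D.regConst + Real.sqrt (D.m⁻¹ * D.m⁻¹ + D.m⁻¹ + 1) + 2) * Real.sqrt (modeConst T)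

lemma solConst_nonneg : 0 ≤ D.solConst T := by
  unfold solConst
  positivity

/-- Higher regularity of weak solutions. -/
lemma regularity (hT : 0 < T) (hA : IsA φ0 h₀) (hf : IsWeakTimeDeriv T f f')
    (hc : D.IsCoeff φ0 (val φ1) f φ φt φtt x y) :
    essSup (fun t => normH2 (Ωsharp (1 / 8)) (val (φ t)) + normDA (φ t)
        + normH01 α (φt t) + normL2 (φtt t)) (volume.restrict (Ioo 0 T)) ≤
      ENNReal.ofReal (D.solConst T * (‖h₀‖ + energyNorm φ1 + Real.sqrt (‖f‖ ^ 2 + ‖f'‖ ^ 2))) := by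
  refine essSup_le_of_ae_le _ ?_
  have hmode := ae_all_iff.2 fun a => D.mode_regularity hT hA hf hc a
  set R := ‖h₀‖ + energyNorm φ1 + Real.sqrt (‖f‖ ^ 2 + ‖f'‖ ^ 2) with hRd
  have r1 := norm_nonneg h₀
  have r2 := energyNorm_nonneg φ1
  have r3 := Real.sqrt_nonneg (‖f‖ ^ 2 + ‖f'‖ ^ 2)
  have r4 := Real.sq_sqrt (show 0 ≤ ‖f‖ ^ 2 + ‖f'‖ ^ 2 by positivity)
  have hR0 : 0 ≤ R := by positivity
  have hM := modeConst_nonneg hT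
  have hsum : ∀ S : Finset (D.ι × D.κ), ∑ a ∈ S, modeConst T * D.regData h₀ φ1 f f' a ≤
      (Real.sqrt (modeConst T) * R) ^ 2 := by
    intro S
    rw [← Finset.mul_sum, mul_pow, Real.sq_sqrt hM]
    refine mul_le_mul_of_nonneg_left (D.sum_regData_le S |>.trans ?_) hM
    rw [hRd]
    nlinarith [mul_nonneg r1 r2, mul_nonneg r1 r3, mul_nonneg r2 r3]
  set N := Real.sqrt (modeConst T) * R with hN
  have hN0 : 0 ≤ N := by positivity
  have hsm : Summable fun a => modeConst T * D.regData h₀ φ1 f f' a :=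
    D.summable_regData.mul_left _
  filter_upwards [hmode, hc.deriv_two] with t ht htt
  -- Square-summable coefficients are realised by functions: $k$ is $\mathcal A\varphi(t)$, and $v$
  -- is $\partial_t\varphi(t)$ as an element of $H^1_0(\Omega;w)$.
  obtain ⟨k, hk⟩ := D.exists_co hsm fun a => (ht a).1
  obtain ⟨v, hv⟩ := D.exists_co_val hsm fun a => (ht a).2.1
  have hvt : val v = φt t := D.ext_co hv
  have hAk : IsA (φ t) k := D.isA_iff_co.2 hk
  have nk : ‖k‖ ≤ N := abs_le_of_sq_le_sq' (D.norm_sq_le_of_co (fun a => by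
    rw [hk]; exact (ht a).1) hsum) hN0 |>.2
  have nv : energyNorm v ≤ N := abs_le_of_sq_le_sq' (D.energyNorm_sq_le_of_co (fun a => by
    rw [hv]; exact (ht a).2.1) hsum) hN0 |>.2
  have nfk : ‖f t - k‖ ≤ N := abs_le_of_sq_le_sq' (D.norm_sq_le_of_co (fun a => by
    rw [co_sub, hk]; exact (ht a).2.2) hsum) hN0 |>.2
  -- Once $\mathcal A\varphi(t)$ is in $L^2(\Omega)$, the equation shows that
  -- $\partial_{tt}\varphi(t)=f(t)-\mathcal A\varphi(t)$ is too.
  have htt' : (toHneg1 (f t - k) : Hneg1 α) = φtt t := by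
    rw [htt]
    refine D.dual_ext fun a => ?_
    rw [sub_apply, toHneg1_e, toHneg1_e, energyDual_e, co_sub, hk]
  have t1 : normH2 (Ωsharp (1 / 8)) (val (φ t)) ≤ ENNReal.ofReal (Real.sqrt D.regConst * N) :=
    (D.normH2_le hAk).trans (ENNReal.ofReal_le_ofReal (by gcongr))
  have t2 : normDA (φ t) ≤ ENNReal.ofReal (Real.sqrt (D.m⁻¹ * D.m⁻¹ + D.m⁻¹ + 1) * N) :=
    (D.normDA_le hAk).trans (ENNReal.ofReal_le_ofReal (by gcongr))
  have t3 : normH01 α (φt t) ≤ ENNReal.ofReal N :=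
    (iInf₂_le v hvt).trans (ENNReal.ofReal_le_ofReal nv)
  have t4 : normL2 (φtt t) ≤ ENNReal.ofReal N := by
    refine (iInf₂_le (f t - k) htt').trans ?_
    rw [← ofReal_norm]
    exact ENNReal.ofReal_le_ofReal nfk
  refine (add_le_add (add_le_add (add_le_add t1 t2) t3) t4).trans (le_of_eq ?_)
  rw [← ENNReal.ofReal_add (by positivity) (by positivity),
    ← ENNReal.ofReal_add (by positivity) (by positivity),
    ← ENNReal.ofReal_add (by positivity) (by positivity)]
  congr 1
  rw [solConst, hN]
  ring

/-- The image under $\mathcal A$ is unique, so the infimum defining `normDA` runs over a single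
function. -/
lemma norm_le_normDA (D : Spec α) (hA : IsA φ0 h₀) : ENNReal.ofReal ‖h₀‖ ≤ normDA φ0 := by
  refine le_iInf₂ fun h hh => ENNReal.ofReal_le_ofReal ?_
  have : h = h₀ := D.ext_co fun a => by rw [D.isA_iff_co.1 hh, D.isA_iff_co.1 hA]
  rw [this]
  exact Real.le_sqrt_of_sq_le (by nlinarith [sq_nonneg ‖φ0‖])

end Spec

end

end DegenerateWave

/-! ### The theorem. -/

theorem theorem03p11 (α : ℝ) (hα₀ : 0 < α) (hα₁ : α < 1) (T : ℝ) (hT : 0 < T) :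
    -- existence and uniqueness of the weak solution
    (∀ (φ0 : H01 α) (φ1 : L2 Ω) (f : L2t T (L2 Ω)),
      ∃! φ : L2t T (H01 α), ∃ (φt : L2t T (L2 Ω)) (φtt : L2t T (Hneg1 α)),
        IsWeakSolution α T φ0 φ1 f φ φt φtt) ∧
    -- energy estimate and hidden trace estimate
    (∃ C : ℝ, 0 < C ∧
      ∀ (φ0 : H01 α) (φ1 : L2 Ω) (f : L2t T (L2 Ω))
        (φ : L2t T (H01 α)) (φt : L2t T (L2 Ω)) (φtt : L2t T (Hneg1 α)),
        IsWeakSolution α T φ0 φ1 f φ φt φtt →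
        ∃ g : L2t T L2Top, IsTopTrace T φ g ∧
          essSup (fun t => ENNReal.ofReal (energyNorm (φ t)) + ‖φt t‖ₑ)
              (volume.restrict (Ioo 0 T))
            + (∫⁻ t in Ioo 0 T, hneg1Norm (φtt t) ^ 2) ^ (1 / 2 : ℝ)
            + ‖g‖ₑ
          ≤ ENNReal.ofReal (C * (energyNorm φ0 + ‖φ1‖ + ‖f‖))) ∧
    -- higher regularity
    (∃ C : ℝ, 0 < C ∧
      ∀ (φ0 : H01 α) (φ1 : H01 α) (f f' : L2t T (L2 Ω))
        (φ : L2t T (H01 α)) (φt : L2t T (L2 Ω)) (φtt : L2t T (Hneg1 α)),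
        MemDA φ0 → IsWeakTimeDeriv T f f' →
        IsWeakSolution α T φ0 (val φ1) f φ φt φtt →
          essSup (fun t => normH2 (Ωsharp (1 / 8)) (val (φ t)) + normDA (φ t)
              + normH01 α (φt t) + normL2 (φtt t))
            (volume.restrict (Ioo 0 T))
          ≤ ENNReal.ofReal C * (normDA φ0 + ENNReal.ofReal (energyNorm φ1)
              + ENNReal.ofReal (Real.sqrt (‖f‖ ^ 2 + ‖f'‖ ^ 2)))) := by
  -- The spectral data are fixed before any solution is considered; all constants below are built
  -- from them, α and $T$ alone.
  obtain ⟨D⟩ := nonempty_spec hα₀ hα₁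
  refine ⟨fun φ0 φ1 f => ?_, ?_, ?_⟩
  · obtain ⟨φ, φt, φtt, h⟩ := D.exists_isWeakSolution hT φ0 φ1 f
    refine ⟨φ, ⟨φt, φtt, h⟩, ?_⟩
    rintro φ' ⟨φt', φtt', h'⟩
    obtain ⟨x, y, hc⟩ := D.exists_isCoeff hT h
    obtain ⟨x', y', hc'⟩ := D.exists_isCoeff hT h'
    exact D.eq_of_isCoeff hT hc' hc
  · refine ⟨2 * Real.sqrt (2 + 4 * T) + Real.sqrt (2 * D.m⁻¹ + 2 * T * (2 + 4 * T))
      + Real.sqrt (5 + 14 * T + 12 * T ^ 2), by positivity, fun φ0 φ1 f φ φt φtt h => ?_⟩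
    obtain ⟨x, y, hc⟩ := D.exists_isCoeff hT h
    obtain ⟨g, hg, hgn⟩ := D.exists_isTopTrace hT hc
    refine ⟨g, hg, ?_⟩
    have n1 := energyNorm_nonneg φ0
    have n2 := norm_nonneg φ1
    have n3 := norm_nonneg f
    rw [add_mul, ENNReal.ofReal_add (by positivity) (by positivity)]
    refine add_le_add (D.energy_estimate hT hc) ?_
    rw [← ofReal_norm]
    refine ENNReal.ofReal_le_ofReal (abs_le_of_sq_le_sq' (hgn.trans ?_) (by positivity)).2
    rw [mul_pow, Real.sq_sqrt (by positivity)]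
    refine mul_le_mul_of_nonneg_left ?_ (by positivity)
    nlinarith [mul_nonneg n1 n2, mul_nonneg n1 n3, mul_nonneg n2 n3]
  -- The added $1$ only provides strict positivity.
  · refine ⟨D.solConst T + 1, by linarith [D.solConst_nonneg (T := T)],
      fun φ0 φ1 f f' φ φt φtt hA hf h => ?_⟩
    obtain ⟨h₀, hh₀⟩ := hA
    obtain ⟨x, y, hc⟩ := D.exists_isCoeff hT h
    refine (D.regularity hT hh₀ hf hc).trans ?_
    have n1 := energyNorm_nonneg φ1
    have hC := D.solConst_nonneg (T := T)
    rw [ENNReal.ofReal_mul hC, ENNReal.ofReal_add (by positivity) (by positivity),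
      ENNReal.ofReal_add (by positivity) (by positivity)]
    refine mul_le_mul' (ENNReal.ofReal_le_ofReal (by linarith)) ?_
    gcongr
    exact D.norm_le_normDA hh₀
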